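/- **Setting.** Let $d\in\{2,3\}$, and let $\mathcal T_h$ be a finite conforming mesh of nondegenerate closed $d$-simplices in $\mathbb R^d$. Let $\Omega$ be the interior of the union of its elements (for instance any Lipschitz polygon or polyhedron with such a mesh). Let $h=\max_T h_T$ with $h_T=\operatorname{diam}T$, and suppose that $\mathcal T_h$ is shape regular: every element $T$ contains a ball of diameter $C_{SR}h_T$, where $C_{SR}>0$. Let $V^h$ be the space of continuous functions that are polynomials of degree at most $r$ $(r\ge 1)$ on each element and vanish on $\partial\Omega$. Its degrees of freedom $l$ are the Lagrange nodes of degree $r$ lying in $\Omega$, and $\phi_l$ denote the nodal basis functions. Let $A:\Omega\to\mathbb R^{d\times d}$ be measurable and symmetric and $n:\Omega\to\mathbb R$ measurable, with $|\xi|^2\le A(x)\xi\cdot\xi\le a_{\max}|\xi|^2$ for all $\xi\in\mathbb R^d$ and $n_{\min}\le n(x)\le 1$ for a.e. $x\in\Omega$, where $a_{\max}\ge1$ and $0<n_{\min}\le 1$. For $k>0$ and an open set $D\subseteq\Omega$ composed of elements put $$b_D(u,v)=\int_D (A\nabla u\cdot\nabla v-k^2nuv)\,dx,\qquad (u,v)_{1,k,D}=\int_D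 (A\nabla u\cdot\nabla v+k^2nuv)\,dx,\qquad \|u\|_{1,k,D}^2=(u,u)_{1,k,D},$$ and omit $D$ when $D=\Omega$. Let $\widetilde V_D=\{v|_D:v\in V^h\}$ and $V_D=\{v|_D: v\in V^h,\ v|_{\partial D}=0\}$, let $E_D:V_D\to V^h$ be the extension by zero, and let $\operatorname{dof}(D)=\{l:\operatorname{supp}\phi_l\subseteq\overline D\}$. Assume the inverse estimate $\|\nabla v\|_{L^2(T)}\le C_{inv}\,k\,\|v\|_{L^2(T)}$ for all $T\in\mathcal T_h$ and $v\in V^h$, with some $C_{inv}\ge1$. Let $\{\Omega_j^\ell\}_{j=1}^Q$ (local) and $\{\Omega_i^c\}_{i=1}^N$ (coarse) be two covers of $\Omega$, $\Omega=\bigcup_j\Omega_j^\ell=\bigcup_i\Omega_i^c$, whose members are interiors of unions of elements. Let $\Lambda_\ell$ and $\Lambda_c$ be the largest number of members of the respective cover that contain (in their closure) one and the same element. Assume that the local cover has overlap $\delta_\ell\ge k^{-1}$: every $x\in\Omega$ lies in some $\Omega_j^\ell$ with $\operatorname{dist}(x,\partial\Omega_j^\ell\setminus\partial\Omega)\ge\delta_\ell$.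 Assume that the coarse subdomains are nondegenerate with parameter $M\in\mathbb N$: in each $\Omega_i^c$, from every element of $\overline{\Omega_i^c}$ one can reach, in at most $M$ steps between elements of $\overline{\Omega_i^c}$ having a common edge, an element with a Lagrange node that is not on $\partial\Omega_i^c\setminus\partial\Omega$. Write $E_j^\ell=E_{\Omega_j^\ell}$ and $E_i^c=E_{\Omega_i^c}$. For each $i$ set $\mu_l=\#\{i':l\in\operatorname{dof}(\Omega_{i'}^c)\}$ and, for $v\in\widetilde V_{\Omega_i^c}$, $\Xi_i^c(v)=\sum_{l\in\operatorname{dof}(\Omega_i^c)}\mu_l^{-1}v(x_l)\,\phi_l|_{\Omega_i^c}$, where $x_l$ is the node of $l$; also let $c_i(w,v)=(\Xi_i^c(w),\Xi_i^c(v))_{1,k,\Omega_i^c}$. Let $q_i=\dim\widetilde V_{\Omega_i^c}-\dim\ker c_i$, and let $(p^i_j,\lambda^i_j)_{1\le j\le q_i}$ be eigenpairs of the problem $b_{\Omega_i^c}(p,v)=\lambda c_i(p,v)$ for all $v\in\widetilde V_{\Omega_i^c}$, with $p^i_j\in \widetilde V_{\Omega_i^c}$ orthonormal with respect to $c_i$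 and $\lambda_1^i\le\dots\le\lambda_{q_i}^i$. Let $m_i\ge1$ with $m_i+1\le q_i$ and $\lambda^i_{m_i+1}>0$. Put $\Pi_{m_i}v=\sum_{j=1}^{m_i}c_i(v,p^i_j)p^i_j$, $$V_0=\operatorname{span}\{E_i^c\Xi_i^c(p^i_j):1\le j\le m_i,\ 1\le i\le N\},\qquad \Theta=\frac1{\min_i\lambda^i_{m_i+1}},\qquad C_*=\Lambda_c^2\,n_{\min}^{-1}\,(a_{\max}C_{inv}^2+2)^2\,C_{inv}^2 .$$ **Lemma (stable decomposition).** There are constants $C_1>0$ and $C_3\ge1$, depending only on $d$, $r$, $C_{SR}$ and $M$, such that in the above setting, whenever $(kh)^2\le C_1$, the following holds for every $v\in V^h$. The function $z_0=\sum_{i=1}^N E_i^c\,\Xi_i^c\bigl(\Pi_{m_i}(v|_{\Omega_i^c})\bigr)$ belongs to $V_0$, and there are $z_j\in V_{\Omega_j^\ell}$, $j=1,\dots,Q$, with $$v=z_0+\sum_{j=1}^Q E_j^\ell z_j\qquad\text{and}\qquad \|z_0\|_{1,k}^2+\sum_{j=1}^Q\|z_j\|_{1,k,\Omega_j^\ell}^2\le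 C_3\bigl(1+\Lambda_\ell\Lambda_c^2\,a_{\max}\,n_{\min}^{-1}\,C_*\,\Theta\bigr)\|v\|_{1,k}^2 .$$ -/

import Mathlib

open MeasureTheory

noncomputable section

namespace HkGenEO

/-- The Euclidean space `ℝ^d`. -/
abbrev Sp (d : ℕ) := EuclideanSpace ℝ (Fin d)

/-! ### Meshes, the domain, subdomains -/

/-- The closed simplex with vertex set `T`. -/
def cell {d : ℕ} (T : Finset (Sp d)) : Set (Sp d) := convexHull ℝ (T : Set (Sp d))

/-- A conforming simplicial mesh: finitely many nondegenerate `d`-simplices (given by their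
vertex sets), any two of which meet in the simplex spanned by their common vertices. -/
structure Mesh (d : ℕ) where
  elems : Finset (Finset (Sp d))
  card_eq : ∀ T ∈ elems, T.card = d + 1
  indep : ∀ T ∈ elems, AffineIndependent ℝ (fun a : T => (a : Sp d))
  conforming : ∀ T ∈ elems, ∀ T' ∈ elems,
    cell T ∩ cell T' ⊆ convexHull ℝ ((T : Set (Sp d)) ∩ (T' : Set (Sp d)))

/-- The open polyhedral set composed of a given set of mesh elements. -/
def region {d : ℕ} (S : Finset (Finset (Sp d))) : Set (Sp d) := interior (⋃ T ∈ S, cell T)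

/-- The domain `Ω` on which the mesh lives. -/
def Mesh.domain {d : ℕ} (𝒯 : Mesh d) : Set (Sp d) := region 𝒯.elems

/-- The mesh size `h`, the maximum of the diameters `h_T`. -/
def Mesh.size {d : ℕ} (𝒯 : Mesh d) : ℝ := ⨆ T : 𝒯.elems, Metric.diam (cell (T : Finset (Sp d)))

/-- Shape regularity `ρ_T ≥ C h_T`: each element contains a ball of diameter `C h_T`. -/
def Mesh.ShapeRegular {d : ℕ} (𝒯 : Mesh d) (C : ℝ) : Prop :=
  ∀ T ∈ 𝒯.elems, ∃ x, Metric.closedBall x (C * Metric.diam (cell T) / 2) ⊆ cell T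

/-- A cover of the domain by open subdomains, each composed of mesh elements; the `i`-th
subdomain is `region (S i)`. -/
structure IsCover {d n : ℕ} (𝒯 : Mesh d) (S : Fin n → Finset (Finset (Sp d))) : Prop where
  subset : ∀ i, S i ⊆ 𝒯.elems
  covers : 𝒯.domain = ⋃ i, region (S i)

open Classical in
/-- `Λ`: the largest number of subdomains of the cover that contain a given element. -/
def multiplicity {d n : ℕ} (𝒯 : Mesh d) (S : Fin n → Finset (Finset (Sp d))) : ℕ :=
  𝒯.elems.sup fun T => (Finset.univ.filter fun i => T ∈ S i).card

/-- The cover has overlap at least `δ`: each point of `Ω` lies in a subdomain `Ω_j` with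
`dist(x, ∂Ω_j \ ∂Ω) ≥ δ`. -/
def HasOverlap {d n : ℕ} (𝒯 : Mesh d) (S : Fin n → Finset (Finset (Sp d))) (δ : ℝ) : Prop :=
  ∀ x ∈ 𝒯.domain, ∃ j, x ∈ region (S j) ∧
    ∀ y ∈ frontier (region (S j)) ∩ 𝒯.domain, δ ≤ dist x y

/-! ### Lagrange finite elements -/

/-- `V^h`: continuous functions that are polynomials of degree at most `r` on each element and
vanish on `∂Ω`. Functions on `Ω` are represented by their extension by zero to `ℝ^d`. -/
def Mesh.Vh {d : ℕ} (𝒯 : Mesh d) (r : ℕ) : Submodule ℝ (Sp d → ℝ) where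
  carrier := {v | Continuous v ∧ (∀ x, x ∉ 𝒯.domain → v x = 0) ∧
    ∀ T ∈ 𝒯.elems, ∃ p : MvPolynomial (Fin d) ℝ, p.totalDegree ≤ r ∧
      ∀ x ∈ cell T, v x = MvPolynomial.eval (fun i => x i) p}
  zero_mem' := ⟨continuous_const, fun _ _ => rfl, fun _ _ => ⟨0, by simp, by simp⟩⟩
  add_mem' := by
    rintro u v ⟨hu, hu', hu''⟩ ⟨hv, hv', hv''⟩
    refine ⟨hu.add hv, fun x hx => by simp [hu' x hx, hv' x hx], fun T hT => ?_⟩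
    obtain ⟨p, hp, hp'⟩ := hu'' T hT
    obtain ⟨q, hq, hq'⟩ := hv'' T hT
    exact ⟨p + q, (MvPolynomial.totalDegree_add p q).trans (max_le hp hq),
      fun x hx => by simp [hp' x hx, hq' x hx]⟩
  smul_mem' := by
    rintro c v ⟨hv, hv', hv''⟩
    refine ⟨hv.const_smul c, fun x hx => by simp [hv' x hx], fun T hT => ?_⟩
    obtain ⟨p, hp, hp'⟩ := hv'' T hT
    exact ⟨c • p, (MvPolynomial.totalDegree_smul_le c p).trans hp,
      fun x hx => by simp [hp' x hx]⟩

/-- Restriction `v ↦ v|_D`; a function on `D` is represented by its extension by zero. -/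
def restr {d : ℕ} (D : Set (Sp d)) : (Sp d → ℝ) →ₗ[ℝ] (Sp d → ℝ) where
  toFun v := D.indicator v
  map_add' u v := Set.indicator_add D u v
  map_smul' c v := Set.indicator_const_smul D c v

/-- `Ṽ_D = { v|_D : v ∈ V^h }`. -/
def Mesh.VTilde {d : ℕ} (𝒯 : Mesh d) (r : ℕ) (D : Set (Sp d)) : Submodule ℝ (Sp d → ℝ) :=
  (𝒯.Vh r).map (restr D)

/-- Functions vanishing on a given set. -/
def vanishingOn {d : ℕ} (F : Set (Sp d)) : Submodule ℝ (Sp d → ℝ) where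
  carrier := {v | ∀ x ∈ F, v x = 0}
  zero_mem' := fun _ _ => rfl
  add_mem' := fun hu hv x hx => by simp [hu x hx, hv x hx]
  smul_mem' := fun c v hv x hx => by simp [hv x hx]

/-- `V_D`: the restrictions to `D` of those `v ∈ V^h` that vanish on `∂D`. As functions on `D` are
represented by their extension by zero, the zero extension `E_D : V_D → V^h` is the inclusion. -/
def Mesh.V {d : ℕ} (𝒯 : Mesh d) (r : ℕ) (D : Set (Sp d)) : Submodule ℝ (Sp d → ℝ) :=
  (𝒯.Vh r ⊓ vanishingOn (frontier D)).map (restr D)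

open Classical in
/-- The Lagrange nodes of degree `r` of a simplex: the points `∑ (α_a / r) a` over the vertices `a`,
with nonnegative integers `α_a` of sum `r`. -/
def lagrangeNodes {d : ℕ} (r : ℕ) (T : Finset (Sp d)) : Finset (Sp d) :=
  (T.piAntidiag r).image fun α => ∑ a ∈ T, ((α a : ℝ) / (r : ℝ)) • a

open Classical in
/-- The degrees of freedom of `V^h`, identified with the Lagrange nodes of the mesh in `Ω`. -/
def Mesh.nodes {d : ℕ} (𝒯 : Mesh d) (r : ℕ) : Finset (Sp d) :=
  (𝒯.elems.biUnion (lagrangeNodes r)).filter (· ∈ 𝒯.domain)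

open Classical in
/-- The nodal basis function at the node `l`: the element of `V^h` with nodal values `δ_{l,l'}`. -/
def Mesh.nodalBasis {d : ℕ} (𝒯 : Mesh d) (r : ℕ) (l : Sp d) : Sp d → ℝ :=
  if h : ∃ φ ∈ 𝒯.Vh r, ∀ y ∈ 𝒯.nodes r, φ y = if y = l then 1 else 0 then h.choose else 0

open Classical in
/-- `dof(D)`: the degrees of freedom with `supp φ_l ⊆ closure D`. -/
def Mesh.dof {d : ℕ} (𝒯 : Mesh d) (r : ℕ) (D : Set (Sp d)) : Finset (Sp d) :=
  (𝒯.nodes r).filter fun l => tsupport (𝒯.nodalBasis r l) ⊆ closure D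

/-! ### Bilinear forms and norms -/

/-- `a_D(u,v) = ∫_D A∇u · ∇v`. -/
def aForm {d : ℕ} (A : Sp d → Matrix (Fin d) (Fin d) ℝ) (D : Set (Sp d)) (u v : Sp d → ℝ) : ℝ :=
  ∫ x in D, inner ℝ (Matrix.toEuclideanLin (A x) (gradient u x)) (gradient v x)

/-- `(u,v)_{n,D} = ∫_D n u v`. -/
def nForm {d : ℕ} (n : Sp d → ℝ) (D : Set (Sp d)) (u v : Sp d → ℝ) : ℝ :=
  ∫ x in D, n x * u x * v x

/-- `b_D(u,v) = a_D(u,v) - k² (u,v)_{n,D}`. -/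
def bForm {d : ℕ} (A : Sp d → Matrix (Fin d) (Fin d) ℝ) (n : Sp d → ℝ) (k : ℝ)
    (D : Set (Sp d)) (u v : Sp d → ℝ) : ℝ :=
  aForm A D u v - k ^ 2 * nForm n D u v

/-- `(u,v)_{1,k,D} = a_D(u,v) + k² (u,v)_{n,D}`. -/
def ipk {d : ℕ} (A : Sp d → Matrix (Fin d) (Fin d) ℝ) (n : Sp d → ℝ) (k : ℝ)
    (D : Set (Sp d)) (u v : Sp d → ℝ) : ℝ :=
  aForm A D u v + k ^ 2 * nForm n D u v

/-- `‖u‖_{1,k,D}`. -/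
def normk {d : ℕ} (A : Sp d → Matrix (Fin d) (Fin d) ℝ) (n : Sp d → ℝ) (k : ℝ)
    (D : Set (Sp d)) (u : Sp d → ℝ) : ℝ :=
  Real.sqrt (ipk A n k D u u)

/-- The coefficients are measurable, `A` is symmetric, and a.e. in `D`, `1 ≤ A ≤ a_max` in the sense
of quadratic forms and `n_min ≤ n ≤ 1`. -/
structure AdmissibleCoeffs {d : ℕ} (D : Set (Sp d)) (A : Sp d → Matrix (Fin d) (Fin d) ℝ)
    (n : Sp d → ℝ) (amax nmin : ℝ) : Prop where
  measurable_A : ∀ i j, Measurable fun x => A x i j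
  measurable_n : Measurable n
  symm : ∀ x ∈ D, (A x).IsSymm
  one_le_amax : 1 ≤ amax
  nmin_pos : 0 < nmin
  nmin_le_one : nmin ≤ 1
  bounds_A : ∀ᵐ x ∂(volume.restrict D), ∀ ξ : Sp d,
    ‖ξ‖ ^ 2 ≤ inner ℝ (Matrix.toEuclideanLin (A x) ξ) ξ ∧
      inner ℝ (Matrix.toEuclideanLin (A x) ξ) ξ ≤ amax * ‖ξ‖ ^ 2
  bounds_n : ∀ᵐ x ∂(volume.restrict D), nmin ≤ n x ∧ n x ≤ 1

/-- The inverse estimate `‖∇v‖_T ≤ C k ‖v‖_T` for all elements `T` and all `v ∈ V^h`. -/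
def InverseEstimate {d : ℕ} (𝒯 : Mesh d) (r : ℕ) (k C : ℝ) : Prop :=
  ∀ T ∈ 𝒯.elems, ∀ v ∈ 𝒯.Vh r,
    Real.sqrt (∫ x in cell T, ‖gradient v x‖ ^ 2) ≤
      C * k * Real.sqrt (∫ x in cell T, v x ^ 2)

/-! ### The coarse space -/

open Classical in
/-- `μ_l`: the number of coarse subdomains for which `l` is an internal degree of freedom. -/
def mu {d N : ℕ} (𝒯 : Mesh d) (r : ℕ) (Sc : Fin N → Finset (Finset (Sp d))) (l : Sp d) : ℕ :=
  (Finset.univ.filter fun i => l ∈ 𝒯.dof r (region (Sc i))).card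

/-- The partition of unity operator
`Ξ_i(v) = ∑_{l ∈ dof(Ω_i)} μ_l⁻¹ v_l φ_l|_{Ω_i}`, where `v_l` is the value of `v` at `l`. -/
def Xi {d N : ℕ} (𝒯 : Mesh d) (r : ℕ) (Sc : Fin N → Finset (Finset (Sp d))) (i : Fin N)
    (v : Sp d → ℝ) : Sp d → ℝ :=
  ∑ l ∈ 𝒯.dof r (region (Sc i)),
    ((1 / (mu 𝒯 r Sc l : ℝ)) * v l) • restr (region (Sc i)) (𝒯.nodalBasis r l)

/-- `c_i(w,v) = (Ξ_i w, Ξ_i v)_{1,k,Ω_i}`. -/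
def cForm {d N : ℕ} (𝒯 : Mesh d) (r : ℕ) (A : Sp d → Matrix (Fin d) (Fin d) ℝ) (n : Sp d → ℝ)
    (k : ℝ) (Sc : Fin N → Finset (Finset (Sp d))) (i : Fin N) (w v : Sp d → ℝ) : ℝ :=
  ipk A n k (region (Sc i)) (Xi 𝒯 r Sc i w) (Xi 𝒯 r Sc i v)

/-- `ker c` on the space `W`. -/
def kerForm {d : ℕ} (W : Submodule ℝ (Sp d → ℝ)) (c : (Sp d → ℝ) → (Sp d → ℝ) → ℝ) :
    Set (Sp d → ℝ) :=
  {v | v ∈ W ∧ ∀ w ∈ W, c v w = 0}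

/-- `(p_j, λ_j)`, `j = 1, …, q`, is a complete system of eigenpairs with finite eigenvalues of
`b(p,v) = λ c(p,v)` for all `v ∈ W`, with `p_j` orthonormal for `c`, `λ_j` nondecreasing, and
`q = dim W - dim ker c`. -/
structure IsEigenSystem {d : ℕ} (W : Submodule ℝ (Sp d → ℝ))
    (b c : (Sp d → ℝ) → (Sp d → ℝ) → ℝ) (q : ℕ) (p : ℕ → Sp d → ℝ) (lam : ℕ → ℝ) : Prop where
  mem : ∀ j ∈ Set.Icc 1 q, p j ∈ W
  eigen : ∀ j ∈ Set.Icc 1 q, ∀ v ∈ W, b (p j) v = lam j * c (p j) v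
  orthonormal : ∀ j ∈ Set.Icc 1 q, ∀ j' ∈ Set.Icc 1 q, c (p j) (p j') = if j = j' then 1 else 0
  mono : MonotoneOn lam (Set.Icc 1 q)
  count : q + Set.finrank ℝ (kerForm W c) = Module.finrank ℝ W

/-- The coarse space `V_0`, spanned by `E_i Ξ_i p^i_j` for `1 ≤ j ≤ m_i` and all `i`. -/
def coarseSpace {d N : ℕ} (𝒯 : Mesh d) (r : ℕ) (Sc : Fin N → Finset (Finset (Sp d)))
    (p : Fin N → ℕ → Sp d → ℝ) (m : Fin N → ℕ) : Submodule ℝ (Sp d → ℝ) :=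
  Submodule.span ℝ {w | ∃ i, ∃ j ∈ Set.Icc 1 (m i), w = Xi 𝒯 r Sc i (p i j)}

/-- The local projector `Π_{m} v = ∑_{j=1}^{m} c(v, p_j) p_j`. -/
def eigProj {d : ℕ} (c : (Sp d → ℝ) → (Sp d → ℝ) → ℝ) (p : ℕ → Sp d → ℝ) (m : ℕ)
    (v : Sp d → ℝ) : Sp d → ℝ :=
  ∑ j ∈ Finset.Icc 1 m, c v (p j) • p j

/-- `z_0 = ∑_i E_i Ξ_i (Π_{m_i} v|_{Ω_i})`. -/
def coarsePart {d N : ℕ} (𝒯 : Mesh d) (r : ℕ) (A : Sp d → Matrix (Fin d) (Fin d) ℝ)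
    (n : Sp d → ℝ) (k : ℝ) (Sc : Fin N → Finset (Finset (Sp d)))
    (p : Fin N → ℕ → Sp d → ℝ) (m : Fin N → ℕ) (v : Sp d → ℝ) : Sp d → ℝ :=
  ∑ i, Xi 𝒯 r Sc i
    (eigProj (cForm 𝒯 r A n k Sc i) (p i) (m i) (restr (region (Sc i)) v))

/-- Nondegeneracy of a subdomain `Ω'` composed of the elements in `S`: from each of its elements one
reaches, in at most `M` steps between elements of `Ω'` with a common edge, an element
with a Lagrange node off `∂Ω' \ ∂Ω` (that is, in `Ω'` or on `∂Ω`). -/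
def InteriorReach {d : ℕ} (𝒯 : Mesh d) (r M : ℕ) (S : Finset (Finset (Sp d))) : Prop :=
  ∀ T ∈ S, ∃ t : ℕ → Finset (Sp d), t 0 = T ∧ (∀ s ≤ M, t s ∈ S) ∧
    (∀ s < M, ∃ a b : Sp d, a ≠ b ∧ a ∈ t s ∧ b ∈ t s ∧ a ∈ t (s + 1) ∧ b ∈ t (s + 1)) ∧
    ∃ x ∈ lagrangeNodes r (t M), x ∈ region S ∨ x ∉ 𝒯.domain

/-- `C_eig = Λ_c² n_min⁻¹ (a_max C_inv² + 2)²`. -/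
def Ceig (Λc : ℕ) (amax nmin Cinv : ℝ) : ℝ :=
  (Λc : ℝ) ^ 2 * nmin⁻¹ * (amax * Cinv ^ 2 + 2) ^ 2

/-- `C_* = C_eig C_inv²`. -/
def Cstar (Λc : ℕ) (amax nmin Cinv : ℝ) : ℝ := Ceig Λc amax nmin Cinv * Cinv ^ 2

/-- `Θ = 1 / min_i λ^i_{m_i+1}`. -/
def Theta {N : ℕ} (lam : Fin N → ℕ → ℝ) (m : Fin N → ℕ) : ℝ := 1 / ⨅ i, lam i (m i + 1)

end HkGenEO

end

noncomputable section

namespace HkGenEO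

/-! ### Polynomial functions -/

/-- The functions on `ℝ^d` given by a polynomial of degree at most `r`. -/
def polyFun (d r : ℕ) : Submodule ℝ (Sp d → ℝ) where
  carrier := {f | ∃ p : MvPolynomial (Fin d) ℝ, p.totalDegree ≤ r ∧
    ∀ x, f x = MvPolynomial.eval (fun i => x i) p}
  zero_mem' := ⟨0, by simp, by simp⟩
  add_mem' := by
    rintro u v ⟨p, hp, hp'⟩ ⟨q, hq, hq'⟩
    exact ⟨p + q, (MvPolynomial.totalDegree_add p q).trans (max_le hp hq),
      fun x => by simp [hp' x, hq' x]⟩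
  smul_mem' := by
    rintro c v ⟨p, hp, hp'⟩
    exact ⟨c • p, (MvPolynomial.totalDegree_smul_le c p).trans hp, fun x => by simp [hp' x]⟩

theorem polyFun_mono {d r s : ℕ} (h : r ≤ s) : polyFun d r ≤ polyFun d s := by
  rintro f ⟨p, hp, hp'⟩
  exact ⟨p, hp.trans h, hp'⟩

theorem polyFun_const {d : ℕ} (r : ℕ) (c : ℝ) : (fun _ : Sp d => c) ∈ polyFun d r :=
  ⟨MvPolynomial.C c, by simp, by simp⟩

theorem polyFun_coord {d : ℕ} (i : Fin d) : (fun x : Sp d => x i) ∈ polyFun d 1 :=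
  ⟨MvPolynomial.X i, by simp, by simp⟩

theorem polyFun_mul {d r s : ℕ} {f g : Sp d → ℝ} (hf : f ∈ polyFun d r) (hg : g ∈ polyFun d s) :
    (fun x => f x * g x) ∈ polyFun d (r + s) := by
  obtain ⟨p, hp, hp'⟩ := hf
  obtain ⟨q, hq, hq'⟩ := hg
  exact ⟨p * q, (MvPolynomial.totalDegree_mul p q).trans (add_le_add hp hq),
    fun x => by simp [hp' x, hq' x]⟩

theorem polyFun_prod {d : ℕ} {ι : Type*} (s : Finset ι) {f : ι → Sp d → ℝ} {e : ι → ℕ}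
    (hf : ∀ i ∈ s, f i ∈ polyFun d (e i)) :
    (fun x => ∏ i ∈ s, f i x) ∈ polyFun d (∑ i ∈ s, e i) := by
  classical
  induction s using Finset.induction_on with
  | empty => simpa using polyFun_const 0 1
  | insert a s ha ih =>
    simp only [Finset.prod_insert ha, Finset.sum_insert ha]
    exact polyFun_mul (hf a (Finset.mem_insert_self _ _))
      (ih fun i hi => hf i (Finset.mem_insert_of_mem hi))

theorem polyFun_pow {d r : ℕ} {f : Sp d → ℝ} (hf : f ∈ polyFun d r) (n : ℕ) :
    (fun x => f x ^ n) ∈ polyFun d (n * r) := by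
  have := polyFun_prod (d := d) (Finset.range n) (f := fun _ => f) (e := fun _ => r)
    (fun _ _ => hf)
  simpa using this

/-- Monomials with exponents at most `r`. -/
def mono {d r : ℕ} (m : Fin d → Fin (r + 1)) (x : Sp d) : ℝ := ∏ i, x i ^ (m i : ℕ)

theorem mono_contDiff {d r : ℕ} (m : Fin d → Fin (r + 1)) : ContDiff ℝ 1 (mono m) := by
  unfold mono
  refine contDiff_prod fun i _ => ContDiff.pow ?_ _
  exact contDiff_euclidean.1 contDiff_id i

/-- The function with given coefficients with respect to the monomials `mono`. -/
def monoSum {d r : ℕ} (c : (Fin d → Fin (r + 1)) → ℝ) (x : Sp d) : ℝ := ∑ m, c m * mono m x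

theorem monoSum_contDiff {d r : ℕ} (c : (Fin d → Fin (r + 1)) → ℝ) :
    ContDiff ℝ 1 (monoSum c) := by
  unfold monoSum
  exact ContDiff.sum fun m _ => contDiff_const.mul (mono_contDiff m)

theorem exists_monoSum {d r : ℕ} {f : Sp d → ℝ} (hf : f ∈ polyFun d r) :
    ∃ c : (Fin d → Fin (r + 1)) → ℝ, f = monoSum c := by
  obtain ⟨p, hp, hp'⟩ := hf
  let e : (Fin d → Fin (r + 1)) → (Fin d →₀ ℕ) :=
    fun m => Finsupp.equivFunOnFinite.symm fun i => (m i : ℕ)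
  have he : Function.Injective e := by
    intro m m' h
    funext i
    exact Fin.ext (by simpa [e] using DFunLike.congr_fun h i)
  refine ⟨fun m => p.coeff (e m), funext fun x => ?_⟩
  rw [hp', MvPolynomial.eval_eq', monoSum]
  have h1 : ∑ m, p.coeff (e m) * mono m x =
      ∑ s ∈ Finset.univ.image e, p.coeff s * ∏ i, x i ^ s i := by
    rw [Finset.sum_image (fun a _ b _ h => he h)]
    rfl
  rw [h1]
  refine Finset.sum_subset (fun s hs => ?_) (fun s _ hs => ?_)
  · rw [Finset.mem_image]
    have hle : ∀ i, s i < r + 1 := by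
      intro i
      have h2 := (MvPolynomial.le_totalDegree hs).trans hp
      have h3 : s i ≤ s.sum fun _ e => e := by
        by_cases hi : i ∈ s.support
        · exact Finset.single_le_sum (f := fun i => s i) (fun _ _ => Nat.zero_le _) hi
        · simp [Finsupp.notMem_support_iff.1 hi]
      omega
    exact ⟨fun i => ⟨s i, hle i⟩, Finset.mem_univ _, by ext i; simp [e]⟩
  · simp [MvPolynomial.notMem_support_iff.1 hs]

theorem polyFun_contDiff {d r : ℕ} {f : Sp d → ℝ} (hf : f ∈ polyFun d r) : ContDiff ℝ 1 f := by
  obtain ⟨c, rfl⟩ := exists_monoSum hf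
  exact monoSum_contDiff c

theorem polyFun_comp_affine {d r : ℕ} {f : Sp d → ℝ} (hf : f ∈ polyFun d r) (x₀ : Sp d) (h : ℝ) :
    (fun y => f (x₀ + h • y)) ∈ polyFun d r := by
  obtain ⟨p, hp, hp'⟩ := hf
  have h1 : (fun y : Sp d => f (x₀ + h • y)) =
      ∑ s ∈ p.support, p.coeff s • fun y : Sp d => ∏ i, (x₀ i + h * y i) ^ s i := by
    funext y
    rw [hp', MvPolynomial.eval_eq']
    simp [Finset.sum_apply]
  rw [h1]
  refine Submodule.sum_mem _ fun s hs => Submodule.smul_mem _ _ ?_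
  refine polyFun_mono (r := ∑ i, s i * 1) ?_ (polyFun_prod _ fun i _ => polyFun_pow ?_ _)
  · have h2 := (MvPolynomial.le_totalDegree hs).trans hp
    simpa [Finsupp.sum_fintype] using h2
  · exact Submodule.add_mem _ (polyFun_const 1 (x₀ i))
      (Submodule.smul_mem _ h (polyFun_coord i))

/-- A polynomial in monomial form that vanishes on a neighbourhood of the origin is zero. -/
theorem monoSum_eq_zero {d r : ℕ} {c : (Fin d → Fin (r + 1)) → ℝ} {ε : ℝ} (hε : 0 < ε)
    (h : ∀ x ∈ Metric.ball (0 : Sp d) ε, monoSum c x = 0) : c = 0 := by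
  let e : (Fin d → Fin (r + 1)) → (Fin d →₀ ℕ) :=
    fun m => Finsupp.equivFunOnFinite.symm fun i => (m i : ℕ)
  have he : Function.Injective e := by
    intro m m' h
    funext i
    exact Fin.ext (by simpa [e] using DFunLike.congr_fun h i)
  let p : MvPolynomial (Fin d) ℝ := ∑ m, MvPolynomial.monomial (e m) (c m)
  have hp : ∀ x : Sp d, MvPolynomial.eval (fun i => x i) p = monoSum c x := by
    intro x
    simp only [p, map_sum, monoSum, mono, MvPolynomial.eval_monomial]
    refine Finset.sum_congr rfl fun m _ => ?_
    rw [Finsupp.prod_fintype _ _ (by simp)]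
    rfl
  have hcont : Continuous fun y : Fin d → ℝ => (WithLp.toLp 2 y : Sp d) := by fun_prop
  obtain ⟨η, hη, hball⟩ : ∃ η > 0, ∀ y : Fin d → ℝ, y ∈ Metric.ball 0 η →
      (WithLp.toLp 2 y : Sp d) ∈ Metric.ball (0 : Sp d) ε := by
    have := (hcont.continuousAt (x := 0)).preimage_mem_nhds
      (by simpa using Metric.ball_mem_nhds (0 : Sp d) hε)
    obtain ⟨η, hη, hsub⟩ := Metric.mem_nhds_iff.1 this
    exact ⟨η, hη, fun y hy => hsub hy⟩
  have hp0 : p = 0 := by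
    refine MvPolynomial.funext_set (fun _ => Set.Ioo (-η) η)
      (fun _ => Set.Ioo_infinite (by linarith)) fun y hy => ?_
    have hy' : y ∈ Metric.ball (0 : Fin d → ℝ) η := by
      rw [mem_ball_zero_iff, pi_norm_lt_iff hη]
      intro i
      have := hy i trivial
      rw [Real.norm_eq_abs, abs_lt]
      exact ⟨this.1, this.2⟩
    simpa using (hp (WithLp.toLp 2 y)).trans (h _ (hball y hy'))
  funext m
  have : p.coeff (e m) = c m := by
    simp only [p, MvPolynomial.coeff_sum, MvPolynomial.coeff_monomial]
    rw [Finset.sum_eq_single m]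
    · simp
    · intro b _ hb
      rw [if_neg fun h => hb (he h)]
    · simp
  rw [← this, hp0]
  simp

/-- A positive definite continuous function that is homogeneous of degree two dominates the squared
norm. -/
theorem exists_norm_sq_le {V : Type*} [NormedAddCommGroup V] [NormedSpace ℝ V]
    [FiniteDimensional ℝ V] (q : V → ℝ) (hq : Continuous q)
    (hsmul : ∀ (t : ℝ) (v : V), q (t • v) = t ^ 2 * q v) (hpos : ∀ v, v ≠ 0 → 0 < q v) :
    ∃ C : ℝ, 0 < C ∧ ∀ v, ‖v‖ ^ 2 ≤ C * q v := by
  have : ProperSpace V := FiniteDimensional.proper ℝ V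
  by_cases hne : (Metric.sphere (0 : V) 1).Nonempty
  · obtain ⟨v₀, hv₀, hmin⟩ := (isCompact_sphere (0 : V) 1).exists_isMinOn hne hq.continuousOn
    have hv₀' : v₀ ≠ 0 := by
      rintro rfl
      simp at hv₀
    have hm := hpos v₀ hv₀'
    refine ⟨(q v₀)⁻¹, inv_pos.2 hm, fun v => ?_⟩
    by_cases hv : v = 0
    · subst hv
      have : q 0 = 0 := by simpa using hsmul 0 (0 : V)
      simp [this]
    have hn : ‖v‖ ≠ 0 := norm_ne_zero_iff.2 hv
    have h1 : q v₀ ≤ q (‖v‖⁻¹ • v) := hmin (by simp [norm_smul, hn])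
    rw [hsmul] at h1
    rw [inv_mul_eq_div, le_div_iff₀ hm]
    calc ‖v‖ ^ 2 * q v₀ ≤ ‖v‖ ^ 2 * (‖v‖⁻¹ ^ 2 * q v) := by gcongr
      _ = q v := by field_simp
  · refine ⟨1, one_pos, fun v => ?_⟩
    have hv : v = 0 := by
      by_contra hv
      exact hne ⟨‖v‖⁻¹ • v, by simp [norm_smul, norm_ne_zero_iff.2 hv]⟩
    subst hv
    have : q 0 = 0 := by simpa using hsmul 0 (0 : V)
    simp [this]

theorem eq_zero_of_integral_ball_eq_zero {d : ℕ} {σ : ℝ} {g : Sp d → ℝ} (hg : Continuous g)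
    (hg0 : ∀ x, 0 ≤ g x) (h : ∫ x in Metric.closedBall 0 σ, g x = 0) :
    ∀ x ∈ Metric.ball (0 : Sp d) σ, g x = 0 := by
  have h1 : g =ᵐ[volume.restrict (Metric.closedBall 0 σ)] 0 :=
    (setIntegral_eq_zero_iff_of_nonneg_ae (ae_of_all _ hg0)
      (hg.continuousOn.integrableOn_compact (isCompact_closedBall 0 σ))).1 h
  have h2 : g =ᵐ[volume.restrict (Metric.ball 0 σ)] 0 :=
    ae_restrict_of_ae_restrict_of_subset Metric.ball_subset_closedBall h1
  exact Measure.eqOn_open_of_ae_eq h2 Metric.isOpen_ball hg.continuousOn continuousOn_const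

theorem monoSum_add {d r : ℕ} (c c' : (Fin d → Fin (r + 1)) → ℝ) :
    monoSum (c + c') = monoSum c + monoSum c' := by
  funext x
  simp [monoSum, add_mul, Finset.sum_add_distrib]

theorem monoSum_smul {d r : ℕ} (t : ℝ) (c : (Fin d → Fin (r + 1)) → ℝ) :
    monoSum (t • c) = t • monoSum c := by
  funext x
  simp [monoSum, mul_assoc, Finset.mul_sum]

theorem fderiv_monoSum {d r : ℕ} (c : (Fin d → Fin (r + 1)) → ℝ) (x : Sp d) :
    fderiv ℝ (monoSum c) x = ∑ m, c m • fderiv ℝ (mono m) x := by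
  have h : monoSum c = fun x => ∑ m, c m * mono m x := rfl
  have hm : ∀ m, DifferentiableAt ℝ (mono (d := d) (r := r) m) x := fun m =>
    (mono_contDiff m).differentiable one_ne_zero x
  rw [h, fderiv_fun_sum fun m _ => (hm m).const_mul _]
  exact Finset.sum_congr rfl fun m _ => fderiv_const_mul (hm m) _

theorem continuous_fderiv_mono {d r : ℕ} (m : Fin d → Fin (r + 1)) :
    Continuous (fderiv ℝ (mono m)) :=
  (mono_contDiff m).continuous_fderiv one_ne_zero

theorem norm_fderiv_monoSum_le (d r : ℕ) : ∃ K : ℝ, 0 ≤ K ∧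
    ∀ (c : (Fin d → Fin (r + 1)) → ℝ), ∀ y ∈ Metric.closedBall (0 : Sp d) 1,
      ‖fderiv ℝ (monoSum c) y‖ ≤ K * ‖c‖ := by
  have h : ∀ m : Fin d → Fin (r + 1), ∃ K : ℝ, ∀ y ∈ Metric.closedBall (0 : Sp d) 1,
      ‖fderiv ℝ (mono m) y‖ ≤ K := fun m =>
    (isCompact_closedBall 0 1).exists_bound_of_continuousOn (continuous_fderiv_mono m).continuousOn
  choose K hK using h
  have hK0 : ∀ m, 0 ≤ K m := fun m =>
    (norm_nonneg _).trans (hK m 0 (Metric.mem_closedBall_self zero_le_one))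
  refine ⟨∑ m, K m, Finset.sum_nonneg fun m _ => hK0 m, fun c y hy => ?_⟩
  rw [fderiv_monoSum, Finset.sum_mul]
  refine (norm_sum_le _ _).trans (Finset.sum_le_sum fun m _ => ?_)
  rw [norm_smul, mul_comm]
  exact mul_le_mul (hK m y hy) (norm_le_pi_norm c m) (norm_nonneg _) (hK0 m)

theorem abs_monoSum_le (d r : ℕ) : ∃ K : ℝ, 0 ≤ K ∧
    ∀ (c : (Fin d → Fin (r + 1)) → ℝ), ∀ y ∈ Metric.closedBall (0 : Sp d) 1,
      |monoSum c y| ≤ K * ‖c‖ := by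
  have h : ∀ m : Fin d → Fin (r + 1), ∃ K : ℝ, ∀ y ∈ Metric.closedBall (0 : Sp d) 1,
      ‖mono m y‖ ≤ K := fun m =>
    (isCompact_closedBall 0 1).exists_bound_of_continuousOn (mono_contDiff m).continuous.continuousOn
  choose K hK using h
  have hK0 : ∀ m, 0 ≤ K m := fun m =>
    (norm_nonneg _).trans (hK m 0 (Metric.mem_closedBall_self zero_le_one))
  refine ⟨∑ m, K m, Finset.sum_nonneg fun m _ => hK0 m, fun c y hy => ?_⟩
  rw [monoSum, Finset.sum_mul]
  refine (Finset.abs_sum_le_sum_abs _ _).trans (Finset.sum_le_sum fun m _ => ?_)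
  rw [abs_mul, mul_comm]
  exact mul_le_mul (hK m y hy) (norm_le_pi_norm c m) (abs_nonneg _) (hK0 m)

theorem continuous_monoSum_uncurry (d r : ℕ) :
    Continuous fun z : ((Fin d → Fin (r + 1)) → ℝ) × Sp d => monoSum z.1 z.2 := by
  unfold monoSum
  refine continuous_finsetSum _ fun m _ => ?_
  have := (mono_contDiff (d := d) m).continuous
  fun_prop

theorem continuous_fderiv_monoSum_uncurry (d r : ℕ) :
    Continuous fun z : ((Fin d → Fin (r + 1)) → ℝ) × Sp d => fderiv ℝ (monoSum z.1) z.2 := by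
  simp only [fderiv_monoSum]
  refine continuous_finsetSum _ fun m _ => ?_
  have := continuous_fderiv_mono (d := d) m
  fun_prop

/-- On the unit ball, a polynomial and its derivative are controlled by the `L²`-norm of the
polynomial on a concentric ball. -/
theorem polyFun_bound_unit_ball (d r : ℕ) {σ : ℝ} (hσ : 0 < σ) : ∃ C : ℝ, 0 < C ∧
    ∀ f ∈ polyFun d r, ∀ y ∈ Metric.closedBall (0 : Sp d) 1,
      f y ^ 2 ≤ C * ∫ x in Metric.closedBall 0 σ, f x ^ 2 ∧
      ‖fderiv ℝ f y‖ ^ 2 ≤ C * ∫ x in Metric.closedBall 0 σ, f x ^ 2 := by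
  obtain ⟨C, hC, h⟩ := exists_norm_sq_le
    (fun c : (Fin d → Fin (r + 1)) → ℝ => ∫ x in Metric.closedBall (0 : Sp d) σ, monoSum c x ^ 2)
    (continuous_parametric_integral_of_continuous
      (by exact (continuous_monoSum_uncurry d r).pow 2) (isCompact_closedBall 0 σ))
    (fun t c => by
      simp only [monoSum_smul, Pi.smul_apply, smul_eq_mul, mul_pow]
      exact integral_const_mul _ _)
    (fun c hc => by
      refine lt_of_le_of_ne (integral_nonneg fun x => sq_nonneg _) fun h0 => hc ?_
      refine monoSum_eq_zero hσ fun x hx => ?_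
      exact pow_eq_zero_iff two_ne_zero |>.1 (eq_zero_of_integral_ball_eq_zero
        ((monoSum_contDiff c).continuous.pow 2) (fun x => sq_nonneg _) h0.symm x hx))
  obtain ⟨K, hK, hK'⟩ := abs_monoSum_le d r
  obtain ⟨K₁, hK₁, hK₁'⟩ := norm_fderiv_monoSum_le d r
  refine ⟨(K ^ 2 + K₁ ^ 2 + 1) * C, by positivity, fun f hf y hy => ?_⟩
  obtain ⟨c, rfl⟩ := exists_monoSum hf
  have h1 := h c
  have h2 := pow_le_pow_left₀ (abs_nonneg _) (hK' c y hy) 2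
  have h3 := pow_le_pow_left₀ (norm_nonneg _) (hK₁' c y hy) 2
  rw [sq_abs] at h2
  have h4 : (K ^ 2 + K₁ ^ 2 + 1) * ‖c‖ ^ 2 ≤ (K ^ 2 + K₁ ^ 2 + 1) * C *
      ∫ x in Metric.closedBall (0 : Sp d) σ, monoSum c x ^ 2 := by
    rw [mul_assoc]
    gcongr
  constructor
  · nlinarith [sq_nonneg (K₁ * ‖c‖), sq_nonneg ‖c‖]
  · nlinarith [sq_nonneg (K * ‖c‖), sq_nonneg ‖c‖]

/-- On the unit ball, the oscillation of a polynomial is controlled by the `L²`-norm of its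
derivative on a concentric ball. -/
theorem polyFun_osc_unit_ball (d r : ℕ) {σ : ℝ} (hσ : 0 < σ) : ∃ C : ℝ, 0 < C ∧
    ∀ f ∈ polyFun d r, ∀ x ∈ Metric.closedBall (0 : Sp d) 1, ∀ y ∈ Metric.closedBall (0 : Sp d) 1,
      (f x - f y) ^ 2 ≤ C * ∫ x in Metric.closedBall 0 σ, ‖fderiv ℝ f x‖ ^ 2 := by
  let W : Submodule ℝ ((Fin d → Fin (r + 1)) → ℝ) :=
    LinearMap.ker (LinearMap.proj (fun _ => (0 : Fin (r + 1))))
  have hmono : ∀ m : Fin d → Fin (r + 1), m ≠ (fun _ => 0) → mono m (0 : Sp d) = 0 := by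
    intro m hm
    obtain ⟨i, hi⟩ := Function.ne_iff.1 hm
    exact Finset.prod_eq_zero (Finset.mem_univ i)
      (by simpa using fun h => hi (Fin.ext h))
  have hW0 : ∀ c ∈ W, monoSum c (0 : Sp d) = 0 := by
    intro c hc
    refine Finset.sum_eq_zero fun m _ => ?_
    by_cases hm : m = fun _ => 0
    · have : c m = 0 := by rw [hm]; exact hc
      simp [this]
    · simp [hmono m hm]
  obtain ⟨C, hC, h⟩ := exists_norm_sq_le
    (fun c : W => ∫ x in Metric.closedBall (0 : Sp d) σ,
      ‖fderiv ℝ (monoSum (c : (Fin d → Fin (r + 1)) → ℝ)) x‖ ^ 2)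
    (continuous_parametric_integral_of_continuous
      (by exact (((continuous_fderiv_monoSum_uncurry d r).comp
            ((continuous_subtype_val.comp continuous_fst).prodMk continuous_snd)).norm).pow 2)
      (isCompact_closedBall 0 σ))
    (fun t c => by
      have : ∀ x, fderiv ℝ (monoSum (t • (c : (Fin d → Fin (r + 1)) → ℝ))) x =
          t • fderiv ℝ (monoSum (c : (Fin d → Fin (r + 1)) → ℝ)) x := fun x => by
        simp [fderiv_monoSum, Finset.smul_sum, smul_smul]
      simp only [Submodule.coe_smul, this, norm_smul, mul_pow, Real.norm_eq_abs, sq_abs]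
      exact integral_const_mul _ _)
    (fun c hc => by
      refine lt_of_le_of_ne (integral_nonneg fun x => sq_nonneg _) fun h0 => hc ?_
      refine Subtype.ext (monoSum_eq_zero hσ fun x hx => ?_)
      have hz : ∀ x ∈ Metric.ball (0 : Sp d) σ, fderiv ℝ (monoSum c.1) x = 0 := fun x hx => by
        have := eq_zero_of_integral_ball_eq_zero
          (((monoSum_contDiff c.1).continuous_fderiv one_ne_zero).norm.pow 2)
          (fun x => sq_nonneg _) h0.symm x hx
        simpa using this
      have := (convex_ball (0 : Sp d) σ).norm_image_sub_le_of_norm_fderiv_le (𝕜 := ℝ)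
        (C := 0) (f := monoSum c.1)
        (fun x _ => (monoSum_contDiff c.1).differentiable one_ne_zero x)
        (fun x hx => by simp [hz x hx]) (Metric.mem_ball_self hσ) hx
      rw [hW0 c.1 c.2] at this
      simpa using this)
  obtain ⟨K, hK, hK'⟩ := abs_monoSum_le d r
  refine ⟨4 * (K ^ 2 + 1) * C, by positivity, fun f hf x hx y hy => ?_⟩
  obtain ⟨c, rfl⟩ := exists_monoSum hf
  let c' : (Fin d → Fin (r + 1)) → ℝ := c - Pi.single (fun _ => 0) (c fun _ => 0)
  have hc' : c' ∈ W := by simp [W, c']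
  have hcc : monoSum c = fun x : Sp d => monoSum c' x + c fun _ => 0 := by
    funext x
    have : monoSum (Pi.single (fun _ : Fin d => (0 : Fin (r + 1))) (c fun _ => 0)) x =
        c fun _ => 0 := by
      rw [monoSum, Finset.sum_eq_single (fun _ => 0)]
      · simp [mono]
      · intro b _ hb
        simp [Pi.single_eq_of_ne hb]
      · simp
    have h2 : c = c' + Pi.single (fun _ => 0) (c fun _ => 0) := by simp [c']
    conv_lhs => rw [h2, monoSum_add]
    simp [this]
  rw [hcc]
  simp only [fderiv_add_const, add_sub_add_right_eq_sub]
  have h1 := h ⟨c', hc'⟩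
  have h2 := hK' c' x hx
  have h3 := hK' c' y hy
  have h4 : |monoSum c' x - monoSum c' y| ≤ 2 * (K * ‖c'‖) :=
    (abs_sub _ _).trans (by linarith)
  have h5 := pow_le_pow_left₀ (abs_nonneg _) h4 2
  rw [sq_abs] at h5
  have h6 : 4 * (K ^ 2 + 1) * ‖c'‖ ^ 2 ≤ 4 * (K ^ 2 + 1) * C *
      ∫ x in Metric.closedBall (0 : Sp d) σ, ‖fderiv ℝ (monoSum c') x‖ ^ 2 := by
    rw [mul_assoc _ C]
    exact mul_le_mul_of_nonneg_left h1 (by positivity)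
  nlinarith [sq_nonneg ‖c'‖]

open scoped Pointwise in
theorem setIntegral_closedBall_comp_affine {d : ℕ} (F : Sp d → ℝ) (x₀ : Sp d) {h : ℝ} (hh : 0 < h)
    (σ : ℝ) :
    h ^ d * ∫ y in Metric.closedBall 0 σ, F (x₀ + h • y) =
      ∫ x in Metric.closedBall x₀ (σ * h), F x := by
  have h1 := Measure.setIntegral_comp_smul_of_pos volume (fun y => F (x₀ + y))
    (Metric.closedBall (0 : Sp d) σ) hh
  have h2 : h • Metric.closedBall (0 : Sp d) σ = Metric.closedBall 0 (σ * h) := by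
    rw [smul_closedBall' hh.ne']
    simp [abs_of_pos hh, mul_comm]
  rw [h1, h2, finrank_euclideanSpace_fin, smul_eq_mul, mul_inv_cancel_left₀ (by positivity)]
  have h3 := (measurePreserving_add_left volume x₀).setIntegral_preimage_emb
    (measurableEmbedding_addLeft x₀) F (Metric.closedBall x₀ (σ * h))
  rw [← h3]
  congr 2
  ext y
  simp [dist_eq_norm]

/-- Scaled form of `polyFun_bound_unit_ball` and `polyFun_osc_unit_ball`. -/
theorem polyFun_bound_ball (d r : ℕ) {σ : ℝ} (hσ : 0 < σ) : ∃ C : ℝ, 0 < C ∧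
    ∀ f ∈ polyFun d r, ∀ (x₀ : Sp d) (h : ℝ), 0 < h → ∀ x ∈ Metric.closedBall x₀ h,
      h ^ d * f x ^ 2 ≤ C * ∫ x in Metric.closedBall x₀ (σ * h), f x ^ 2 ∧
      h ^ d * (h ^ 2 * ‖fderiv ℝ f x‖ ^ 2) ≤
        C * ∫ x in Metric.closedBall x₀ (σ * h), f x ^ 2 ∧
      ∀ y ∈ Metric.closedBall x₀ h, h ^ d * (f x - f y) ^ 2 ≤
        C * (h ^ 2 * ∫ x in Metric.closedBall x₀ (σ * h), ‖fderiv ℝ f x‖ ^ 2) := by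
  obtain ⟨C₁, hC₁, H₁⟩ := polyFun_bound_unit_ball d r hσ
  obtain ⟨C₂, hC₂, H₂⟩ := polyFun_osc_unit_ball d r hσ
  refine ⟨C₁ + C₂, by positivity, fun f hf x₀ h hh x hx => ?_⟩
  set g : Sp d → ℝ := fun y => f (x₀ + h • y) with hg
  have hgp : g ∈ polyFun d r := polyFun_comp_affine hf x₀ h
  have hfd : ∀ y, fderiv ℝ g y = h • fderiv ℝ f (x₀ + h • y) := by
    intro y
    have e1 : HasFDerivAt (fun y : Sp d => x₀ + h • y)
        (h • ContinuousLinearMap.id ℝ (Sp d)) y :=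
      ((hasFDerivAt_id y).const_smul h).const_add x₀
    have e2 := ((polyFun_contDiff hf).differentiable one_ne_zero (x₀ + h • y)).hasFDerivAt.comp y e1
    rw [HasFDerivAt.fderiv (f := g) e2]
    ext v
    simp
  have key : ∀ x ∈ Metric.closedBall x₀ h, ∃ y ∈ Metric.closedBall (0 : Sp d) 1,
      x = x₀ + h • y := by
    intro x hx
    refine ⟨h⁻¹ • (x - x₀), ?_, ?_⟩
    · rw [mem_closedBall_zero_iff, norm_smul, Real.norm_eq_abs, abs_of_pos (inv_pos.2 hh),
        inv_mul_le_iff₀ hh, mul_one, ← dist_eq_norm]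
      exact hx
    · rw [smul_smul, mul_inv_cancel₀ hh.ne', one_smul, add_sub_cancel]
  have i1 := setIntegral_closedBall_comp_affine (fun x => f x ^ 2) x₀ hh σ
  have i2 := setIntegral_closedBall_comp_affine (fun x => ‖fderiv ℝ f x‖ ^ 2) x₀ hh σ
  have n1 : 0 ≤ ∫ x in Metric.closedBall x₀ (σ * h), f x ^ 2 :=
    integral_nonneg fun _ => sq_nonneg _
  have n2 : 0 ≤ ∫ x in Metric.closedBall x₀ (σ * h), ‖fderiv ℝ f x‖ ^ 2 :=
    integral_nonneg fun _ => sq_nonneg _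
  have hd0 : 0 ≤ h ^ d := by positivity
  obtain ⟨u, hu, rfl⟩ := key x hx
  obtain ⟨a1, a2⟩ := H₁ g hgp u hu
  have b1 := mul_le_mul_of_nonneg_left a1 hd0
  have b2 := mul_le_mul_of_nonneg_left a2 hd0
  rw [mul_left_comm, i1] at b1 b2
  rw [hfd, norm_smul, mul_pow, Real.norm_eq_abs, sq_abs] at b2
  refine ⟨b1.trans ?_, b2.trans ?_, fun y hy => ?_⟩
  · gcongr
    linarith
  · gcongr
    linarith
  · obtain ⟨w, hw, rfl⟩ := key y hy
    have b3 := mul_le_mul_of_nonneg_left (H₂ g hgp u hu w hw) hd0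
    have : ∫ x in Metric.closedBall 0 σ, ‖fderiv ℝ g x‖ ^ 2 =
        h ^ 2 * ∫ y in Metric.closedBall 0 σ, ‖fderiv ℝ f (x₀ + h • y)‖ ^ 2 := by
      rw [← integral_const_mul]
      refine integral_congr_ae (ae_of_all _ fun y => ?_)
      simp only [hfd, norm_smul, mul_pow, Real.norm_eq_abs, sq_abs]
    rw [this, mul_left_comm, mul_left_comm (h ^ d), i2] at b3
    refine b3.trans ?_
    gcongr
    linarith

/-! ### Barycentric coordinates -/

/-- `T` is the vertex set of a nondegenerate `d`-simplex. -/
structure IsSimplex {d : ℕ} (T : Finset (Sp d)) : Prop where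
  card_eq : T.card = d + 1
  indep : AffineIndependent ℝ (fun a : T => (a : Sp d))

theorem Mesh.isSimplex {d : ℕ} (𝒯 : Mesh d) {T : Finset (Sp d)} (hT : T ∈ 𝒯.elems) :
    IsSimplex T :=
  ⟨𝒯.card_eq T hT, 𝒯.indep T hT⟩

/-- The vertices of a simplex as an affine basis. -/
def IsSimplex.basis {d : ℕ} {T : Finset (Sp d)} (hT : IsSimplex T) : AffineBasis T ℝ (Sp d) :=
  ⟨fun a => (a : Sp d), hT.indep, by
    rw [hT.indep.affineSpan_eq_top_iff_card_eq_finrank_add_one]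
    simp [hT.card_eq]⟩

theorem IsSimplex.basis_apply {d : ℕ} {T : Finset (Sp d)} (hT : IsSimplex T) (a : T) :
    hT.basis a = a := rfl

theorem IsSimplex.range_basis {d : ℕ} {T : Finset (Sp d)} (hT : IsSimplex T) :
    Set.range hT.basis = (T : Set (Sp d)) := by
  ext x
  simp [hT.basis_apply]

open Classical in
/-- The barycentric coordinate of `x` with respect to the vertex `a` of the simplex `T`; it is zero
if `a` is not a vertex. -/
def bary {d : ℕ} (T : Finset (Sp d)) (a x : Sp d) : ℝ :=
  if h : IsSimplex T ∧ a ∈ T then h.1.basis.coord ⟨a, h.2⟩ x else 0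

section Bary

variable {d : ℕ} {T : Finset (Sp d)}

theorem bary_of_notMem {a : Sp d} (ha : a ∉ T) (x : Sp d) : bary T a x = 0 := by
  simp [bary, ha]

theorem bary_of_mem (hT : IsSimplex T) (a : T) (x : Sp d) :
    bary T a x = hT.basis.coord a x := by
  simp [bary, hT]

theorem sum_bary (hT : IsSimplex T) (x : Sp d) : ∑ a ∈ T, bary T a x = 1 := by
  rw [← hT.basis.sum_coord_apply_eq_one x, ← Finset.sum_coe_sort]
  exact Finset.sum_congr rfl fun a _ => bary_of_mem hT a x

theorem sum_bary_smul (hT : IsSimplex T) (x : Sp d) : ∑ a ∈ T, bary T a x • a = x := by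
  conv_rhs => rw [← hT.basis.linear_combination_coord_eq_self x]
  rw [← Finset.sum_coe_sort T (fun a => bary T a x • a)]
  exact Finset.sum_congr rfl fun a _ => by rw [bary_of_mem hT a x, hT.basis_apply]

theorem exists_affineMap_bary (hT : IsSimplex T) (a : Sp d) :
    ∃ f : Sp d →ᵃ[ℝ] ℝ, ∀ x, bary T a x = f x := by
  by_cases ha : a ∈ T
  · exact ⟨hT.basis.coord ⟨a, ha⟩, fun x => bary_of_mem hT ⟨a, ha⟩ x⟩
  · exact ⟨AffineMap.const ℝ _ 0, fun x => by simp [bary_of_notMem ha]⟩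

theorem bary_self (hT : IsSimplex T) {a : Sp d} (ha : a ∈ T) : bary T a a = 1 := by
  rw [bary_of_mem hT ⟨a, ha⟩]
  exact hT.basis.coord_apply_eq ⟨a, ha⟩

theorem bary_ne (hT : IsSimplex T) {a b : Sp d} (hb : b ∈ T) (hab : a ≠ b) : bary T a b = 0 := by
  by_cases ha : a ∈ T
  · rw [bary_of_mem hT ⟨a, ha⟩]
    exact hT.basis.coord_apply_ne (i := ⟨a, ha⟩) (j := ⟨b, hb⟩) (by simpa using hab)
  · exact bary_of_notMem ha b

theorem bary_sum (hT : IsSimplex T) {U : Finset (Sp d)} (hU : U ⊆ T) {w : Sp d → ℝ}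
    (hw : ∑ b ∈ U, w b = 1) (a : Sp d) [Decidable (a ∈ U)] :
    bary T a (∑ b ∈ U, w b • b) = if a ∈ U then w a else 0 := by
  classical
  obtain ⟨f, hf⟩ := exists_affineMap_bary hT a
  have h1 : ∑ b ∈ U, w b • b = U.affineCombination ℝ id w := by
    rw [Finset.affineCombination_eq_linear_combination _ _ _ hw]
    rfl
  rw [hf, h1, Finset.map_affineCombination _ _ _ hw,
    Finset.affineCombination_eq_linear_combination _ _ _ hw]
  have h2 : ∀ b ∈ U, w b • (f ∘ id) b = if a = b then w a else 0 := by
    intro b hb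
    split_ifs with hab
    · subst hab
      simp [← hf, bary_self hT (hU hb)]
    · simp [← hf, bary_ne hT (hU hb) hab]
  rw [Finset.sum_congr rfl h2, Finset.sum_ite_eq]
  congr

theorem mem_cell_iff (hT : IsSimplex T) {x : Sp d} : x ∈ cell T ↔ ∀ a, 0 ≤ bary T a x := by
  rw [cell, ← hT.range_basis, hT.basis.convexHull_eq_nonneg_coord]
  refine ⟨fun h a => ?_, fun h a => by rw [← bary_of_mem hT]; exact h a⟩
  by_cases ha : a ∈ T
  · rw [bary_of_mem hT ⟨a, ha⟩]
    exact h _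
  · rw [bary_of_notMem ha]

theorem mem_interior_cell_iff (hT : IsSimplex T) {x : Sp d} :
    x ∈ interior (cell T) ↔ ∀ a ∈ T, 0 < bary T a x := by
  rw [cell, ← hT.range_basis, hT.basis.interior_convexHull]
  exact ⟨fun h a ha => by rw [bary_of_mem hT ⟨a, ha⟩]; exact h _,
    fun h a => by rw [← bary_of_mem hT]; exact h a a.2⟩

theorem bary_le_one (hT : IsSimplex T) {x : Sp d} (hx : x ∈ cell T) (a : Sp d) :
    bary T a x ≤ 1 := by
  rw [mem_cell_iff hT] at hx
  by_cases ha : a ∈ T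
  · rw [← sum_bary hT x]
    exact Finset.single_le_sum (f := fun a => bary T a x) (fun b _ => hx b) ha
  · simp [bary_of_notMem ha]

theorem bary_polyFun (hT : IsSimplex T) (a : Sp d) : bary T a ∈ polyFun d 1 := by
  obtain ⟨f, hf⟩ := exists_affineMap_bary hT a
  have h1 : bary T a = (fun _ : Sp d => f 0) + ∑ i : Fin d,
      f.linear (EuclideanSpace.single i 1) • fun x : Sp d => x i := by
    funext x
    have h2 : x = ∑ i : Fin d, x i • EuclideanSpace.single i (1 : ℝ) := by
      have := (EuclideanSpace.basisFun (Fin d) ℝ).sum_repr x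
      simpa using this.symm
    have h3 : f x = f.linear x + f 0 := by
      have := f.map_vadd 0 x
      simpa using this
    rw [hf, h3]
    conv_lhs => rw [h2]
    simp [mul_comm, add_comm]
  rw [h1]
  exact Submodule.add_mem _ (polyFun_const 1 _)
    (Submodule.sum_mem _ fun i _ => Submodule.smul_mem _ _ (polyFun_coord i))

theorem continuous_bary (hT : IsSimplex T) (a : Sp d) : Continuous (bary T a) :=
  (polyFun_contDiff (bary_polyFun hT a)).continuous

theorem isCompact_cell (T : Finset (Sp d)) : IsCompact (cell T) :=
  T.finite_toSet.isCompact_convexHull ℝ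

theorem isClosed_cell (T : Finset (Sp d)) : IsClosed (cell T) := (isCompact_cell T).isClosed

theorem subset_cell (T : Finset (Sp d)) {a : Sp d} (ha : a ∈ T) : a ∈ cell T :=
  subset_convexHull ℝ _ ha

theorem interior_cell_nonempty (hT : IsSimplex T) : (interior (cell T)).Nonempty := by
  rw [cell, interior_convexHull_nonempty_iff_affineSpan_eq_top, ← hT.range_basis]
  exact hT.basis.tot

theorem cell_subset_closure_interior (hT : IsSimplex T) : cell T ⊆ closure (interior (cell T)) := by
  rw [cell, (convex_convexHull ℝ _).closure_interior_eq_closure_of_nonempty_interior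
    (interior_cell_nonempty hT)]
  exact subset_closure

theorem dist_le_diam_cell (T : Finset (Sp d)) {x y : Sp d} (hx : x ∈ cell T) (hy : y ∈ cell T) :
    dist x y ≤ Metric.diam (cell T) :=
  Metric.dist_le_diam_of_mem (isCompact_cell T).isBounded hx hy

theorem diam_cell_pos (hd : 1 ≤ d) (hT : IsSimplex T) : 0 < Metric.diam (cell T) := by
  obtain ⟨a, ha, b, hb, hab⟩ := Finset.one_lt_card.1 (by rw [hT.card_eq]; omega : 1 < T.card)
  exact (dist_pos.2 hab).trans_le (dist_le_diam_cell T (subset_cell T ha) (subset_cell T hb))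

/-- The edges of a simplex are at least as long as the diameter of any ball it contains. -/
theorem le_dist_of_closedBall_subset (hT : IsSimplex T) {a b x₀ : Sp d} {ρ : ℝ}
    (hρ : 0 ≤ ρ) (hball : Metric.closedBall x₀ ρ ⊆ cell T) (ha : a ∈ T) (hb : b ∈ T)
    (hab : a ≠ b) : 2 * ρ ≤ dist a b := by
  obtain ⟨f, hf⟩ := exists_affineMap_bary hT a
  have hsub : ∀ x y, f x - f y = f.linear (x - y) := fun x y => by
    simpa using (f.linearMap_vsub x y).symm
  have hpos : 0 < ‖a - b‖ := norm_pos_iff.2 (sub_ne_zero.2 hab)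
  set u : Sp d := (ρ / ‖a - b‖) • (a - b)
  have hu : ‖u‖ ≤ ρ := by
    simp only [u, norm_smul, norm_div, Real.norm_eq_abs, abs_of_nonneg hρ, abs_norm]
    rw [div_mul_cancel₀ _ hpos.ne']
  have h1 : x₀ + u ∈ cell T := hball (by simpa using hu)
  have h2 : x₀ - u ∈ cell T := hball (by simpa [dist_eq_norm] using hu)
  have h3 : f (x₀ + u) - f (x₀ - u) = 2 * (ρ / ‖a - b‖) := by
    rw [hsub]
    have : x₀ + u - (x₀ - u) = (2 * (ρ / ‖a - b‖)) • (a - b) := by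
      simp only [u, mul_smul, two_smul]
      abel
    rw [this, map_smul, ← hsub, ← hf, ← hf, bary_self hT ha, bary_ne hT hb hab]
    simp
  have h4 := bary_le_one hT h1 a
  have h5 := (mem_cell_iff hT).1 h2 a
  rw [hf] at h4 h5
  have h6 : 2 * (ρ / ‖a - b‖) ≤ 1 := by linarith
  rw [dist_eq_norm]
  rw [← mul_div_assoc, div_le_one hpos] at h6
  exact h6

end Bary

/-! ### Lagrange polynomials of a simplex -/

section Lagrange

variable {d : ℕ} {T : Finset (Sp d)}

/-- The Lagrange node of degree `r` with multi-index `α`. -/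
def lagNode (r : ℕ) (T : Finset (Sp d)) (α : Sp d → ℕ) : Sp d :=
  ∑ a ∈ T, ((α a : ℝ) / (r : ℝ)) • a

/-- The Newton polynomial `∏_a ∏_{j < α_a} (r λ_a - j)`. -/
def newtonPoly (r : ℕ) (T : Finset (Sp d)) (α : Sp d → ℕ) (x : Sp d) : ℝ :=
  ∏ a ∈ T, ∏ j ∈ Finset.range (α a), ((r : ℝ) * bary T a x - j)

/-- The Lagrange polynomial of degree `r` with multi-index `α`. -/
def lagPoly (r : ℕ) (T : Finset (Sp d)) (α : Sp d → ℕ) (x : Sp d) : ℝ :=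
  ∏ a ∈ T, ∏ j ∈ Finset.range (α a), (((r : ℝ) * bary T a x - j) / ((α a : ℝ) - j))

theorem newtonPoly_eq_smul (r : ℕ) (T : Finset (Sp d)) (α : Sp d → ℕ) :
    newtonPoly r T α =
      (∏ a ∈ T, ∏ j ∈ Finset.range (α a), ((α a : ℝ) - j)) • lagPoly r T α := by
  funext x
  simp only [newtonPoly, lagPoly, Pi.smul_apply, smul_eq_mul, ← Finset.prod_mul_distrib]
  refine Finset.prod_congr rfl fun a _ => Finset.prod_congr rfl fun j hj => ?_
  have : (α a : ℝ) - j ≠ 0 := by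
    rw [sub_ne_zero, Ne, Nat.cast_inj]
    exact (Finset.mem_range.1 hj).ne'
  field_simp

theorem bary_lagNode (hT : IsSimplex T) {r : ℕ} (hr : 1 ≤ r) {α : Sp d → ℕ}
    (hα : ∑ a ∈ T, α a = r) {a : Sp d} (ha : a ∈ T) : bary T a (lagNode r T α) = α a / r := by
  classical
  rw [lagNode, bary_sum hT subset_rfl, if_pos ha]
  rw [← Finset.sum_div, ← Nat.cast_sum, hα, div_self (by positivity)]

theorem lagPoly_lagNode [DecidableEq (Sp d)] (hT : IsSimplex T) {r : ℕ} (hr : 1 ≤ r)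
    {α β : Sp d → ℕ} (hα : α ∈ T.piAntidiag r) (hβ : β ∈ T.piAntidiag r) [Decidable (α = β)] :
    lagPoly r T α (lagNode r T β) = if α = β then 1 else 0 := by
  rw [Finset.mem_piAntidiag] at hα hβ
  have hr' : (r : ℝ) ≠ 0 := by positivity
  have hc : ∀ a ∈ T, (r : ℝ) * bary T a (lagNode r T β) = β a := fun a ha => by
    rw [bary_lagNode hT hr hβ.1 ha, mul_div_cancel₀ _ hr']
  split_ifs with h
  · subst h
    refine Finset.prod_eq_one fun a ha => Finset.prod_eq_one fun j hj => ?_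
    rw [hc a ha, div_self]
    rw [sub_ne_zero, Ne, Nat.cast_inj]
    exact (Finset.mem_range.1 hj).ne'
  · obtain ⟨a, ha, hlt⟩ : ∃ a ∈ T, β a < α a := by
      by_contra! hle
      refine h (funext fun a => ?_)
      by_cases ha : a ∈ T
      · exact (Finset.sum_eq_sum_iff_of_le hle).1 (hα.1.trans hβ.1.symm) a ha
      · have h1 : α a = 0 := by
          by_contra h0
          exact ha (hα.2 a h0)
        have h2 : β a = 0 := by
          by_contra h0
          exact ha (hβ.2 a h0)
        rw [h1, h2]
    refine Finset.prod_eq_zero ha (Finset.prod_eq_zero (Finset.mem_range.2 hlt) ?_)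
    rw [hc a ha, sub_self, zero_div]

theorem lagPoly_polyFun [DecidableEq (Sp d)] (hT : IsSimplex T) {r : ℕ} {α : Sp d → ℕ}
    (hα : α ∈ T.piAntidiag r) : lagPoly r T α ∈ polyFun d r := by
  rw [Finset.mem_piAntidiag] at hα
  have h := polyFun_prod T (f := fun a x => ∏ j ∈ Finset.range (α a),
    (((r : ℝ) * bary T a x - j) / ((α a : ℝ) - j))) (e := fun a => ∑ _j ∈ Finset.range (α a), 1)
    (fun a _ => polyFun_prod _ fun j _ => by
      have : (fun x => ((r : ℝ) * bary T a x - j) / ((α a : ℝ) - j)) =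
          ((α a : ℝ) - j)⁻¹ • ((r : ℝ) • bary T a - fun _ => (j : ℝ)) := by
        funext x
        simp [div_eq_inv_mul]
      rw [this]
      exact Submodule.smul_mem _ _ (Submodule.sub_mem _
        (Submodule.smul_mem _ _ (bary_polyFun hT a)) (polyFun_const 1 _)))
  have h' : lagPoly r T α ∈ polyFun d (∑ a ∈ T, α a) := by
    simp only [Finset.sum_const, Finset.card_range, smul_eq_mul, mul_one] at h
    exact h
  rwa [hα.1] at h'

/-- The span of the Newton polynomials of order `s`. -/
def newtonSpan (r : ℕ) (T : Finset (Sp d)) (s : ℕ) : Submodule ℝ (Sp d → ℝ) :=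
  Submodule.span ℝ {f | ∃ α : Sp d → ℕ, ∑ a ∈ T, α a = s ∧ (∀ a, α a ≠ 0 → a ∈ T) ∧
    f = newtonPoly r T α}

theorem newtonPoly_mul_bary [DecidableEq (Sp d)] (r : ℕ) {α : Sp d → ℕ} {a : Sp d} (ha : a ∈ T)
    (x : Sp d) : (r : ℝ) * bary T a x * newtonPoly r T α x =
      newtonPoly r T (α + Pi.single a 1) x + α a * newtonPoly r T α x := by
  have h : newtonPoly r T (α + Pi.single a 1) x =
      newtonPoly r T α x * ((r : ℝ) * bary T a x - α a) := by
    unfold newtonPoly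
    rw [← Finset.mul_prod_erase _ _ ha, ← Finset.mul_prod_erase T (fun a => _) ha]
    have : ∀ b ∈ T.erase a, ∏ j ∈ Finset.range ((α + Pi.single a 1 : Sp d → ℕ) b),
        ((r : ℝ) * bary T b x - j) = ∏ j ∈ Finset.range (α b), ((r : ℝ) * bary T b x - j) := by
      intro b hb
      rw [Pi.add_apply, Pi.single_eq_of_ne (Finset.ne_of_mem_erase hb), add_zero]
    rw [Finset.prod_congr rfl this, Pi.add_apply, Pi.single_eq_same, Finset.prod_range_succ]
    ring
  rw [h]
  ring

theorem newtonPoly_single_mem [DecidableEq (Sp d)] {r s : ℕ} {α : Sp d → ℕ}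
    (hα : ∑ a ∈ T, α a = s) (hα' : ∀ a, α a ≠ 0 → a ∈ T) {a : Sp d} (ha : a ∈ T) :
    newtonPoly r T (α + Pi.single a 1) ∈ newtonSpan r T (s + 1) := by
  refine Submodule.subset_span ⟨_, ?_, ?_, rfl⟩
  · simp [Finset.sum_add_distrib, hα, ha]
  · intro b hb
    by_cases hab : b = a
    · exact hab ▸ ha
    · exact hα' b (by simpa [Pi.single_eq_of_ne hab] using hb)

theorem newtonSpan_le_succ (hT : IsSimplex T) {r s : ℕ} (hs : s < r) :
    newtonSpan r T s ≤ newtonSpan r T (s + 1) := by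
  classical
  refine Submodule.span_le.2 ?_
  rintro f ⟨α, hα, hα', rfl⟩
  have h : newtonPoly r T α =
      ((r : ℝ) - s)⁻¹ • ∑ a ∈ T, newtonPoly r T (α + Pi.single a 1) := by
    funext x
    have h1 := Finset.sum_congr rfl fun a (ha : a ∈ T) => newtonPoly_mul_bary r (α := α) ha x
    rw [Finset.sum_add_distrib, ← Finset.sum_mul, ← Finset.sum_mul, ← Finset.mul_sum,
      sum_bary hT, ← Nat.cast_sum, hα] at h1
    have h2 : (r : ℝ) - s ≠ 0 := by
      rw [sub_ne_zero, Ne, Nat.cast_inj]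
      exact hs.ne'
    simp only [Pi.smul_apply, Finset.sum_apply, smul_eq_mul]
    rw [eq_inv_mul_iff_mul_eq₀ h2]
    linarith
  rw [SetLike.mem_coe, h]
  exact Submodule.smul_mem _ _ (Submodule.sum_mem _ fun a ha => newtonPoly_single_mem hα hα' ha)

theorem newtonSpan_mono (hT : IsSimplex T) {r s t : ℕ} (hst : s ≤ t) (ht : t ≤ r) :
    newtonSpan r T s ≤ newtonSpan r T t := by
  induction t, hst using Nat.le_induction with
  | base => exact le_rfl
  | succ t _ ih => exact (ih (by omega)).trans (newtonSpan_le_succ hT (by omega))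

theorem coord_mul_mem_newtonSpan (hT : IsSimplex T) {r s : ℕ} (hs : s < r) (i : Fin d)
    {f : Sp d → ℝ} (hf : f ∈ newtonSpan r T s) :
    (fun x => x i * f x) ∈ newtonSpan r T (s + 1) := by
  classical
  have hr : (r : ℝ) ≠ 0 := by
    have : 0 < r := by omega
    positivity
  induction hf using Submodule.span_induction with
  | mem f hf =>
    obtain ⟨α, hα, hα', rfl⟩ := hf
    have h : (fun x : Sp d => x i * newtonPoly r T α x) = ∑ a ∈ T, ((a i) / (r : ℝ)) •
        (newtonPoly r T (α + Pi.single a 1) + (α a : ℝ) • newtonPoly r T α) := by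
      funext x
      simp only [Finset.sum_apply, Pi.smul_apply, Pi.add_apply, smul_eq_mul]
      have hx : x i = ∑ a ∈ T, bary T a x * a i := by
        conv_lhs => rw [← sum_bary_smul hT x]
        simp
      rw [hx, Finset.sum_mul]
      refine Finset.sum_congr rfl fun a ha => ?_
      rw [← newtonPoly_mul_bary r ha x]
      field_simp
    rw [h]
    exact Submodule.sum_mem _ fun a ha => Submodule.smul_mem _ _ (Submodule.add_mem _
      (newtonPoly_single_mem hα hα' ha) (Submodule.smul_mem _ _
        (newtonSpan_le_succ hT hs (Submodule.subset_span ⟨α, hα, hα', rfl⟩))))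
  | zero =>
    refine (congrArg (· ∈ newtonSpan r T (s + 1)) (funext fun x => ?_)).mp
      (Submodule.zero_mem _)
    simp
  | add f g _ _ hf hg =>
    refine (congrArg (· ∈ newtonSpan r T (s + 1)) (funext fun x => ?_)).mp
      (Submodule.add_mem _ hf hg)
    simp [mul_add]
  | smul c f _ hf =>
    have := Submodule.smul_mem _ c hf
    refine (congrArg (· ∈ newtonSpan r T (s + 1)) (funext fun x => ?_)).mp this
    simp only [Pi.smul_apply, smul_eq_mul]
    ring

theorem prod_coord_mem_newtonSpan (hT : IsSimplex T) {r : ℕ} (s : ℕ) (hs : s ≤ r)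
    (m : Fin d → ℕ) (hm : ∑ i, m i = s) : (fun x : Sp d => ∏ i, x i ^ m i) ∈ newtonSpan r T s := by
  induction s generalizing m with
  | zero =>
    have h0 : ∀ i, m i = 0 := fun i => by
      simpa using (Finset.sum_eq_zero_iff.1 hm) i (Finset.mem_univ i)
    refine Submodule.subset_span ⟨fun _ => 0, by simp, by simp, ?_⟩
    funext x
    simp [h0, newtonPoly]
  | succ s ih =>
    obtain ⟨i, hi⟩ : ∃ i, m i ≠ 0 := by
      by_contra! h
      simp [h] at hm
    let m' : Fin d → ℕ := Function.update m i (m i - 1)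
    have h1 : ∑ j, m' j = s := by
      have e1 := Finset.add_sum_erase Finset.univ m (Finset.mem_univ i)
      have e2 := Finset.add_sum_erase Finset.univ m' (Finset.mem_univ i)
      have e3 : ∑ j ∈ Finset.univ.erase i, m' j = ∑ j ∈ Finset.univ.erase i, m j :=
        Finset.sum_congr rfl fun j hj => by simp [m', Finset.ne_of_mem_erase hj]
      have e4 : m' i = m i - 1 := by simp [m']
      omega
    have h2 := coord_mul_mem_newtonSpan hT (by omega : s < r) i (ih (by omega) m' h1)
    refine (congrArg (· ∈ newtonSpan r T (s + 1)) (funext fun x => ?_)).mp h2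
    rw [← Finset.mul_prod_erase _ _ (Finset.mem_univ i),
      ← Finset.mul_prod_erase _ (fun j => x j ^ m j) (Finset.mem_univ i), ← mul_assoc]
    congr 1
    · simp only [m', Function.update_self]
      rw [← pow_succ']
      congr 1
      omega
    · exact Finset.prod_congr rfl fun j hj => by simp [m', Finset.ne_of_mem_erase hj]

theorem polyFun_le_newtonSpan (hT : IsSimplex T) (r : ℕ) : polyFun d r ≤ newtonSpan r T r := by
  rintro f ⟨p, hp, hp'⟩
  have h1 : f = ∑ s ∈ p.support, p.coeff s • fun y : Sp d => ∏ i, y i ^ s i := by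
    funext y
    rw [hp', MvPolynomial.eval_eq']
    simp [Finset.sum_apply]
  rw [h1]
  refine Submodule.sum_mem _ fun s hs => Submodule.smul_mem _ _ ?_
  have h2 : ∑ i, s i ≤ r := by
    simpa [Finsupp.sum_fintype] using (MvPolynomial.le_totalDegree hs).trans hp
  exact newtonSpan_mono hT h2 le_rfl (prod_coord_mem_newtonSpan hT _ h2 s rfl)

/-- The Lagrange interpolation formula. -/
theorem polyFun_eq_sum_lagPoly [DecidableEq (Sp d)] (hT : IsSimplex T) {r : ℕ} (hr : 1 ≤ r)
    {f : Sp d → ℝ} (hf : f ∈ polyFun d r) (x : Sp d) :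
    f x = ∑ α ∈ T.piAntidiag r, f (lagNode r T α) * lagPoly r T α x := by
  classical
  have h := polyFun_le_newtonSpan hT r hf
  clear hf
  induction h using Submodule.span_induction with
  | mem f hf =>
    obtain ⟨β, hβ, hβ', rfl⟩ := hf
    have hβm : β ∈ T.piAntidiag r := Finset.mem_piAntidiag.2 ⟨hβ, hβ'⟩
    rw [Finset.sum_eq_single β]
    · rw [newtonPoly_eq_smul]
      simp only [Pi.smul_apply, smul_eq_mul]
      rw [lagPoly_lagNode hT hr hβm hβm, if_pos rfl, mul_one]
    · intro α hα hne
      rw [newtonPoly_eq_smul]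
      simp only [Pi.smul_apply, smul_eq_mul]
      rw [lagPoly_lagNode hT hr hβm hα, if_neg hne.symm, mul_zero, zero_mul]
    · exact fun h => absurd hβm h
  | zero => simp
  | add f g _ _ hf hg => simp only [Pi.add_apply, add_mul, Finset.sum_add_distrib, ← hf, ← hg]
  | smul c f _ hf => simp only [Pi.smul_apply, smul_eq_mul, mul_assoc, ← Finset.mul_sum, ← hf]

theorem abs_lagPoly_le [DecidableEq (Sp d)] (hT : IsSimplex T) {r : ℕ} (hr : 1 ≤ r)
    {α : Sp d → ℕ} (hα : α ∈ T.piAntidiag r) {x : Sp d} (hx : x ∈ cell T) :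
    |lagPoly r T α x| ≤ (r : ℝ) ^ r := by
  rw [Finset.mem_piAntidiag] at hα
  have h1 : ∀ a ∈ T, |∏ j ∈ Finset.range (α a), (((r : ℝ) * bary T a x - j) / ((α a : ℝ) - j))| ≤
      (r : ℝ) ^ α a := by
    intro a ha
    rw [Finset.abs_prod]
    have : ∏ j ∈ Finset.range (α a), |((r : ℝ) * bary T a x - j) / ((α a : ℝ) - j)| ≤
        ∏ _j ∈ Finset.range (α a), (r : ℝ) := by
      refine Finset.prod_le_prod (fun _ _ => abs_nonneg _) fun j hj => ?_
      have hj' : (j : ℝ) + 1 ≤ α a := by exact_mod_cast Finset.mem_range.1 hj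
      have hα' : (α a : ℝ) ≤ r := by
        have : α a ≤ r := hα.1 ▸ Finset.single_le_sum (f := α) (fun _ _ => Nat.zero_le _) ha
        exact_mod_cast this
      have h0 := (mem_cell_iff hT).1 hx a
      have h2 := bary_le_one hT hx a
      have hr0 : (0 : ℝ) ≤ r := by positivity
      have hj0 : (0 : ℝ) ≤ j := by positivity
      rw [abs_div, abs_of_pos (by linarith : (0 : ℝ) < α a - j)]
      refine (div_le_self (abs_nonneg _) (by linarith)).trans ?_
      rw [abs_le]
      constructor <;> nlinarith
    simpa using this
  rw [lagPoly, Finset.abs_prod]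
  refine (Finset.prod_le_prod (fun _ _ => abs_nonneg _) h1).trans ?_
  rw [Finset.prod_pow_eq_pow_sum, hα.1]

theorem card_piAntidiag_le [DecidableEq (Sp d)] (hT : IsSimplex T) (r : ℕ) :
    (T.piAntidiag r).card ≤ (r + 1) ^ (d + 1) := by
  have h : (T.piAntidiag r).card ≤ (T.pi fun _ => Finset.range (r + 1)).card := by
    refine Finset.card_le_card_of_injOn (fun α a _ => α a) (fun α hα => ?_) ?_
    · rw [Finset.mem_coe, Finset.mem_piAntidiag] at hα
      rw [Finset.mem_coe, Finset.mem_pi]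
      intro a ha
      have : α a ≤ r := hα.1 ▸ Finset.single_le_sum (f := α) (fun _ _ => Nat.zero_le _) ha
      exact Finset.mem_range.2 (Nat.lt_succ_of_le this)
    · intro α hα β hβ hαβ
      rw [Finset.mem_coe, Finset.mem_piAntidiag] at hα hβ
      funext a
      by_cases ha : a ∈ T
      · exact congrFun (congrFun hαβ a) ha
      · rw [not_imp_comm.1 (hα.2 a) ha, not_imp_comm.1 (hβ.2 a) ha]
  simpa [Finset.card_pi, hT.card_eq] using h

theorem lagNode_mem_cell [DecidableEq (Sp d)] (hT : IsSimplex T) {r : ℕ} (hr : 1 ≤ r)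
    {α : Sp d → ℕ} (hα : α ∈ T.piAntidiag r) : lagNode r T α ∈ cell T := by
  rw [Finset.mem_piAntidiag] at hα
  rw [mem_cell_iff hT]
  intro a
  by_cases ha : a ∈ T
  · rw [bary_lagNode hT hr hα.1 ha]
    positivity
  · rw [bary_of_notMem ha]

theorem mem_lagrangeNodes_iff [DecidableEq (Sp d)] {r : ℕ} {l : Sp d} :
    l ∈ lagrangeNodes r T ↔ ∃ α ∈ T.piAntidiag r, lagNode r T α = l := by
  simp only [lagrangeNodes, Finset.mem_image, lagNode, Finset.mem_piAntidiag]

theorem lagrangeNodes_subset_cell (hT : IsSimplex T) {r : ℕ} (hr : 1 ≤ r) {l : Sp d}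
    (hl : l ∈ lagrangeNodes r T) : l ∈ cell T := by
  classical
  obtain ⟨α, hα, rfl⟩ := mem_lagrangeNodes_iff.1 hl
  exact lagNode_mem_cell hT hr hα

/-- A polynomial is bounded on a simplex by its values at the Lagrange nodes. -/
theorem abs_le_of_abs_lagrangeNodes_le (hT : IsSimplex T) {r : ℕ} (hr : 1 ≤ r) {f : Sp d → ℝ}
    (hf : f ∈ polyFun d r) {B : ℝ} (hB : ∀ l ∈ lagrangeNodes r T, |f l| ≤ B) {x : Sp d}
    (hx : x ∈ cell T) : |f x| ≤ ((r + 1 : ℝ) ^ (d + 1) * (r : ℝ) ^ r) * B := by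
  classical
  rw [polyFun_eq_sum_lagPoly hT hr hf x]
  have hB' : ∀ α ∈ T.piAntidiag r, |f (lagNode r T α) * lagPoly r T α x| ≤ (r : ℝ) ^ r * B := by
    intro α hα
    rw [abs_mul, mul_comm]
    exact mul_le_mul (abs_lagPoly_le hT hr hα hx) (hB _ (mem_lagrangeNodes_iff.2 ⟨α, hα, rfl⟩))
      (abs_nonneg _) (by positivity)
  refine (Finset.abs_sum_le_sum_abs _ _).trans ((Finset.sum_le_sum hB').trans ?_)
  rw [Finset.sum_const, nsmul_eq_mul, mul_assoc]
  have hB0 : 0 ≤ B := by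
    obtain ⟨a, ha⟩ : T.Nonempty := Finset.card_pos.1 (by rw [hT.card_eq]; omega)
    have hα : (Pi.single a r : Sp d → ℕ) ∈ T.piAntidiag r := by
      rw [Finset.mem_piAntidiag]
      refine ⟨by simp [ha], fun b hb => ?_⟩
      by_contra hbT
      exact hb (Pi.single_eq_of_ne (by rintro rfl; exact hbT ha) _)
    exact (abs_nonneg _).trans (hB _ (mem_lagrangeNodes_iff.2 ⟨_, hα, rfl⟩))
  refine mul_le_mul_of_nonneg_right ?_ (by positivity)
  exact_mod_cast card_piAntidiag_le hT r

end Lagrange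

/-! ### Geometry of conforming meshes -/

@[to_additive]
theorem prod_eq_prod_of_ne_one {ι M : Type*} [CommMonoid M] {s t : Finset ι} {f : ι → M}
    (hs : ∀ i ∈ s, f i ≠ 1 → i ∈ t) (ht : ∀ i ∈ t, f i ≠ 1 → i ∈ s) :
    ∏ i ∈ s, f i = ∏ i ∈ t, f i := by
  classical
  rw [← Finset.prod_subset (Finset.inter_subset_left (s₁ := s) (s₂ := t)),
    ← Finset.prod_subset (Finset.inter_subset_right (s₁ := s) (s₂ := t))]
  · exact fun i hi hi' => by_contra fun h => hi' (Finset.mem_inter.2 ⟨ht i hi h, hi⟩)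
  · exact fun i hi hi' => by_contra fun h => hi' (Finset.mem_inter.2 ⟨hi, hs i hi h⟩)

section Geometry

variable {d : ℕ} (𝒯 : Mesh d)

/-- On the intersection of two elements the barycentric coordinates agree. -/
theorem bary_eq_bary {T T' : Finset (Sp d)} (hT : T ∈ 𝒯.elems) (hT' : T' ∈ 𝒯.elems) {x : Sp d}
    (hx : x ∈ cell T) (hx' : x ∈ cell T') (a : Sp d) : bary T a x = bary T' a x := by
  classical
  have h := 𝒯.conforming T hT T' hT' ⟨hx, hx'⟩
  rw [← Finset.coe_inter, Finset.mem_convexHull'] at h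
  obtain ⟨w, -, hw1, rfl⟩ := h
  rw [bary_sum (𝒯.isSimplex hT) Finset.inter_subset_left hw1,
    bary_sum (𝒯.isSimplex hT') Finset.inter_subset_right hw1]

theorem eq_of_mem_interior_cell {T T' : Finset (Sp d)} (hT : T ∈ 𝒯.elems) (hT' : T' ∈ 𝒯.elems)
    {x : Sp d} (hx : x ∈ interior (cell T)) (hx' : x ∈ cell T') : T = T' := by
  refine Finset.eq_of_subset_of_card_le (fun a ha => ?_)
    (by rw [𝒯.card_eq T hT, 𝒯.card_eq T' hT'])
  by_contra ha'
  have h1 := (mem_interior_cell_iff (𝒯.isSimplex hT)).1 hx a ha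
  rw [bary_eq_bary 𝒯 hT hT' (interior_subset hx) hx', bary_of_notMem ha'] at h1
  exact lt_irrefl _ h1

theorem isClosed_iUnion_cell (S : Finset (Finset (Sp d))) : IsClosed (⋃ T ∈ S, cell T) :=
  S.finite_toSet.isClosed_biUnion fun T _ => isClosed_cell T

theorem isOpen_region (S : Finset (Finset (Sp d))) : IsOpen (region S) := isOpen_interior

theorem isOpen_domain : IsOpen 𝒯.domain := isOpen_interior

theorem exists_mem_cell_of_mem_region {S : Finset (Finset (Sp d))} {x : Sp d}
    (hx : x ∈ region S) : ∃ T ∈ S, x ∈ cell T := by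
  simpa using interior_subset hx

theorem interior_cell_subset_region {S : Finset (Finset (Sp d))} {T : Finset (Sp d)} (hT : T ∈ S) :
    interior (cell T) ⊆ region S :=
  interior_mono (Set.subset_biUnion_of_mem (u := cell) hT)

theorem cell_subset_closure_region {S : Finset (Finset (Sp d))} {T : Finset (Sp d)}
    (hT : IsSimplex T) (hTS : T ∈ S) : cell T ⊆ closure (region S) :=
  (cell_subset_closure_interior hT).trans (closure_mono (interior_cell_subset_region hTS))

theorem closure_region_subset (S : Finset (Finset (Sp d))) :
    closure (region S) ⊆ ⋃ T ∈ S, cell T :=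
  (closure_mono interior_subset).trans (isClosed_iUnion_cell S).closure_eq.subset

/-- An open set contained in the closure of `region S` is contained in `region S`. -/
theorem subset_region_of_isOpen {S : Finset (Finset (Sp d))} {U : Set (Sp d)} (hU : IsOpen U)
    (h : U ⊆ closure (region S)) : U ⊆ region S :=
  interior_maximal (h.trans (closure_region_subset S)) hU

/-- An element that contains a point of `region S` belongs to `S`. -/
theorem mem_of_mem_cell_of_mem_region {S : Finset (Finset (Sp d))} (hS : S ⊆ 𝒯.elems)
    {T : Finset (Sp d)} (hT : T ∈ 𝒯.elems) {x : Sp d} (hx : x ∈ cell T) (hx' : x ∈ region S) :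
    T ∈ S := by
  obtain ⟨y, hy, hyT⟩ := mem_closure_iff.1 (cell_subset_closure_interior (𝒯.isSimplex hT) hx)
    _ (isOpen_region S) hx'
  obtain ⟨T', hT', hyT'⟩ := exists_mem_cell_of_mem_region hy
  rwa [eq_of_mem_interior_cell 𝒯 hT (hS hT') hyT hyT']

theorem bary_lineMap {T : Finset (Sp d)} (hT : IsSimplex T) (a x y : Sp d) (t : ℝ) :
    bary T a (AffineMap.lineMap x y t) = (1 - t) * bary T a x + t * bary T a y := by
  obtain ⟨f, hf⟩ := exists_affineMap_bary hT a
  rw [hf, AffineMap.apply_lineMap, AffineMap.lineMap_apply_module, hf, hf, smul_eq_mul,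
    smul_eq_mul]

/-- If a point of the domain lies on an element `T`, then so does every point of `T` whose carrier
face contains the carrier face of the given point. -/
theorem mem_domain_of_bary_pos {T : Finset (Sp d)} (hT : T ∈ 𝒯.elems) {l x : Sp d}
    (hl : l ∈ 𝒯.domain) (hlT : l ∈ cell T) (hxT : x ∈ cell T)
    (hlx : ∀ a, 0 < bary T a l → 0 < bary T a x) : x ∈ 𝒯.domain := by
  classical
  obtain ⟨t, ht0, htd⟩ : ∃ t : ℝ, 0 < t ∧ t < 1 ∧ AffineMap.lineMap l x t ∈ 𝒯.domain := by
    have hc : ContinuousAt (fun t : ℝ => (AffineMap.lineMap l x t : Sp d)) 0 := by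
      simp only [AffineMap.lineMap_apply_module]
      fun_prop
    have h1 : ∀ᶠ t in nhds (0 : ℝ), (AffineMap.lineMap l x t : Sp d) ∈ 𝒯.domain :=
      hc.preimage_mem_nhds ((isOpen_domain 𝒯).mem_nhds (by simpa using hl))
    have h2 : ∀ᶠ t in nhdsWithin (0 : ℝ) (Set.Ioi 0), t < 1 :=
      Filter.Eventually.filter_mono nhdsWithin_le_nhds (Iio_mem_nhds zero_lt_one)
    obtain ⟨t, h3, h4, h5⟩ := ((h1.filter_mono nhdsWithin_le_nhds).and
      (h2.and self_mem_nhdsWithin)).exists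
    exact ⟨t, h5, h4, h3⟩
  obtain ⟨ht1, htd⟩ := htd
  have hsT := 𝒯.isSimplex hT
  have hc : Continuous fun y : Sp d => (AffineMap.lineMap l y t : Sp d) := by
    simp only [AffineMap.lineMap_apply_module]
    fun_prop
  have hxt : (AffineMap.lineMap l x t : Sp d) ∈ cell T := by
    rw [mem_cell_iff hsT] at hlT hxT ⊢
    intro a
    rw [bary_lineMap hsT]
    have := hlT a
    have := hxT a
    have : 0 ≤ 1 - t := by linarith
    positivity
  have key : ∀ T' ∈ 𝒯.elems, ∀ᶠ y in nhds x,
      (AffineMap.lineMap l y t : Sp d) ∈ cell T' → y ∈ cell T' := by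
    intro T' hT'
    have hsT' := 𝒯.isSimplex hT'
    by_cases hxt' : (AffineMap.lineMap l x t : Sp d) ∈ cell T'
    · have e1 : ∀ a, bary T' a (AffineMap.lineMap l x t) = bary T a (AffineMap.lineMap l x t) :=
        fun a => bary_eq_bary 𝒯 hT' hT hxt' hxt a
      let U := T.filter fun a => bary T a l ≠ 0
      have hU : U ⊆ T' := by
        intro a ha
        by_contra haT'
        have h0 : bary T a l ≠ 0 := (Finset.mem_filter.1 ha).2
        have h1 : 0 < bary T a l := lt_of_le_of_ne ((mem_cell_iff hsT).1 hlT a) h0.symm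
        have h2 := hlx a h1
        have h3 := e1 a
        rw [bary_of_notMem haT', bary_lineMap hsT] at h3
        have : 0 < 1 - t := by linarith
        have : 0 < (1 - t) * bary T a l + t * bary T a x := by positivity
        linarith
      have hlU : l = ∑ a ∈ U, bary T a l • a := by
        conv_lhs => rw [← sum_bary_smul hsT l]
        rw [Finset.sum_filter_of_ne]
        intro a _ h h0
        simp [h0] at h
      have hU1 : ∑ a ∈ U, bary T a l = 1 := by
        rw [← sum_bary hsT l, Finset.sum_filter_of_ne]
        exact fun a _ h => h
      have e2 : ∀ a, bary T' a l = bary T a l := by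
        intro a
        have h1 := bary_sum hsT' hU hU1 a
        have h2 := bary_sum hsT (Finset.filter_subset _ _ : U ⊆ T) hU1 a
        rw [← hlU] at h1 h2
        exact h1.trans h2.symm
      have e3 : ∀ a, bary T' a x = bary T a x := by
        intro a
        have := e1 a
        rw [bary_lineMap hsT, bary_lineMap hsT', e2, add_right_inj] at this
        exact mul_left_cancel₀ ht0.ne' this
      have h1 : ∀ a ∈ T', ∀ᶠ y in nhds x, 0 < bary T a x → 0 < bary T' a y := by
        intro a _
        by_cases h : 0 < bary T a x
        · have := (continuous_bary hsT' a).continuousAt.eventually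
            (lt_mem_nhds (by rwa [e3 a] : 0 < bary T' a x))
          filter_upwards [this] with y hy _ using hy
        · exact Filter.Eventually.of_forall fun y hy => absurd hy h
      filter_upwards [(Filter.eventually_all_finset T').2 h1] with y hy hyt
      rw [mem_cell_iff hsT']
      intro a
      by_cases haT' : a ∈ T'
      · by_cases h : 0 < bary T a x
        · exact (hy a haT' h).le
        · have h0 : bary T a l = 0 := by
            refine le_antisymm (not_lt.1 fun h' => h (hlx a h')) ((mem_cell_iff hsT).1 hlT a)
          have h2 := (mem_cell_iff hsT').1 hyt a
          rw [bary_lineMap hsT', e2, h0, mul_zero, zero_add] at h2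
          exact nonneg_of_mul_nonneg_right h2 ht0
      · rw [bary_of_notMem haT']
    · have := hc.continuousAt.preimage_mem_nhds
        ((isClosed_cell T').isOpen_compl.mem_nhds hxt')
      filter_upwards [this] with y hy hy'
      exact absurd hy' hy
  have hdom : ∀ᶠ y in nhds x, (AffineMap.lineMap l y t : Sp d) ∈ 𝒯.domain :=
    hc.continuousAt.preimage_mem_nhds ((isOpen_domain 𝒯).mem_nhds htd)
  rw [Mesh.domain, region, mem_interior_iff_mem_nhds]
  filter_upwards [(Filter.eventually_all_finset 𝒯.elems).2 key, hdom] with y hy hyd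
  obtain ⟨T', hT', hyT'⟩ := exists_mem_cell_of_mem_region hyd
  exact Set.mem_biUnion hT' (hy T' hT' hyT')

/-- A Lagrange node that lies on another element is a Lagrange node of that element, with the same
multi-index. -/
theorem lagNode_transfer [DecidableEq (Sp d)] {r : ℕ} (hr : 1 ≤ r) {T T' : Finset (Sp d)}
    (hT : T ∈ 𝒯.elems) (hT' : T' ∈ 𝒯.elems) {α : Sp d → ℕ} (hα : α ∈ T.piAntidiag r)
    (h : lagNode r T α ∈ cell T') :
    α ∈ T'.piAntidiag r ∧ lagNode r T' α = lagNode r T α := by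
  have hsT := 𝒯.isSimplex hT
  have hmem := lagNode_mem_cell hsT hr hα
  rw [Finset.mem_piAntidiag] at hα ⊢
  have hr' : (0 : ℝ) < r := by positivity
  have hsupp : ∀ a, α a ≠ 0 → a ∈ T' := by
    intro a ha
    by_contra haT'
    have := bary_eq_bary 𝒯 hT hT' hmem h a
    rw [bary_of_notMem haT', bary_lagNode hsT hr hα.1 (hα.2 a ha)] at this
    rw [div_eq_zero_iff] at this
    rcases this with h0 | h0
    · exact ha (by exact_mod_cast h0)
    · exact hr'.ne' h0
  refine ⟨⟨(sum_eq_sum_of_ne_zero (fun a _ => hα.2 a) fun a _ => hsupp a).trans hα.1, hsupp⟩,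
    sum_eq_sum_of_ne_zero (fun a _ h => hα.2 a ?_) fun a _ h => hsupp a ?_⟩ <;>
  · rintro h0
    simp [h0] at h

end Geometry

/-! ### The nodal basis -/

section NodalBasis

variable {d : ℕ} (𝒯 : Mesh d)

open Classical in
/-- Barycentric coordinates as piecewise affine functions on the mesh. -/
def hat (a x : Sp d) : ℝ :=
  if h : ∃ T ∈ 𝒯.elems, x ∈ cell T then bary h.choose a x else 0

theorem hat_eq_bary {T : Finset (Sp d)} (hT : T ∈ 𝒯.elems) {x : Sp d} (hx : x ∈ cell T)
    (a : Sp d) : hat 𝒯 a x = bary T a x := by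
  have h : ∃ T ∈ 𝒯.elems, x ∈ cell T := ⟨T, hT, hx⟩
  rw [hat, dif_pos h]
  exact bary_eq_bary 𝒯 h.choose_spec.1 hT h.choose_spec.2 hx a

theorem Vh_exists_polyFun {r : ℕ} {f : Sp d → ℝ} (hf : f ∈ 𝒯.Vh r) {T : Finset (Sp d)}
    (hT : T ∈ 𝒯.elems) : ∃ g ∈ polyFun d r, ∀ x ∈ cell T, f x = g x := by
  obtain ⟨p, hp, hp'⟩ := hf.2.2 T hT
  exact ⟨fun x => MvPolynomial.eval (fun i => x i) p, ⟨p, hp, fun _ => rfl⟩, hp'⟩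

theorem Vh_continuous {r : ℕ} {f : Sp d → ℝ} (hf : f ∈ 𝒯.Vh r) : Continuous f := hf.1

theorem Vh_eq_zero {r : ℕ} {f : Sp d → ℝ} (hf : f ∈ 𝒯.Vh r) {x : Sp d} (hx : x ∉ 𝒯.domain) :
    f x = 0 := hf.2.1 x hx

theorem mem_nodes_iff {r : ℕ} {l : Sp d} :
    l ∈ 𝒯.nodes r ↔ (∃ T ∈ 𝒯.elems, l ∈ lagrangeNodes r T) ∧ l ∈ 𝒯.domain := by
  simp [Mesh.nodes]

theorem mem_domain_of_mem_nodes {r : ℕ} {l : Sp d} (hl : l ∈ 𝒯.nodes r) : l ∈ 𝒯.domain :=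
  ((mem_nodes_iff 𝒯).1 hl).2

/-- Existence of a function in `V^h` with prescribed nodal values `δ_{l,l'}`. -/
theorem exists_nodal {r : ℕ} (hr : 1 ≤ r) {l : Sp d} (hl : l ∈ 𝒯.nodes r) :
    ∃ φ ∈ 𝒯.Vh r, ∀ y ∈ 𝒯.nodes r, φ y = open Classical in if y = l then 1 else 0 := by
  classical
  obtain ⟨⟨T₀, hT₀, hlT₀⟩, hld⟩ := (mem_nodes_iff 𝒯).1 hl
  obtain ⟨α, hα, rfl⟩ := mem_lagrangeNodes_iff.1 hlT₀
  have hαT₀ := Finset.mem_piAntidiag.1 hα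
  set P : Sp d → ℝ := fun x => ∏ a ∈ T₀, ∏ j ∈ Finset.range (α a),
    (((r : ℝ) * hat 𝒯 a x - j) / ((α a : ℝ) - j)) with hP
  have hzero : ∀ x a, α a ≠ 0 → hat 𝒯 a x = 0 → P x = 0 := by
    intro x a ha h0
    refine Finset.prod_eq_zero (hαT₀.2 a ha)
      (Finset.prod_eq_zero (Finset.mem_range.2 (Nat.pos_of_ne_zero ha)) ?_)
    simp [h0]
  have hin : ∀ T ∈ 𝒯.elems, (∀ a, α a ≠ 0 → a ∈ T) → ∀ x ∈ cell T, P x = lagPoly r T α x := by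
    intro T hT hsupp x hx
    simp only [hP, hat_eq_bary 𝒯 hT hx, lagPoly]
    have h0 : ∀ a, α a = 0 → ∏ j ∈ Finset.range (α a),
        (((r : ℝ) * bary T a x - j) / ((α a : ℝ) - j)) = 1 := fun a h => by simp [h]
    refine prod_eq_prod_of_ne_one (fun a _ h => hsupp a fun h' => h (h0 a h'))
      fun a _ h => hαT₀.2 a fun h' => h (h0 a h')
  have hsum : ∀ T, (∀ a, α a ≠ 0 → a ∈ T) → ∑ a ∈ T, α a = r := fun T hsupp =>
    (sum_eq_sum_of_ne_zero (fun a _ => hαT₀.2 a) fun a _ => hsupp a).trans hαT₀.1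
  have hnode : ∀ T, (∀ a, α a ≠ 0 → a ∈ T) → lagNode r T α = lagNode r T₀ α := by
    intro T hsupp
    refine sum_eq_sum_of_ne_zero (fun a _ h => hαT₀.2 a ?_) fun a _ h => hsupp a ?_ <;>
    · rintro h0
      simp [h0] at h
  have hout : ∀ T ∈ 𝒯.elems, (¬ ∀ a, α a ≠ 0 → a ∈ T) → ∀ x ∈ cell T, P x = 0 := by
    intro T hT hsupp x hx
    push Not at hsupp
    obtain ⟨a, ha, haT⟩ := hsupp
    exact hzero x a ha (by rw [hat_eq_bary 𝒯 hT hx, bary_of_notMem haT])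
  have hbd : ∀ T ∈ 𝒯.elems, ∀ x ∈ cell T, x ∉ 𝒯.domain → P x = 0 := by
    intro T hT x hx hxd
    by_cases hsupp : ∀ a, α a ≠ 0 → a ∈ T
    · have hlT : lagNode r T₀ α ∈ cell T := by
        rw [← hnode T hsupp]
        exact lagNode_mem_cell (𝒯.isSimplex hT) hr (Finset.mem_piAntidiag.2 ⟨hsum T hsupp, hsupp⟩)
      have hnot : ¬ ∀ a, 0 < bary T a (lagNode r T₀ α) → 0 < bary T a x :=
        fun h => hxd (mem_domain_of_bary_pos 𝒯 hT hld hlT hx h)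
      push Not at hnot
      obtain ⟨a, ha, ha'⟩ := hnot
      refine hzero x a ?_ ?_
      · rintro h0
        by_cases haT₀ : a ∈ T₀
        · rw [bary_eq_bary 𝒯 hT hT₀ hlT (lagNode_mem_cell (𝒯.isSimplex hT₀) hr hα),
            bary_lagNode (𝒯.isSimplex hT₀) hr hαT₀.1 haT₀] at ha
          simp [h0] at ha
        · rw [bary_eq_bary 𝒯 hT hT₀ hlT (lagNode_mem_cell (𝒯.isSimplex hT₀) hr hα),
            bary_of_notMem haT₀] at ha
          exact lt_irrefl _ ha
      · rw [hat_eq_bary 𝒯 hT hx]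
        exact le_antisymm ha' ((mem_cell_iff (𝒯.isSimplex hT)).1 hx a)
    · exact hout T hT hsupp x hx
  set φ : Sp d → ℝ := 𝒯.domain.indicator P with hφ
  have hφP : ∀ T ∈ 𝒯.elems, ∀ x ∈ cell T, φ x = P x := by
    intro T hT x hx
    by_cases hxd : x ∈ 𝒯.domain
    · exact Set.indicator_of_mem hxd _
    · rw [hφ, Set.indicator_of_notMem hxd, hbd T hT x hx hxd]
  have hpoly : ∀ T ∈ 𝒯.elems, ∃ g ∈ polyFun d r, ∀ x ∈ cell T, φ x = g x := by
    intro T hT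
    by_cases hsupp : ∀ a, α a ≠ 0 → a ∈ T
    · have hα' : α ∈ T.piAntidiag r := Finset.mem_piAntidiag.2 ⟨hsum T hsupp, hsupp⟩
      exact ⟨_, lagPoly_polyFun (𝒯.isSimplex hT) hα', fun x hx =>
        (hφP T hT x hx).trans (hin T hT hsupp x hx)⟩
    · exact ⟨0, Submodule.zero_mem _, fun x hx => (hφP T hT x hx).trans (hout T hT hsupp x hx)⟩
  have hcont : Continuous φ := by
    let F : Option 𝒯.elems → Set (Sp d) := fun o => o.elim 𝒯.domainᶜ fun T => cell T.1
    have hF : LocallyFinite F := locallyFinite_of_finite F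
    refine hF.continuous ?_ ?_ ?_
    · rw [Set.eq_univ_iff_forall]
      intro x
      by_cases hx : x ∈ 𝒯.domain
      · obtain ⟨T, hT, hxT⟩ := exists_mem_cell_of_mem_region hx
        exact Set.mem_iUnion.2 ⟨some ⟨T, hT⟩, hxT⟩
      · exact Set.mem_iUnion.2 ⟨none, hx⟩
    · rintro (_ | T)
      · exact (isOpen_domain 𝒯).isClosed_compl
      · exact isClosed_cell _
    · rintro (_ | T)
      · exact (continuousOn_const (c := (0 : ℝ))).congr fun x hx => Set.indicator_of_notMem hx _
      · obtain ⟨g, hg, hg'⟩ := hpoly T.1 T.2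
        exact (polyFun_contDiff hg).continuous.continuousOn.congr hg'
  refine ⟨φ, ⟨hcont, fun x hx => Set.indicator_of_notMem hx _, fun T hT => ?_⟩, fun y hy => ?_⟩
  · obtain ⟨g, ⟨p, hp, hp'⟩, hg'⟩ := hpoly T hT
    exact ⟨p, hp, fun x hx => (hg' x hx).trans (hp' x)⟩
  · obtain ⟨⟨T, hT, hyT⟩, hyd⟩ := (mem_nodes_iff 𝒯).1 hy
    obtain ⟨β, hβ, rfl⟩ := mem_lagrangeNodes_iff.1 hyT
    have hyc := lagNode_mem_cell (𝒯.isSimplex hT) hr hβ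
    rw [hφP T hT _ hyc]
    by_cases hy' : lagNode r T β = lagNode r T₀ α
    · rw [if_pos hy']
      have h1 := lagNode_transfer 𝒯 hr hT₀ hT hα (hy' ▸ hyc)
      rw [hin T hT (Finset.mem_piAntidiag.1 h1.1).2 _ hyc, hy', ← h1.2,
        lagPoly_lagNode (𝒯.isSimplex hT) hr h1.1 h1.1, if_pos rfl]
    · rw [if_neg hy']
      by_cases hsupp : ∀ a, α a ≠ 0 → a ∈ T
      · rw [hin T hT hsupp _ hyc, lagPoly_lagNode (𝒯.isSimplex hT) hr
          (Finset.mem_piAntidiag.2 ⟨hsum T hsupp, hsupp⟩) hβ, if_neg]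
        rintro rfl
        exact hy' (hnode T hsupp)
      · exact hout T hT hsupp _ hyc

end NodalBasis

section Nodal

variable {d : ℕ} (𝒯 : Mesh d) {r : ℕ}

theorem nodalBasis_mem (hr : 1 ≤ r) {l : Sp d} (hl : l ∈ 𝒯.nodes r) :
    𝒯.nodalBasis r l ∈ 𝒯.Vh r := by
  rw [Mesh.nodalBasis, dif_pos (exists_nodal 𝒯 hr hl)]
  exact (exists_nodal 𝒯 hr hl).choose_spec.1

theorem nodalBasis_apply [DecidableEq (Sp d)] (hr : 1 ≤ r) {l y : Sp d} (hl : l ∈ 𝒯.nodes r)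
    (hy : y ∈ 𝒯.nodes r) : 𝒯.nodalBasis r l y = if y = l then 1 else 0 := by
  rw [Mesh.nodalBasis, dif_pos (exists_nodal 𝒯 hr hl)]
  refine ((exists_nodal 𝒯 hr hl).choose_spec.2 y hy).trans ?_
  congr

theorem mem_nodes_of_mem_lagrangeNodes {T : Finset (Sp d)} (hT : T ∈ 𝒯.elems) {l : Sp d}
    (hl : l ∈ lagrangeNodes r T) (hld : l ∈ 𝒯.domain) : l ∈ 𝒯.nodes r :=
  (mem_nodes_iff 𝒯).2 ⟨⟨T, hT, hl⟩, hld⟩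

/-- Bound of a finite element function on an element by its nodal values. -/
theorem Vh_abs_le (hr : 1 ≤ r) {f : Sp d → ℝ} (hf : f ∈ 𝒯.Vh r) {T : Finset (Sp d)}
    (hT : T ∈ 𝒯.elems) {B : ℝ} (hB0 : 0 ≤ B)
    (hB : ∀ l ∈ lagrangeNodes r T, l ∈ 𝒯.nodes r → |f l| ≤ B) {x : Sp d} (hx : x ∈ cell T) :
    |f x| ≤ ((r + 1 : ℝ) ^ (d + 1) * (r : ℝ) ^ r) * B := by
  obtain ⟨g, hg, hfg⟩ := Vh_exists_polyFun 𝒯 hf hT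
  rw [hfg x hx]
  refine abs_le_of_abs_lagrangeNodes_le (𝒯.isSimplex hT) hr hg (fun l hl => ?_) hx
  rw [← hfg l (lagrangeNodes_subset_cell (𝒯.isSimplex hT) hr hl)]
  by_cases hld : l ∈ 𝒯.domain
  · exact hB l hl (mem_nodes_of_mem_lagrangeNodes 𝒯 hT hl hld)
  · rw [Vh_eq_zero 𝒯 hf hld, abs_zero]
    exact hB0

theorem Vh_eq_zero_on_cell (hr : 1 ≤ r) {f : Sp d → ℝ} (hf : f ∈ 𝒯.Vh r) {T : Finset (Sp d)}
    (hT : T ∈ 𝒯.elems) (h : ∀ l ∈ 𝒯.nodes r, l ∈ cell T → f l = 0) {x : Sp d}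
    (hx : x ∈ cell T) : f x = 0 := by
  have := Vh_abs_le 𝒯 hr hf hT le_rfl (fun l hl hln => by
    rw [h l hln (lagrangeNodes_subset_cell (𝒯.isSimplex hT) hr hl), abs_zero]) hx
  rw [mul_zero] at this
  exact abs_nonpos_iff.1 this

theorem Vh_ext (hr : 1 ≤ r) {f g : Sp d → ℝ} (hf : f ∈ 𝒯.Vh r) (hg : g ∈ 𝒯.Vh r)
    (h : ∀ l ∈ 𝒯.nodes r, f l = g l) : f = g := by
  funext x
  by_cases hx : x ∈ 𝒯.domain
  · obtain ⟨T, hT, hxT⟩ := exists_mem_cell_of_mem_region hx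
    have := Vh_eq_zero_on_cell 𝒯 hr (Submodule.sub_mem _ hf hg) hT
      (fun l hl _ => by simp [h l hl]) hxT
    simpa [sub_eq_zero] using this
  · rw [Vh_eq_zero 𝒯 hf hx, Vh_eq_zero 𝒯 hg hx]

/-- The finite element function with nodal values `g`. -/
def interp (r : ℕ) (g : Sp d → ℝ) : Sp d → ℝ := ∑ l ∈ 𝒯.nodes r, g l • 𝒯.nodalBasis r l

theorem interp_mem (hr : 1 ≤ r) (g : Sp d → ℝ) : interp 𝒯 r g ∈ 𝒯.Vh r :=
  Submodule.sum_mem _ fun _ hl => Submodule.smul_mem _ _ (nodalBasis_mem 𝒯 hr hl)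

theorem interp_apply (hr : 1 ≤ r) (g : Sp d → ℝ) {y : Sp d} (hy : y ∈ 𝒯.nodes r) :
    interp 𝒯 r g y = g y := by
  classical
  rw [interp, Finset.sum_apply, Finset.sum_eq_single y]
  · simp [nodalBasis_apply 𝒯 hr hy hy]
  · intro l hl hly
    simp [nodalBasis_apply 𝒯 hr hl hy, hly.symm]
  · exact fun h => absurd hy h

theorem interp_self (hr : 1 ≤ r) {f : Sp d → ℝ} (hf : f ∈ 𝒯.Vh r) : interp 𝒯 r f = f :=
  Vh_ext 𝒯 hr (interp_mem 𝒯 hr f) hf fun _ hl => interp_apply 𝒯 hr f hl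

theorem Vh_finiteDimensional (hr : 1 ≤ r) : FiniteDimensional ℝ (𝒯.Vh r) := by
  classical
  have hle : 𝒯.Vh r ≤ Submodule.span ℝ ((𝒯.nodes r).image (𝒯.nodalBasis r) : Set (Sp d → ℝ)) := by
    intro f hf
    rw [← interp_self 𝒯 hr hf]
    exact Submodule.sum_mem _ fun l hl => Submodule.smul_mem _ _
      (Submodule.subset_span (Finset.mem_image_of_mem _ hl))
  have := FiniteDimensional.span_finset ℝ ((𝒯.nodes r).image (𝒯.nodalBasis r))
  exact Submodule.finiteDimensional_of_le hle

theorem exists_mem_elems_of_mem_nodes {l : Sp d} (hl : l ∈ 𝒯.nodes r) :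
    ∃ T ∈ 𝒯.elems, l ∈ cell T :=
  exists_mem_cell_of_mem_region (mem_domain_of_mem_nodes 𝒯 hl)

/-- The degrees of freedom of a subdomain are the nodes it contains. -/
theorem mem_dof_iff (hr : 1 ≤ r) {S : Finset (Finset (Sp d))} (hS : S ⊆ 𝒯.elems) {l : Sp d} :
    l ∈ 𝒯.dof r (region S) ↔ l ∈ 𝒯.nodes r ∧ l ∈ region S := by
  classical
  rw [Mesh.dof, Finset.mem_filter]
  refine and_congr_right fun hl => ?_
  have hcont := Vh_continuous 𝒯 (nodalBasis_mem 𝒯 hr hl)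
  constructor
  · intro h
    refine subset_region_of_isOpen (isOpen_compl_singleton.preimage hcont)
      ((subset_tsupport _).trans h) (?_ : 𝒯.nodalBasis r l l ≠ 0)
    simp [nodalBasis_apply 𝒯 hr hl hl]
  · intro h
    refine closure_minimal (fun x hx => ?_) isClosed_closure
    have hxd : x ∈ 𝒯.domain :=
      by_contra fun hxd => hx (Vh_eq_zero 𝒯 (nodalBasis_mem 𝒯 hr hl) hxd)
    obtain ⟨T, hT, hxT⟩ := exists_mem_cell_of_mem_region hxd
    by_cases hlT : l ∈ cell T
    · exact cell_subset_closure_region (𝒯.isSimplex hT)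
        (mem_of_mem_cell_of_mem_region 𝒯 hS hT hlT h) hxT
    · refine absurd (Vh_eq_zero_on_cell 𝒯 hr (nodalBasis_mem 𝒯 hr hl) hT (fun y hy hyT => ?_) hxT)
        hx
      rw [nodalBasis_apply 𝒯 hr hl hy, if_neg]
      rintro rfl
      exact hlT hyT

theorem mem_nodes_of_mem_dof {D : Set (Sp d)} {l : Sp d} (hl : l ∈ 𝒯.dof r D) :
    l ∈ 𝒯.nodes r := by
  classical
  exact Finset.mem_of_mem_filter _ hl

/-- Basis functions of internal degrees of freedom vanish off the subdomain. -/
theorem nodalBasis_eq_zero_of_notMem (hr : 1 ≤ r) {S : Finset (Finset (Sp d))} {l x : Sp d}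
    (hl : l ∈ 𝒯.dof r (region S)) (hx : x ∉ region S) : 𝒯.nodalBasis r l x = 0 := by
  classical
  rw [Mesh.dof, Finset.mem_filter] at hl
  have hcont := Vh_continuous 𝒯 (nodalBasis_mem 𝒯 hr hl.1)
  by_contra h
  exact hx (subset_region_of_isOpen (isOpen_compl_singleton.preimage hcont)
    ((subset_tsupport _).trans hl.2) h)

theorem restr_apply_of_mem {D : Set (Sp d)} {x : Sp d} (hx : x ∈ D) (v : Sp d → ℝ) :
    restr D v x = v x := Set.indicator_of_mem hx v

theorem restr_apply_of_notMem {D : Set (Sp d)} {x : Sp d} (hx : x ∉ D) (v : Sp d → ℝ) :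
    restr D v x = 0 := Set.indicator_of_notMem hx v

theorem restr_eq_self {D : Set (Sp d)} {v : Sp d → ℝ} (h : ∀ x, x ∉ D → v x = 0) :
    restr D v = v := by
  funext x
  by_cases hx : x ∈ D
  · exact restr_apply_of_mem hx v
  · rw [restr_apply_of_notMem hx, h x hx]

theorem restr_nodalBasis (hr : 1 ≤ r) {S : Finset (Finset (Sp d))} {l : Sp d}
    (hl : l ∈ 𝒯.dof r (region S)) :
    restr (region S) (𝒯.nodalBasis r l) = 𝒯.nodalBasis r l :=
  restr_eq_self fun _ hx => nodalBasis_eq_zero_of_notMem 𝒯 hr hl hx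

/-- A function of `V^h` whose nodal values off `region S` are zero vanishes off `region S`. -/
theorem Vh_eq_zero_of_notMem_region (hr : 1 ≤ r) {S : Finset (Finset (Sp d))} (hS : S ⊆ 𝒯.elems)
    {f : Sp d → ℝ} (hf : f ∈ 𝒯.Vh r) (h : ∀ l ∈ 𝒯.nodes r, l ∉ region S → f l = 0) {x : Sp d}
    (hx : x ∉ region S) : f x = 0 := by
  rw [← interp_self 𝒯 hr hf, interp, Finset.sum_apply]
  refine Finset.sum_eq_zero fun l hl => ?_
  by_cases hlS : l ∈ region S
  · simp [nodalBasis_eq_zero_of_notMem 𝒯 hr ((mem_dof_iff 𝒯 hr hS).2 ⟨hl, hlS⟩) hx]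
  · simp [h l hl hlS]

theorem mem_V_of_nodal (hr : 1 ≤ r) {S : Finset (Finset (Sp d))} (hS : S ⊆ 𝒯.elems)
    {f : Sp d → ℝ} (hf : f ∈ 𝒯.Vh r) (h : ∀ l ∈ 𝒯.nodes r, l ∉ region S → f l = 0) :
    f ∈ 𝒯.V r (region S) := by
  have h0 := fun x (hx : x ∉ region S) => Vh_eq_zero_of_notMem_region 𝒯 hr hS hf h hx
  refine ⟨f, ⟨hf, fun x hx => h0 x ?_⟩, restr_eq_self h0⟩
  rw [(isOpen_region S).frontier_eq] at hx
  exact hx.2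

/-! ### The partition of unity operators -/

section Xi

variable {N : ℕ} {Sc : Fin N → Finset (Finset (Sp d))}

theorem Xi_eq (hr : 1 ≤ r) (i : Fin N) (v : Sp d → ℝ) :
    Xi 𝒯 r Sc i v = ∑ l ∈ 𝒯.dof r (region (Sc i)),
      ((1 / (mu 𝒯 r Sc l : ℝ)) * v l) • 𝒯.nodalBasis r l :=
  Finset.sum_congr rfl fun l hl => by rw [restr_nodalBasis 𝒯 hr hl]

theorem Xi_mem (hr : 1 ≤ r) (i : Fin N) (v : Sp d → ℝ) : Xi 𝒯 r Sc i v ∈ 𝒯.Vh r := by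
  rw [Xi_eq 𝒯 hr]
  exact Submodule.sum_mem _ fun l hl => Submodule.smul_mem _ _
    (nodalBasis_mem 𝒯 hr (mem_nodes_of_mem_dof 𝒯 hl))

theorem Xi_apply_of_mem (hr : 1 ≤ r) {i : Fin N} (hS : Sc i ⊆ 𝒯.elems) (v : Sp d → ℝ) {y : Sp d}
    (hy : y ∈ 𝒯.nodes r) (hyS : y ∈ region (Sc i)) :
    Xi 𝒯 r Sc i v y = (1 / (mu 𝒯 r Sc y : ℝ)) * v y := by
  classical
  have hyd := (mem_dof_iff 𝒯 hr hS).2 ⟨hy, hyS⟩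
  rw [Xi_eq 𝒯 hr, Finset.sum_apply, Finset.sum_eq_single y]
  · simp [nodalBasis_apply 𝒯 hr hy hy]
  · intro l hl hly
    simp [nodalBasis_apply 𝒯 hr (mem_nodes_of_mem_dof 𝒯 hl) hy, hly.symm]
  · exact fun h => absurd hyd h

theorem Xi_apply_of_notMem (hr : 1 ≤ r) (i : Fin N) (v : Sp d → ℝ) {x : Sp d}
    (hx : x ∉ region (Sc i)) : Xi 𝒯 r Sc i v x = 0 := by
  rw [Xi_eq 𝒯 hr, Finset.sum_apply]
  exact Finset.sum_eq_zero fun l hl => by simp [nodalBasis_eq_zero_of_notMem 𝒯 hr hl hx]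

theorem Xi_congr (hr : 1 ≤ r) {i : Fin N} (hS : Sc i ⊆ 𝒯.elems) {v w : Sp d → ℝ}
    (h : ∀ x ∈ region (Sc i), v x = w x) : Xi 𝒯 r Sc i v = Xi 𝒯 r Sc i w :=
  Finset.sum_congr rfl fun l hl => by rw [h l ((mem_dof_iff 𝒯 hr hS).1 hl).2]

theorem Xi_restr (hr : 1 ≤ r) {i : Fin N} (hS : Sc i ⊆ 𝒯.elems) (v : Sp d → ℝ) :
    Xi 𝒯 r Sc i (restr (region (Sc i)) v) = Xi 𝒯 r Sc i v :=
  Xi_congr 𝒯 hr hS fun _ hx => restr_apply_of_mem hx v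

theorem Xi_add (i : Fin N) (v w : Sp d → ℝ) :
    Xi 𝒯 r Sc i (v + w) = Xi 𝒯 r Sc i v + Xi 𝒯 r Sc i w := by
  simp [Xi, mul_add, add_smul, Finset.sum_add_distrib]

theorem Xi_smul (i : Fin N) (t : ℝ) (v : Sp d → ℝ) :
    Xi 𝒯 r Sc i (t • v) = t • Xi 𝒯 r Sc i v := by
  simp only [Xi, Finset.smul_sum, smul_smul]
  refine Finset.sum_congr rfl fun l _ => ?_
  congr 1
  simp only [Pi.smul_apply, smul_eq_mul]
  ring

theorem Xi_sub (i : Fin N) (v w : Sp d → ℝ) :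
    Xi 𝒯 r Sc i (v - w) = Xi 𝒯 r Sc i v - Xi 𝒯 r Sc i w := by
  rw [sub_eq_add_neg, sub_eq_add_neg, Xi_add, ← neg_one_smul ℝ w, Xi_smul, neg_one_smul]

theorem Xi_sum {ι : Type*} (s : Finset ι) (i : Fin N) (v : ι → Sp d → ℝ) :
    Xi 𝒯 r Sc i (∑ j ∈ s, v j) = ∑ j ∈ s, Xi 𝒯 r Sc i (v j) :=
  map_sum (AddMonoidHom.mk' (Xi 𝒯 r Sc i) (Xi_add 𝒯 i)) v s

theorem mu_pos (hr : 1 ≤ r) (hSc : IsCover 𝒯 Sc) {l : Sp d} (hl : l ∈ 𝒯.nodes r) :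
    1 ≤ mu 𝒯 r Sc l := by
  classical
  have h := mem_domain_of_mem_nodes 𝒯 hl
  rw [hSc.covers, Set.mem_iUnion] at h
  obtain ⟨i, hi⟩ := h
  exact Finset.card_pos.2 ⟨i, Finset.mem_filter.2
    ⟨Finset.mem_univ _, (mem_dof_iff 𝒯 hr (hSc.subset i)).2 ⟨hl, hi⟩⟩⟩

theorem card_filter_le_multiplicity {n : ℕ} (S : Fin n → Finset (Finset (Sp d)))
    {T : Finset (Sp d)} (hT : T ∈ 𝒯.elems) [DecidablePred fun i => T ∈ S i] :
    (Finset.univ.filter fun i => T ∈ S i).card ≤ multiplicity 𝒯 S := by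
  classical
  unfold multiplicity
  refine le_trans (le_of_eq ?_) (Finset.le_sup (f := fun T => (Finset.univ.filter
    fun i => T ∈ S i).card) hT)
  congr

theorem mu_le_multiplicity (hr : 1 ≤ r) (hSc : IsCover 𝒯 Sc) {l : Sp d} (hl : l ∈ 𝒯.nodes r) :
    mu 𝒯 r Sc l ≤ multiplicity 𝒯 Sc := by
  classical
  obtain ⟨T, hT, hlT⟩ := exists_mem_elems_of_mem_nodes 𝒯 hl
  refine le_trans (Finset.card_le_card fun i hi => ?_) (card_filter_le_multiplicity 𝒯 Sc hT)
  rw [Finset.mem_filter] at hi ⊢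
  exact ⟨hi.1, mem_of_mem_cell_of_mem_region 𝒯 (hSc.subset i) hT hlT
    ((mem_dof_iff 𝒯 hr (hSc.subset i)).1 hi.2).2⟩

/-- The operators `Ξ_i` form a partition of unity. -/
theorem sum_Xi (hr : 1 ≤ r) (hSc : IsCover 𝒯 Sc) {v : Sp d → ℝ} (hv : v ∈ 𝒯.Vh r) :
    ∑ i, Xi 𝒯 r Sc i v = v := by
  classical
  refine Vh_ext 𝒯 hr (Submodule.sum_mem _ fun i _ => Xi_mem 𝒯 hr i v) hv fun l hl => ?_
  have h1 : ∀ i, Xi 𝒯 r Sc i v l =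
      if l ∈ 𝒯.dof r (region (Sc i)) then (1 / (mu 𝒯 r Sc l : ℝ)) * v l else 0 := by
    intro i
    have hiff := mem_dof_iff 𝒯 hr (hSc.subset i) (l := l)
    by_cases h : l ∈ region (Sc i)
    · rw [if_pos (hiff.2 ⟨hl, h⟩), Xi_apply_of_mem 𝒯 hr (hSc.subset i) v hl h]
    · rw [if_neg fun h' => h (hiff.1 h').2, Xi_apply_of_notMem 𝒯 hr i v h]
  rw [Finset.sum_apply, Finset.sum_congr rfl fun i _ => h1 i, ← Finset.sum_filter,
    Finset.sum_const, nsmul_eq_mul]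
  have h2 : (Finset.univ.filter fun i => l ∈ 𝒯.dof r (region (Sc i))).card = mu 𝒯 r Sc l := by
    unfold mu
    congr
  have h3 : (mu 𝒯 r Sc l : ℝ) ≠ 0 := by
    have := mu_pos 𝒯 hr hSc hl
    positivity
  rw [h2]
  field_simp

theorem one_le_multiplicity {n : ℕ} {S : Fin n → Finset (Finset (Sp d))} (hS : IsCover 𝒯 S)
    (hne : 𝒯.elems.Nonempty) : 1 ≤ multiplicity 𝒯 S := by
  classical
  obtain ⟨T, hT⟩ := hne
  obtain ⟨x, hx⟩ := interior_cell_nonempty (𝒯.isSimplex hT)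
  have hxd := interior_cell_subset_region hT hx
  change x ∈ 𝒯.domain at hxd
  rw [hS.covers, Set.mem_iUnion] at hxd
  obtain ⟨i, hi⟩ := hxd
  refine le_trans (Finset.card_pos.2 ⟨i, Finset.mem_filter.2 ⟨Finset.mem_univ _, ?_⟩⟩)
    (card_filter_le_multiplicity 𝒯 S hT)
  exact mem_of_mem_cell_of_mem_region 𝒯 (hS.subset i) hT (interior_subset hx) hi

/-- Summing elementwise quantities over all subdomains counts each element at most `Λ` times. -/
theorem sum_sum_le_multiplicity {n : ℕ} {S : Fin n → Finset (Finset (Sp d))} (hS : IsCover 𝒯 S)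
    {F : Finset (Sp d) → ℝ} (hF : ∀ T ∈ 𝒯.elems, 0 ≤ F T) :
    ∑ i, ∑ T ∈ S i, F T ≤ multiplicity 𝒯 S * ∑ T ∈ 𝒯.elems, F T := by
  classical
  have h1 : ∀ i, ∑ T ∈ S i, F T = ∑ T ∈ 𝒯.elems, if T ∈ S i then F T else 0 := by
    intro i
    rw [← Finset.sum_filter, Finset.filter_mem_eq_inter, Finset.inter_eq_right.2 (hS.subset i)]
  rw [Finset.sum_congr rfl fun i _ => h1 i, Finset.sum_comm, Finset.mul_sum]
  refine Finset.sum_le_sum fun T hT => ?_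
  rw [← Finset.sum_filter, Finset.sum_const, nsmul_eq_mul]
  exact mul_le_mul_of_nonneg_right
    (by exact_mod_cast card_filter_le_multiplicity 𝒯 S hT) (hF T hT)

end Xi

end Nodal

/-! ### Estimates on a single element -/

section Element

variable {d : ℕ}

/-- `‖f‖²_{L²(T)}`. -/
def mass (T : Finset (Sp d)) (f : Sp d → ℝ) : ℝ := ∫ x in cell T, f x ^ 2

/-- `‖∇f‖²_{L²(T)}`. -/
def stiff (T : Finset (Sp d)) (f : Sp d → ℝ) : ℝ := ∫ x in cell T, ‖gradient f x‖ ^ 2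

/-- The diameter `h_T`. -/
def hT (T : Finset (Sp d)) : ℝ := Metric.diam (cell T)

theorem mass_nonneg (T : Finset (Sp d)) (f : Sp d → ℝ) : 0 ≤ mass T f :=
  integral_nonneg fun _ => sq_nonneg _

theorem stiff_nonneg (T : Finset (Sp d)) (f : Sp d → ℝ) : 0 ≤ stiff T f :=
  integral_nonneg fun _ => sq_nonneg _

theorem interior_cell_ae_eq (T : Finset (Sp d)) :
    (interior (cell T) : Set (Sp d)) =ᵐ[volume] cell T :=
  interior_ae_eq_of_null_frontier ((convex_convexHull ℝ _).addHaar_frontier volume)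

theorem gradient_eq_of_eqOn_cell {T : Finset (Sp d)} {f g : Sp d → ℝ}
    (h : ∀ x ∈ cell T, f x = g x) {x : Sp d} (hx : x ∈ interior (cell T)) :
    gradient f x = gradient g x := by
  have : f =ᶠ[nhds x] g := by
    filter_upwards [isOpen_interior.mem_nhds hx] with y hy using h y (interior_subset hy)
  rw [gradient, gradient, this.fderiv_eq]

theorem norm_gradient (f : Sp d → ℝ) (x : Sp d) : ‖gradient f x‖ = ‖fderiv ℝ f x‖ := by
  rw [gradient, LinearIsometryEquiv.norm_map]

theorem mass_eq {T : Finset (Sp d)} {f g : Sp d → ℝ} (h : ∀ x ∈ cell T, f x = g x) :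
    mass T f = ∫ x in cell T, g x ^ 2 :=
  setIntegral_congr_fun (isClosed_cell T).measurableSet fun x hx => by simp only [h x hx]

theorem stiff_eq {T : Finset (Sp d)} {f g : Sp d → ℝ} (h : ∀ x ∈ cell T, f x = g x) :
    stiff T f = ∫ x in cell T, ‖fderiv ℝ g x‖ ^ 2 := by
  rw [stiff, ← setIntegral_congr_set (interior_cell_ae_eq T),
    ← setIntegral_congr_set (interior_cell_ae_eq T)]
  refine setIntegral_congr_fun isOpen_interior.measurableSet fun x hx => ?_
  simp only [gradient_eq_of_eqOn_cell h hx, norm_gradient]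

theorem hT_pos (hd : 1 ≤ d) {T : Finset (Sp d)} (hsT : IsSimplex T) : 0 < hT T :=
  diam_cell_pos hd hsT

/-- The element estimates: an inverse estimate between `L^∞` and `L²`, its converse, the inverse
estimate for the gradient, and a bound of the oscillation by the gradient. -/
structure ElementEstimates (𝒯 : Mesh d) (r : ℕ) (C : ℝ) (T : Finset (Sp d)) (f : Sp d → ℝ) :
    Prop where
  sq_le : ∀ x ∈ cell T, hT T ^ d * f x ^ 2 ≤ C * mass T f
  mass_le : ∀ B, (∀ x ∈ cell T, |f x| ≤ B) → mass T f ≤ C * (hT T ^ d * B ^ 2)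
  stiff_le : hT T ^ 2 * stiff T f ≤ C * mass T f
  osc_le : ∀ x ∈ cell T, ∀ y ∈ cell T,
    hT T ^ d * (f x - f y) ^ 2 ≤ C * (hT T ^ 2 * stiff T f)

theorem exists_elementEstimates (d r : ℕ) (hd : 1 ≤ d) {CSR : ℝ} (hCSR : 0 < CSR) :
    ∃ C : ℝ, 0 < C ∧ ∀ (𝒯 : Mesh d), 𝒯.ShapeRegular CSR → ∀ T ∈ 𝒯.elems, ∀ f ∈ 𝒯.Vh r,
      ElementEstimates 𝒯 r C T f := by
  obtain ⟨C, hC, H⟩ := polyFun_bound_ball d r (half_pos hCSR)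
  set ω : ℝ := volume.real (Metric.ball (0 : Sp d) 1) with hω
  have hω0 : 0 ≤ ω := measureReal_nonneg
  refine ⟨C + ω + C * ω, by positivity, fun 𝒯 hSR T hTe f hf => ?_⟩
  have hsT := 𝒯.isSimplex hTe
  obtain ⟨x₀, hx₀⟩ := hSR T hTe
  obtain ⟨g, hg, hfg⟩ := Vh_exists_polyFun 𝒯 hf hTe
  have hh := hT_pos hd hsT
  have hball : Metric.closedBall x₀ (CSR / 2 * hT T) ⊆ cell T := by
    refine subset_trans (Metric.closedBall_subset_closedBall (le_of_eq ?_)) hx₀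
    rw [hT]
    ring
  have hx₀T : x₀ ∈ cell T := hball (Metric.mem_closedBall_self (by positivity))
  have hsub : cell T ⊆ Metric.closedBall x₀ (hT T) := fun x hx =>
    dist_le_diam_cell T hx hx₀T
  have hcg := polyFun_contDiff hg
  have hcg' := hcg.continuous_fderiv one_ne_zero
  have hvol : volume.real (cell T) ≤ hT T ^ d * ω := by
    refine (measureReal_mono hsub (measure_closedBall_lt_top.ne)).trans (le_of_eq ?_)
    rw [Measure.addHaar_real_closedBall _ _ hh.le, finrank_euclideanSpace_fin]
  have hfin : volume (cell T) < ⊤ := (isCompact_cell T).measure_lt_top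
  have im : ∫ x in Metric.closedBall x₀ (CSR / 2 * hT T), g x ^ 2 ≤ mass T f := by
    rw [mass_eq hfg]
    exact setIntegral_mono_set
      ((hcg.continuous.pow 2).continuousOn.integrableOn_compact (isCompact_cell T))
      (ae_of_all _ fun x => sq_nonneg _) (Filter.Eventually.of_forall hball)
  have is : ∫ x in Metric.closedBall x₀ (CSR / 2 * hT T), ‖fderiv ℝ g x‖ ^ 2 ≤ stiff T f := by
    rw [stiff_eq hfg]
    exact setIntegral_mono_set
      ((hcg'.norm.pow 2).continuousOn.integrableOn_compact (isCompact_cell T))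
      (ae_of_all _ fun x => sq_nonneg _) (Filter.Eventually.of_forall hball)
  have m0 := mass_nonneg T f
  have s0 := stiff_nonneg T f
  have hC1 : C ≤ C + ω + C * ω := by nlinarith [mul_nonneg hC.le hω0]
  have hd0 : 0 < hT T ^ d := by positivity
  refine ⟨fun x hx => ?_, fun B hB => ?_, ?_, fun x hx y hy => ?_⟩
  · rw [hfg x hx]
    refine ((H g hg x₀ _ hh x (hsub hx)).1).trans ?_
    exact mul_le_mul hC1 im (integral_nonneg fun _ => sq_nonneg _) (by positivity)
  · have h1 : ‖∫ x in cell T, f x ^ 2‖ ≤ B ^ 2 * volume.real (cell T) := by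
      refine norm_setIntegral_le_of_norm_le_const hfin fun x hx => ?_
      rw [Real.norm_eq_abs, abs_pow]
      exact pow_le_pow_left₀ (abs_nonneg _) (hB x hx) 2
    have h2 : mass T f ≤ B ^ 2 * (hT T ^ d * ω) :=
      ((le_abs_self _).trans h1).trans (by gcongr)
    have h3 : 0 ≤ hT T ^ d * B ^ 2 := by positivity
    have h4 : 0 ≤ C * ω := by positivity
    nlinarith
  · have h1 : ‖∫ x in cell T, ‖fderiv ℝ g x‖ ^ 2‖ ≤
        (C * mass T f / (hT T ^ d * hT T ^ 2)) * volume.real (cell T) := by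
      refine norm_setIntegral_le_of_norm_le_const hfin fun x hx => ?_
      rw [Real.norm_eq_abs, abs_of_nonneg (sq_nonneg _), le_div_iff₀ (by positivity)]
      have := ((H g hg x₀ _ hh x (hsub hx)).2).1
      nlinarith [mul_le_mul_of_nonneg_left im hC.le]
    rw [← stiff_eq hfg] at h1
    have h2 : stiff T f ≤ (C * mass T f / (hT T ^ d * hT T ^ 2)) * (hT T ^ d * ω) :=
      ((le_abs_self _).trans h1).trans (by gcongr)
    have h3 : (C * mass T f / (hT T ^ d * hT T ^ 2)) * (hT T ^ d * ω) =
        C * ω * mass T f / hT T ^ 2 := by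
      field_simp
    rw [h3, le_div_iff₀ (by positivity)] at h2
    nlinarith [mul_nonneg hω0 m0, mul_nonneg hC.le m0]
  · rw [hfg x hx, hfg y hy]
    refine ((H g hg x₀ _ hh x (hsub hx)).2.2 y (hsub hy)).trans ?_
    refine mul_le_mul hC1 (by gcongr) ?_ (by positivity)
    exact mul_nonneg (sq_nonneg _) (integral_nonneg fun _ => sq_nonneg _)

/-- Nodal domination implies domination in `L²`. -/
theorem exists_mass_le_of_nodal_le (d r : ℕ) (hd : 1 ≤ d) (hr : 1 ≤ r) {CSR : ℝ}
    (hCSR : 0 < CSR) : ∃ C : ℝ, 1 ≤ C ∧ ∀ (𝒯 : Mesh d), 𝒯.ShapeRegular CSR →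
      ∀ T ∈ 𝒯.elems, ∀ f ∈ 𝒯.Vh r, ∀ g ∈ 𝒯.Vh r, ∀ κ : ℝ, 0 ≤ κ →
      (∀ l ∈ 𝒯.nodes r, l ∈ cell T → |f l| ≤ κ * |g l|) → mass T f ≤ C * κ ^ 2 * mass T g := by
  obtain ⟨C, hC, H⟩ := exists_elementEstimates d r hd hCSR
  set L : ℝ := (r + 1 : ℝ) ^ (d + 1) * (r : ℝ) ^ r with hL
  refine ⟨1 + C * L ^ 2 * C, by nlinarith [mul_nonneg (mul_nonneg hC.le (sq_nonneg L)) hC.le],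
    fun 𝒯 hSR T hTe f hf g hg κ hκ h => ?_⟩
  have hsT := 𝒯.isSimplex hTe
  have hh := hT_pos hd hsT
  have hd0 : 0 < hT T ^ d := by positivity
  have Ef := H 𝒯 hSR T hTe f hf
  have Eg := H 𝒯 hSR T hTe g hg
  have mg := mass_nonneg T g
  set B : ℝ := Real.sqrt (C * mass T g / hT T ^ d) with hB
  have hB2 : B ^ 2 = C * mass T g / hT T ^ d := Real.sq_sqrt (by positivity)
  have hgB : ∀ x ∈ cell T, |g x| ≤ B := by
    intro x hx
    refine Real.le_sqrt_of_sq_le ?_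
    rw [sq_abs, le_div_iff₀ hd0, mul_comm]
    exact Eg.sq_le x hx
  have hfB : ∀ x ∈ cell T, |f x| ≤ L * (κ * B) := fun x hx =>
    Vh_abs_le 𝒯 hr hf hTe (by positivity) (fun l hl hln => by
      have hlT := lagrangeNodes_subset_cell hsT hr hl
      exact (h l hln hlT).trans (mul_le_mul_of_nonneg_left (hgB l hlT) hκ)) hx
  refine (Ef.mass_le _ hfB).trans ?_
  have : C * (hT T ^ d * (L * (κ * B)) ^ 2) = C * L ^ 2 * C * (κ ^ 2 * mass T g) := by
    rw [mul_pow L, mul_pow κ, hB2]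
    field_simp
  rw [this, mul_assoc _ (κ ^ 2)]
  exact mul_le_mul_of_nonneg_right (by linarith) (by positivity)

/-! ### A Poincaré inequality for functions vanishing at interior nodes -/

/-- Shape-regular elements with a common edge have comparable diameters. -/
theorem hT_le_of_common_edge {𝒯 : Mesh d} {CSR : ℝ} (hCSR : 0 < CSR) (hSR : 𝒯.ShapeRegular CSR)
    {T T' : Finset (Sp d)} (hTe : T ∈ 𝒯.elems) {a b : Sp d} (hab : a ≠ b)
    (ha : a ∈ T) (hb : b ∈ T) (ha' : a ∈ T') (hb' : b ∈ T') : hT T ≤ CSR⁻¹ * hT T' := by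
  obtain ⟨x₀, hx₀⟩ := hSR T hTe
  have h0 : 0 ≤ Metric.diam (cell T) := Metric.diam_nonneg
  have h1 := le_dist_of_closedBall_subset (𝒯.isSimplex hTe) (by positivity) hx₀ ha hb hab
  have h2 := dist_le_diam_cell T' (subset_cell T' ha') (subset_cell T' hb')
  rw [le_inv_mul_iff₀ hCSR, hT, hT]
  linarith

/-- Elements containing balls of radius `ρ` and contained in a ball of radius `R` are at most
`(R/ρ)^d` in number. -/
theorem card_mul_pow_le {𝒯 : Mesh d} {P : Finset (Finset (Sp d))} (hP : P ⊆ 𝒯.elems) {ρ R : ℝ}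
    (hρ : 0 ≤ ρ) (hR : 0 ≤ R) {x₀ : Sp d} (hball : ∀ T ∈ P, ∃ x, Metric.closedBall x ρ ⊆ cell T)
    (hsub : ∀ T ∈ P, cell T ⊆ Metric.closedBall x₀ R) : (P.card : ℝ) * ρ ^ d ≤ R ^ d := by
  set ω : ℝ := volume.real (Metric.ball (0 : Sp d) 1) with hω
  have hω0 : 0 < ω := by
    rw [hω, measureReal_def]
    exact ENNReal.toReal_pos (Metric.measure_ball_pos _ _ one_pos).ne' measure_ball_lt_top.ne
  have hvol : ∀ (x : Sp d) {s : ℝ}, 0 ≤ s → volume.real (Metric.closedBall x s) = s ^ d * ω := by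
    intro x s hs
    rw [Measure.addHaar_real_closedBall _ _ hs, finrank_euclideanSpace_fin]
  have hfin : ∀ T ∈ P, volume (interior (cell T)) ≠ ⊤ := fun T _ =>
    ((measure_mono interior_subset).trans_lt (isCompact_cell T).measure_lt_top).ne
  have h1 : ∑ T ∈ P, volume.real (interior (cell T)) = volume.real (⋃ T ∈ P, interior (cell T)) := by
    refine (measureReal_biUnion_finset₀ ?_ ?_ hfin).symm
    · intro T hTP T' hTP' hne
      refine Disjoint.aedisjoint (Set.disjoint_left.2 fun x hx hx' => hne ?_)
      exact eq_of_mem_interior_cell 𝒯 (hP hTP) (hP hTP') hx (interior_subset hx')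
    · exact fun T _ => isOpen_interior.measurableSet.nullMeasurableSet
  have h2 : volume.real (⋃ T ∈ P, interior (cell T)) ≤ R ^ d * ω := by
    rw [← hvol x₀ hR]
    exact measureReal_mono (Set.iUnion₂_subset fun T hTP => interior_subset.trans (hsub T hTP))
      measure_closedBall_lt_top.ne
  have h3 : ∀ T ∈ P, ρ ^ d * ω ≤ volume.real (interior (cell T)) := by
    intro T hTP
    obtain ⟨x, hx⟩ := hball T hTP
    rw [← hvol x hρ, measureReal_congr (interior_cell_ae_eq T)]
    exact measureReal_mono hx (isCompact_cell T).measure_lt_top.ne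
  have h4 := Finset.card_nsmul_le_sum P _ _ h3
  rw [nsmul_eq_mul, h1] at h4
  have h5 := h4.trans h2
  rw [← mul_assoc] at h5
  exact le_of_mul_le_mul_right h5 hω0

/-- A chain of `M` steps between elements of `S` with common edges. -/
structure IsChain (S : Finset (Finset (Sp d))) (M : ℕ) (t : ℕ → Finset (Sp d)) : Prop where
  mem : ∀ s ≤ M, t s ∈ S
  edge : ∀ s < M, ∃ a b : Sp d, a ≠ b ∧ a ∈ t s ∧ b ∈ t s ∧ a ∈ t (s + 1) ∧ b ∈ t (s + 1)

theorem IsChain.hT_le {𝒯 : Mesh d} {CSR : ℝ} (hCSR : 0 < CSR) (hSR : 𝒯.ShapeRegular CSR)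
    {S : Finset (Finset (Sp d))} (hS : S ⊆ 𝒯.elems) {M : ℕ} {t : ℕ → Finset (Sp d)}
    (ht : IsChain S M t) {s : ℕ} (hs : s ≤ M) :
    hT (t 0) ≤ max 1 CSR⁻¹ ^ s * hT (t s) ∧ hT (t s) ≤ max 1 CSR⁻¹ ^ s * hT (t 0) := by
  have h0 : ∀ T : Finset (Sp d), 0 ≤ hT T := fun T => Metric.diam_nonneg
  induction s with
  | zero => simp
  | succ s ih =>
    obtain ⟨ih1, ih2⟩ := ih (by omega)
    obtain ⟨a, b, hab, ha, hb, ha', hb'⟩ := ht.edge s (by omega)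
    have h1 := hT_le_of_common_edge hCSR hSR (hS (ht.mem s (by omega))) hab ha hb ha' hb'
    have h2 := hT_le_of_common_edge hCSR hSR (hS (ht.mem (s + 1) hs)) hab ha' hb' ha hb
    have hc : CSR⁻¹ ≤ max 1 CSR⁻¹ := le_max_right _ _
    have hc0 : 0 ≤ max 1 CSR⁻¹ := zero_le_one.trans (le_max_left _ _)
    constructor
    · calc hT (t 0) ≤ max 1 CSR⁻¹ ^ s * hT (t s) := ih1
        _ ≤ max 1 CSR⁻¹ ^ s * (max 1 CSR⁻¹ * hT (t (s + 1))) := by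
          gcongr
          exact h1.trans (mul_le_mul_of_nonneg_right hc (h0 _))
        _ = _ := by ring
    · calc hT (t (s + 1)) ≤ max 1 CSR⁻¹ * hT (t s) :=
          h2.trans (mul_le_mul_of_nonneg_right hc (h0 _))
        _ ≤ max 1 CSR⁻¹ * (max 1 CSR⁻¹ ^ s * hT (t 0)) := by gcongr
        _ = _ := by ring

/-- Increments along a chain. -/
theorem IsChain.le_sum {S : Finset (Finset (Sp d))} {M : ℕ} {t : ℕ → Finset (Sp d)}
    (ht : IsChain S M t) {D : Sp d → Sp d → ℝ} (hD : ∀ x y z, D x z ≤ D x y + D y z)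
    {B : ℕ → ℝ} (hB : ∀ s ≤ M, ∀ x ∈ cell (t s), ∀ y ∈ cell (t s), D x y ≤ B s)
    {n : ℕ} (hn : n ≤ M) {x y : Sp d} (hx : x ∈ cell (t 0)) (hy : y ∈ cell (t n)) :
    D x y ≤ ∑ s ∈ Finset.range (n + 1), B s := by
  induction n generalizing y with
  | zero => simpa using hB 0 (Nat.zero_le _) x hx y hy
  | succ n ih =>
    obtain ⟨a, b, hab, ha, hb, ha', hb'⟩ := ht.edge n (by omega)
    rw [Finset.sum_range_succ]
    exact (hD x a y).trans (add_le_add (ih (by omega) (subset_cell _ ha))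
      (hB _ hn a (subset_cell _ ha') y hy))

theorem IsChain.mass_le {𝒯 : Mesh d} (hd : 1 ≤ d) {r : ℕ} {CSR : ℝ} (hCSR : 0 < CSR)
    (hSR : 𝒯.ShapeRegular CSR) {S : Finset (Finset (Sp d))} (hS : S ⊆ 𝒯.elems) {M : ℕ}
    {t : ℕ → Finset (Sp d)} (ht : IsChain S M t) {w : Sp d → ℝ} {C : ℝ} (hC : 0 < C)
    (hE : ∀ T ∈ 𝒯.elems, ElementEstimates 𝒯 r C T w) {z : Sp d} (hz : z ∈ cell (t M))
    (hwz : w z = 0) :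
    mass (t 0) w ≤ C * ((M + 1) * (C * (max 1 CSR⁻¹ ^ M) ^ d)) *
      ∑ s ∈ Finset.range (M + 1), hT (t s) ^ 2 * stiff (t s) w := by
  set c : ℝ := max 1 CSR⁻¹ with hc
  have hc1 : 1 ≤ c := le_max_left _ _
  have hpos : ∀ s ≤ M, 0 < hT (t s) := fun s hs => hT_pos hd (𝒯.isSimplex (hS (ht.mem s hs)))
  set A : ℕ → ℝ := fun s => Real.sqrt (C * (hT (t s) ^ 2 * stiff (t s) w) / hT (t s) ^ d) with hA
  have hA2 : ∀ s ≤ M, A s ^ 2 = C * (hT (t s) ^ 2 * stiff (t s) w) / hT (t s) ^ d := by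
    intro s hs
    have := hpos s hs
    have := stiff_nonneg (t s) w
    exact Real.sq_sqrt (by positivity)
  have hosc : ∀ s ≤ M, ∀ x ∈ cell (t s), ∀ y ∈ cell (t s), |w x - w y| ≤ A s := by
    intro s hs x hx y hy
    have := hpos s hs
    refine Real.le_sqrt_of_sq_le ?_
    rw [sq_abs, le_div_iff₀ (by positivity), mul_comm]
    exact (hE _ (hS (ht.mem s hs))).osc_le x hx y hy
  set B : ℝ := ∑ s ∈ Finset.range (M + 1), A s with hBdef
  have hw : ∀ x ∈ cell (t 0), |w x| ≤ B := by
    intro x hx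
    have := ht.le_sum (D := fun x y => |w x - w y|) (fun x y z => abs_sub_le _ _ _) hosc le_rfl hx hz
    simpa [hwz] using this
  have h1 := (hE _ (hS (ht.mem 0 (Nat.zero_le _)))).mass_le B hw
  have h2 : B ^ 2 ≤ (M + 1) * ∑ s ∈ Finset.range (M + 1), A s ^ 2 := by
    have := sq_sum_le_card_mul_sum_sq (s := Finset.range (M + 1)) (f := A)
    simpa using this
  have h3 : ∀ s ∈ Finset.range (M + 1), hT (t 0) ^ d * A s ^ 2 ≤
      C * (c ^ M) ^ d * (hT (t s) ^ 2 * stiff (t s) w) := by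
    intro s hs
    have hs' : s ≤ M := Nat.lt_succ_iff.1 (Finset.mem_range.1 hs)
    have hp := hpos s hs'
    have hst := stiff_nonneg (t s) w
    rw [hA2 s hs', mul_div_assoc', div_le_iff₀ (by positivity)]
    have h4 : hT (t 0) ≤ c ^ M * hT (t s) :=
      ((ht.hT_le hCSR hSR hS hs').1).trans (by gcongr)
    have h5 : hT (t 0) ^ d ≤ (c ^ M) ^ d * hT (t s) ^ d := by
      rw [← mul_pow]
      exact pow_le_pow_left₀ (hpos 0 (Nat.zero_le _)).le h4 d
    calc hT (t 0) ^ d * (C * (hT (t s) ^ 2 * stiff (t s) w)) ≤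
        ((c ^ M) ^ d * hT (t s) ^ d) * (C * (hT (t s) ^ 2 * stiff (t s) w)) := by gcongr
      _ = _ := by ring
  have hp0 := hpos 0 (Nat.zero_le _)
  calc mass (t 0) w ≤ C * (hT (t 0) ^ d * B ^ 2) := h1
    _ ≤ C * (hT (t 0) ^ d * ((M + 1) * ∑ s ∈ Finset.range (M + 1), A s ^ 2)) := by gcongr
    _ = C * ((M + 1) * ∑ s ∈ Finset.range (M + 1), hT (t 0) ^ d * A s ^ 2) := by
      rw [← Finset.mul_sum]
      ring
    _ ≤ C * ((M + 1) * ∑ s ∈ Finset.range (M + 1),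
          C * (c ^ M) ^ d * (hT (t s) ^ 2 * stiff (t s) w)) := by
      refine mul_le_mul_of_nonneg_left ?_ hC.le
      exact mul_le_mul_of_nonneg_left (Finset.sum_le_sum h3) (by positivity)
    _ = _ := by
      rw [← Finset.mul_sum]
      ring

/-- The number of chains of `M` steps that have a given element at a given place is bounded. -/
theorem card_chain_le {𝒯 : Mesh d} (hd : 1 ≤ d) {CSR : ℝ} (hCSR : 0 < CSR)
    (hSR : 𝒯.ShapeRegular CSR) {S : Finset (Finset (Sp d))} (hS : S ⊆ 𝒯.elems) {M : ℕ}
    {t : Finset (Sp d) → ℕ → Finset (Sp d)} (ht0 : ∀ T ∈ S, t T 0 = T)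
    (ht : ∀ T ∈ S, IsChain S M (t T)) {s : ℕ} (hs : s ≤ M) {T' : Finset (Sp d)} (hT' : T' ∈ S)
    [DecidablePred fun T => t T s = T'] :
    ((S.filter fun T => t T s = T').card : ℝ) ≤
      ((M + 1) * (max 1 CSR⁻¹ ^ M) ^ 2 * (2 * max 1 CSR⁻¹ ^ M * CSR⁻¹)) ^ d := by
  set c : ℝ := max 1 CSR⁻¹ ^ M with hc
  have hc1 : 1 ≤ c := one_le_pow₀ (le_max_left _ _)
  set P := S.filter fun T => t T s = T' with hP
  have hh := hT_pos hd (𝒯.isSimplex (hS hT'))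
  have h0 : ∀ T : Finset (Sp d), 0 ≤ hT T := fun T => Metric.diam_nonneg
  obtain ⟨y, hy⟩ := interior_cell_nonempty (𝒯.isSimplex (hS hT'))
  have hy' := interior_subset hy
  have hcs : ∀ T ∈ S, ∀ n ≤ M, hT T ≤ c * hT (t T n) ∧ hT (t T n) ≤ c * hT T := by
    intro T hTS n hn
    have h1 := (ht T hTS).hT_le hCSR hSR hS hn
    rw [ht0 T hTS] at h1
    have h2 : max 1 CSR⁻¹ ^ n ≤ c := pow_le_pow_right₀ (le_max_left _ _) hn
    exact ⟨h1.1.trans (mul_le_mul_of_nonneg_right h2 (h0 _)),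
      h1.2.trans (mul_le_mul_of_nonneg_right h2 (h0 _))⟩
  have key := card_mul_pow_le (𝒯 := 𝒯) (P := P) ((Finset.filter_subset _ _).trans hS)
    (ρ := CSR * (c⁻¹ * hT T') / 2) (R := (M + 1) * c ^ 2 * hT T') (x₀ := y)
    (by positivity) (by positivity) (fun T hTP => ?_) (fun T hTP x hx => ?_)
  · have hR : ((M : ℝ) + 1) * c ^ 2 * hT T' =
        ((M + 1) * c ^ 2 * (2 * c * CSR⁻¹)) * (CSR * (c⁻¹ * hT T') / 2) := by
      field_simp
    rw [hR, mul_pow] at key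
    exact le_of_mul_le_mul_right key (by positivity)
  · obtain ⟨hTS, hTs⟩ := Finset.mem_filter.1 hTP
    obtain ⟨x, hx⟩ := hSR T (hS hTS)
    refine ⟨x, (Metric.closedBall_subset_closedBall ?_).trans hx⟩
    have h1 := (hcs T hTS s hs).2
    rw [hTs] at h1
    have h2 : c⁻¹ * hT T' ≤ hT T := by
      rw [inv_mul_le_iff₀ (by positivity)]
      exact h1
    have : CSR * (c⁻¹ * hT T') ≤ CSR * Metric.diam (cell T) := mul_le_mul_of_nonneg_left h2 hCSR.le
    linarith
  · obtain ⟨hTS, hTs⟩ := Finset.mem_filter.1 hTP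
    have h1 : hT T ≤ c * hT T' := by
      have := (hcs T hTS s hs).1
      rwa [hTs] at this
    have h2 : ∀ n ≤ M, ∀ u ∈ cell (t T n), ∀ v ∈ cell (t T n), dist u v ≤ c ^ 2 * hT T' := by
      intro n hn u hu v hv
      calc dist u v ≤ hT (t T n) := dist_le_diam_cell _ hu hv
        _ ≤ c * hT T := (hcs T hTS n hn).2
        _ ≤ c * (c * hT T') := by gcongr
        _ = _ := by ring
    have h3 := (ht T hTS).le_sum (D := dist) (fun x y z => dist_triangle x y z) h2 hs
      (x := x) (y := y) (by rwa [ht0 T hTS]) (by rwa [hTs])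
    rw [Finset.sum_const, Finset.card_range, nsmul_eq_mul] at h3
    rw [Metric.mem_closedBall]
    refine h3.trans ?_
    rw [← mul_assoc]
    gcongr
    exact_mod_cast Nat.succ_le_succ hs

/-- A Poincaré inequality on nondegenerate subdomains, for functions that vanish at the interior
nodes. -/
theorem exists_poincare (d r M : ℕ) (hd : 1 ≤ d) (hr : 1 ≤ r) {CSR : ℝ} (hCSR : 0 < CSR) :
    ∃ C : ℝ, 0 < C ∧ ∀ (𝒯 : Mesh d), 𝒯.ShapeRegular CSR →
      ∀ S : Finset (Finset (Sp d)), S ⊆ 𝒯.elems → InteriorReach 𝒯 r M S →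
      ∀ w ∈ 𝒯.Vh r, (∀ l ∈ 𝒯.nodes r, l ∈ region S → w l = 0) →
      ∑ T ∈ S, mass T w ≤ C * ∑ T ∈ S, hT T ^ 2 * stiff T w := by
  classical
  obtain ⟨C, hC, H⟩ := exists_elementEstimates d r hd hCSR
  set K : ℝ := ((M + 1) * (max 1 CSR⁻¹ ^ M) ^ 2 * (2 * max 1 CSR⁻¹ ^ M * CSR⁻¹)) ^ d with hK
  set C' : ℝ := C * ((M + 1) * (C * (max 1 CSR⁻¹ ^ M) ^ d)) with hC'
  have hm : 0 < max 1 CSR⁻¹ := zero_lt_one.trans_le (le_max_left _ _)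
  refine ⟨C' * ((M + 1) * K), by positivity, fun 𝒯 hSR S hS hreach w hw hwl => ?_⟩
  have hex : ∀ T ∈ S, ∃ t : ℕ → Finset (Sp d), t 0 = T ∧ IsChain S M t ∧
      ∃ z ∈ cell (t M), w z = 0 := by
    intro T hTS
    obtain ⟨t, h0, h1, h2, z, hz, hz'⟩ := hreach T hTS
    have hzc := lagrangeNodes_subset_cell (𝒯.isSimplex (hS (h1 M le_rfl))) hr hz
    refine ⟨t, h0, ⟨h1, h2⟩, z, hzc, ?_⟩
    by_cases hzd : z ∈ 𝒯.domain
    · exact hwl z (mem_nodes_of_mem_lagrangeNodes 𝒯 (hS (h1 M le_rfl)) hz hzd)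
        (hz'.resolve_right (not_not.2 hzd))
    · exact Vh_eq_zero 𝒯 hw hzd
  choose! t ht0 ht hz using hex
  have hF : ∀ T : Finset (Sp d), 0 ≤ hT T ^ 2 * stiff T w := fun T =>
    mul_nonneg (sq_nonneg _) (stiff_nonneg _ _)
  have h1 : ∀ T ∈ S, mass T w ≤ C' * ∑ s ∈ Finset.range (M + 1),
      hT (t T s) ^ 2 * stiff (t T s) w := by
    intro T hTS
    obtain ⟨z, hz1, hz2⟩ := hz T hTS
    have := (ht T hTS).mass_le hd hCSR hSR hS hC (fun T hT => H 𝒯 hSR T hT w hw) hz1 hz2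
    rwa [ht0 T hTS] at this
  have h2 : ∀ s ∈ Finset.range (M + 1), ∑ T ∈ S, hT (t T s) ^ 2 * stiff (t T s) w ≤
      K * ∑ T ∈ S, hT T ^ 2 * stiff T w := by
    intro s hs
    have hs' : s ≤ M := Nat.lt_succ_iff.1 (Finset.mem_range.1 hs)
    rw [← Finset.sum_fiberwise_of_maps_to (g := fun T => t T s) (t := S)
      fun T hTS => (ht T hTS).mem s hs', Finset.mul_sum]
    refine Finset.sum_le_sum fun T' hT' => ?_
    have : ∀ T ∈ S.filter (fun T => t T s = T'), hT (t T s) ^ 2 * stiff (t T s) w =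
        hT T' ^ 2 * stiff T' w := fun T hT => by rw [(Finset.mem_filter.1 hT).2]
    rw [Finset.sum_congr rfl this, Finset.sum_const, nsmul_eq_mul]
    exact mul_le_mul_of_nonneg_right (card_chain_le hd hCSR hSR hS ht0 ht hs' hT') (hF T')
  calc ∑ T ∈ S, mass T w ≤ ∑ T ∈ S, C' * ∑ s ∈ Finset.range (M + 1),
        hT (t T s) ^ 2 * stiff (t T s) w := Finset.sum_le_sum h1
    _ = C' * ∑ s ∈ Finset.range (M + 1), ∑ T ∈ S, hT (t T s) ^ 2 * stiff (t T s) w := by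
      rw [← Finset.mul_sum, Finset.sum_comm]
    _ ≤ C' * ∑ s ∈ Finset.range (M + 1), K * ∑ T ∈ S, hT T ^ 2 * stiff T w := by
      gcongr with s hs
      exact h2 s hs
    _ = _ := by
      rw [Finset.sum_const, Finset.card_range, nsmul_eq_mul]
      push_cast
      ring

end Element

/-! ### Symmetric bilinear forms on a subspace -/

/-- `f` restricts to a symmetric bilinear form on `W`. -/
structure SymmBilin {E : Type*} [AddCommGroup E] [Module ℝ E] (W : Submodule ℝ E)
    (f : E → E → ℝ) : Prop where
  add_left : ∀ u ∈ W, ∀ u' ∈ W, ∀ v ∈ W, f (u + u') v = f u v + f u' v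
  smul_left : ∀ (t : ℝ), ∀ u ∈ W, ∀ v ∈ W, f (t • u) v = t * f u v
  symm : ∀ u ∈ W, ∀ v ∈ W, f u v = f v u

namespace SymmBilin

variable {E : Type*} [AddCommGroup E] [Module ℝ E] {W : Submodule ℝ E} {f g : E → E → ℝ}

theorem add_right (hf : SymmBilin W f) {u v v' : E} (hu : u ∈ W) (hv : v ∈ W) (hv' : v' ∈ W) :
    f u (v + v') = f u v + f u v' := by
  rw [hf.symm u hu _ (W.add_mem hv hv'), hf.add_left v hv v' hv' u hu, hf.symm v hv u hu,
    hf.symm v' hv' u hu]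

theorem smul_right (hf : SymmBilin W f) (t : ℝ) {u v : E} (hu : u ∈ W) (hv : v ∈ W) :
    f u (t • v) = t * f u v := by
  rw [hf.symm u hu _ (W.smul_mem t hv), hf.smul_left t v hv u hu, hf.symm v hv u hu]

theorem zero_left (hf : SymmBilin W f) {v : E} (hv : v ∈ W) : f 0 v = 0 := by
  have := hf.smul_left 0 0 W.zero_mem v hv
  simpa using this

theorem sum_left (hf : SymmBilin W f) {ι : Type*} (s : Finset ι) {g : ι → E}
    (hg : ∀ i ∈ s, g i ∈ W) {v : E} (hv : v ∈ W) :
    f (∑ i ∈ s, g i) v = ∑ i ∈ s, f (g i) v := by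
  classical
  induction s using Finset.induction_on with
  | empty => simpa using hf.zero_left hv
  | insert a s ha ih =>
    have hg' : ∀ i ∈ s, g i ∈ W := fun i hi => hg i (Finset.mem_insert_of_mem hi)
    rw [Finset.sum_insert ha, Finset.sum_insert ha,
      hf.add_left _ (hg a (Finset.mem_insert_self _ _)) _ (W.sum_mem hg') v hv, ih hg']

theorem sum_right (hf : SymmBilin W f) {ι : Type*} (s : Finset ι) {g : ι → E}
    (hg : ∀ i ∈ s, g i ∈ W) {u : E} (hu : u ∈ W) :
    f u (∑ i ∈ s, g i) = ∑ i ∈ s, f u (g i) := by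
  rw [hf.symm u hu _ (W.sum_mem hg), hf.sum_left s hg hu]
  exact Finset.sum_congr rfl fun i hi => hf.symm _ (hg i hi) u hu

theorem apply_add (hf : SymmBilin W f) {u v : E} (hu : u ∈ W) (hv : v ∈ W) :
    f (u + v) (u + v) = f u u + 2 * f u v + f v v := by
  rw [hf.add_left u hu v hv _ (W.add_mem hu hv), hf.add_right hu hu hv, hf.add_right hv hu hv,
    hf.symm v hv u hu]
  ring

theorem apply_sub (hf : SymmBilin W f) {u v : E} (hu : u ∈ W) (hv : v ∈ W) :
    f (u - v) (u - v) = f u u - 2 * f u v + f v v := by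
  have h := hf.apply_add hu (W.smul_mem (-1) hv)
  rw [hf.smul_right (-1) hu hv, hf.smul_left (-1) v hv _ (W.smul_mem (-1) hv),
    hf.smul_right (-1) hv hv, neg_one_smul, ← sub_eq_add_neg] at h
  linarith

theorem two_mul_le (hf : SymmBilin W f) (hpos : ∀ u ∈ W, 0 ≤ f u u) {u v : E} (hu : u ∈ W)
    (hv : v ∈ W) : 2 * f u v ≤ f u u + f v v := by
  have := hpos _ (W.sub_mem hu hv)
  rw [hf.apply_sub hu hv] at this
  linarith

theorem apply_add_le (hf : SymmBilin W f) (hpos : ∀ u ∈ W, 0 ≤ f u u) {u v : E} (hu : u ∈ W)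
    (hv : v ∈ W) : f (u + v) (u + v) ≤ 2 * f u u + 2 * f v v := by
  rw [hf.apply_add hu hv]
  linarith [hf.two_mul_le hpos hu hv]

theorem apply_sub_le (hf : SymmBilin W f) (hpos : ∀ u ∈ W, 0 ≤ f u u) {u v : E} (hu : u ∈ W)
    (hv : v ∈ W) : f (u - v) (u - v) ≤ 2 * f u u + 2 * f v v := by
  have h := hpos _ (W.add_mem hu hv)
  rw [hf.apply_add hu hv] at h
  rw [hf.apply_sub hu hv]
  linarith

theorem sum_le_card_mul (hf : SymmBilin W f) (hpos : ∀ u ∈ W, 0 ≤ f u u) {ι : Type*}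
    (s : Finset ι) {g : ι → E} (hg : ∀ i ∈ s, g i ∈ W) :
    f (∑ i ∈ s, g i) (∑ i ∈ s, g i) ≤ s.card * ∑ i ∈ s, f (g i) (g i) := by
  rw [hf.sum_left s hg (W.sum_mem hg)]
  have h1 : ∀ i ∈ s, f (g i) (∑ j ∈ s, g j) ≤ ∑ j ∈ s, (f (g i) (g i) + f (g j) (g j)) / 2 := by
    intro i hi
    rw [hf.sum_right s hg (hg i hi)]
    refine Finset.sum_le_sum fun j hj => ?_
    linarith [hf.two_mul_le hpos (hg i hi) (hg j hj)]
  refine (Finset.sum_le_sum h1).trans (le_of_eq ?_)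
  simp only [← Finset.sum_div, Finset.sum_add_distrib, Finset.sum_const, nsmul_eq_mul,
    ← Finset.mul_sum]
  ring

theorem add (hf : SymmBilin W f) (hg : SymmBilin W g) : SymmBilin W fun u v => f u v + g u v where
  add_left u hu u' hu' v hv := by
    rw [hf.add_left u hu u' hu' v hv, hg.add_left u hu u' hu' v hv]
    ring
  smul_left t u hu v hv := by
    rw [hf.smul_left t u hu v hv, hg.smul_left t u hu v hv]
    ring
  symm u hu v hv := by rw [hf.symm u hu v hv, hg.symm u hu v hv]

theorem const_mul (hf : SymmBilin W f) (c : ℝ) : SymmBilin W fun u v => c * f u v where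
  add_left u hu u' hu' v hv := by
    rw [hf.add_left u hu u' hu' v hv]
    ring
  smul_left t u hu v hv := by
    rw [hf.smul_left t u hu v hv]
    ring
  symm u hu v hv := by rw [hf.symm u hu v hv]

theorem sub (hf : SymmBilin W f) (hg : SymmBilin W g) : SymmBilin W fun u v => f u v - g u v := by
  simpa [sub_eq_add_neg] using hf.add (hg.const_mul (-1))

end SymmBilin

/-! ### Spectral estimates -/

section Spectral

variable {d : ℕ} {W : Submodule ℝ (Sp d → ℝ)} {b c : (Sp d → ℝ) → (Sp d → ℝ) → ℝ} {q : ℕ}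
  {p : ℕ → Sp d → ℝ} {lam : ℕ → ℝ}

/-- Up to an element of `ker c`, each element of `W` is the sum of its spectral components. -/
theorem IsEigenSystem.sub_mem_kerForm [FiniteDimensional ℝ W]
    (h : IsEigenSystem W b c q p lam) (hc : SymmBilin W c) {v : Sp d → ℝ} (hv : v ∈ W) :
    v - ∑ j ∈ Finset.Icc 1 q, c v (p j) • p j ∈ kerForm W c := by
  classical
  have hpm : ∀ j ∈ Finset.Icc 1 q, p j ∈ W := fun j hj => h.mem j (Finset.mem_Icc.1 hj)
  let K : Submodule ℝ (Sp d → ℝ) :=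
    { carrier := kerForm W c
      zero_mem' := ⟨W.zero_mem, fun w hw => hc.zero_left hw⟩
      add_mem' := fun {u u'} hu hu' => ⟨W.add_mem hu.1 hu'.1, fun w hw => by
        rw [hc.add_left u hu.1 u' hu'.1 w hw, hu.2 w hw, hu'.2 w hw, add_zero]⟩
      smul_mem' := fun t u hu => ⟨W.smul_mem t hu.1, fun w hw => by
        rw [hc.smul_left t u hu.1 w hw, hu.2 w hw, mul_zero]⟩ }
  have hKW : K ≤ W := fun u hu => hu.1
  have hpF : ∀ j : Fin q, p (j + 1) ∈ W := fun j => h.mem _ ⟨by omega, by omega⟩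
  let φ : W →ₗ[ℝ] (Fin q → ℝ) :=
    { toFun := fun u j => c u (p (j + 1))
      map_add' := fun u u' => funext fun j => hc.add_left u u.2 u' u'.2 _ (hpF j)
      map_smul' := fun t u => funext fun j => hc.smul_left t u u.2 _ (hpF j) }
  have hsurj : Function.Surjective φ := by
    intro a
    refine ⟨⟨∑ j : Fin q, a j • p (j + 1), W.sum_mem fun j _ => W.smul_mem _ (hpF j)⟩, ?_⟩
    funext i
    change c (∑ j : Fin q, a j • p (j + 1)) (p (i + 1)) = a i
    rw [hc.sum_left _ (fun j _ => W.smul_mem _ (hpF j)) (hpF i), Finset.sum_eq_single i]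
    · rw [hc.smul_left _ _ (hpF i) _ (hpF i), h.orthonormal _ ⟨by omega, by omega⟩ _
        ⟨by omega, by omega⟩, if_pos rfl, mul_one]
    · intro j _ hji
      rw [hc.smul_left _ _ (hpF j) _ (hpF i), h.orthonormal _ ⟨by omega, by omega⟩ _
        ⟨by omega, by omega⟩, if_neg (by simpa [Fin.ext_iff] using hji), mul_zero]
    · simp
  have hle : K.comap W.subtype ≤ LinearMap.ker φ := by
    intro u hu
    rw [LinearMap.mem_ker]
    funext j
    exact hu.2 _ (hpF j)
  have heq : K.comap W.subtype = LinearMap.ker φ := by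
    refine Submodule.eq_of_le_of_finrank_eq hle ?_
    have h1 := φ.finrank_range_add_finrank_ker
    rw [LinearMap.range_eq_top.2 hsurj, finrank_top, Module.finrank_fin_fun] at h1
    have h2 := h.count
    have h3 : Set.finrank ℝ (kerForm W c) = Module.finrank ℝ K := by
      rw [Set.finrank, show kerForm W c = (K : Set (Sp d → ℝ)) from rfl, Submodule.span_eq]
    have h4 : Module.finrank ℝ (K.comap W.subtype) = Module.finrank ℝ K :=
      (Submodule.comapSubtypeEquivOfLe hKW).finrank_eq
    omega
  have hw : v - ∑ j ∈ Finset.Icc 1 q, c v (p j) • p j ∈ W :=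
    W.sub_mem hv (W.sum_mem fun j hj => W.smul_mem _ (hpm j hj))
  have hmem : (⟨_, hw⟩ : W) ∈ LinearMap.ker φ := by
    rw [LinearMap.mem_ker]
    funext i
    change c (v - ∑ j ∈ Finset.Icc 1 q, c v (p j) • p j) (p (i + 1)) = 0
    have hi : (i : ℕ) + 1 ∈ Finset.Icc 1 q := Finset.mem_Icc.2 ⟨by omega, by omega⟩
    have hs : ∀ j ∈ Finset.Icc 1 q, c v (p j) • p j ∈ W := fun j hj => W.smul_mem _ (hpm j hj)
    rw [sub_eq_add_neg, ← neg_one_smul ℝ (∑ j ∈ _, _), hc.add_left v hv _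
      (W.smul_mem _ (W.sum_mem hs)) _ (hpF i), hc.smul_left _ _ (W.sum_mem hs) _ (hpF i),
      hc.sum_left _ hs (hpF i), Finset.sum_eq_single (i + 1 : ℕ)]
    · rw [hc.smul_left _ _ (hpF i) _ (hpF i), h.orthonormal _ ⟨by omega, by omega⟩ _
        ⟨by omega, by omega⟩, if_pos rfl]
      ring
    · intro j hj hji
      rw [hc.smul_left _ _ (hpm j hj) _ (hpF i), h.orthonormal _ (Finset.mem_Icc.1 hj) _
        ⟨by omega, by omega⟩, if_neg hji, mul_zero]
    · exact fun h' => absurd hi h'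
  rw [← heq] at hmem
  exact hmem

/-- The form `b` is at least `λ_{m+1} c` on the complement of the first `m` eigenfunctions, and its
values there exceed `b(v,v)` by at most `-b(u,u)`, where `u` is the part of `v` in the span of the
eigenfunctions to negative eigenvalues. -/
theorem IsEigenSystem.spectral_estimate [FiniteDimensional ℝ W]
    (h : IsEigenSystem W b c q p lam) (hb : SymmBilin W b) (hc : SymmBilin W c)
    (hcpos : ∀ u ∈ W, 0 ≤ c u u) (hker : ∀ u ∈ kerForm W c, 0 ≤ b u u) {m : ℕ} (hm : m + 1 ≤ q)
    {v : Sp d → ℝ} (hv : v ∈ W) :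
    eigProj c p m v ∈ W ∧
    lam (m + 1) * c (v - eigProj c p m v) (v - eigProj c p m v) ≤
      b (v - eigProj c p m v) (v - eigProj c p m v) ∧
    ∃ u ∈ W, b u u = b u v ∧ b u u ≤ 0 ∧ c u u ≤ c v v ∧
      b (v - eigProj c p m v) (v - eigProj c p m v) ≤ b v v - b u u := by
  classical
  have hpm : ∀ j ∈ Finset.Icc 1 q, p j ∈ W := fun j hj => h.mem j (Finset.mem_Icc.1 hj)
  set a : ℕ → ℝ := fun j => c v (p j) with ha
  have hsW : ∀ J ⊆ Finset.Icc 1 q, ∀ j ∈ J, a j • p j ∈ W := fun J hJ j hj =>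
    W.smul_mem _ (hpm j (hJ hj))
  have huW : ∀ J ⊆ Finset.Icc 1 q, ∑ j ∈ J, a j • p j ∈ W := fun J hJ => W.sum_mem (hsW J hJ)
  have hcp : ∀ J ⊆ Finset.Icc 1 q, ∀ i ∈ J, c (p i) (∑ j ∈ J, a j • p j) = a i := by
    intro J hJ i hi
    rw [hc.sum_right J (hsW J hJ) (hpm i (hJ hi)), Finset.sum_eq_single i]
    · rw [hc.smul_right _ (hpm i (hJ hi)) (hpm i (hJ hi)),
        h.orthonormal i (Finset.mem_Icc.1 (hJ hi)) i (Finset.mem_Icc.1 (hJ hi)), if_pos rfl, mul_one]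
    · intro j hj hji
      rw [hc.smul_right _ (hpm i (hJ hi)) (hpm j (hJ hj)),
        h.orthonormal i (Finset.mem_Icc.1 (hJ hi)) j (Finset.mem_Icc.1 (hJ hj)),
        if_neg hji.symm, mul_zero]
    · exact fun h' => absurd hi h'
  have hcv : ∀ J ⊆ Finset.Icc 1 q, c (∑ j ∈ J, a j • p j) v = ∑ j ∈ J, a j ^ 2 := by
    intro J hJ
    rw [hc.sum_left J (hsW J hJ) hv]
    refine Finset.sum_congr rfl fun j hj => ?_
    rw [hc.smul_left _ _ (hpm j (hJ hj)) v hv, hc.symm _ (hpm j (hJ hj)) v hv]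
    ring
  have hcu : ∀ J ⊆ Finset.Icc 1 q, c (∑ j ∈ J, a j • p j) (∑ j ∈ J, a j • p j) =
      ∑ j ∈ J, a j ^ 2 := by
    intro J hJ
    rw [hc.sum_left J (hsW J hJ) (huW J hJ)]
    refine Finset.sum_congr rfl fun j hj => ?_
    rw [hc.smul_left _ _ (hpm j (hJ hj)) _ (huW J hJ), hcp J hJ j hj]
    ring
  have hbv : ∀ J ⊆ Finset.Icc 1 q, b (∑ j ∈ J, a j • p j) v = ∑ j ∈ J, lam j * a j ^ 2 := by
    intro J hJ
    rw [hb.sum_left J (hsW J hJ) hv]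
    refine Finset.sum_congr rfl fun j hj => ?_
    rw [hb.smul_left _ _ (hpm j (hJ hj)) v hv, h.eigen j (Finset.mem_Icc.1 (hJ hj)) v hv,
      hc.symm _ (hpm j (hJ hj)) v hv]
    ring
  have hbu : ∀ J ⊆ Finset.Icc 1 q, b (∑ j ∈ J, a j • p j) (∑ j ∈ J, a j • p j) =
      ∑ j ∈ J, lam j * a j ^ 2 := by
    intro J hJ
    rw [hb.sum_left J (hsW J hJ) (huW J hJ)]
    refine Finset.sum_congr rfl fun j hj => ?_
    rw [hb.smul_left _ _ (hpm j (hJ hj)) _ (huW J hJ),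
      h.eigen j (Finset.mem_Icc.1 (hJ hj)) _ (huW J hJ), hcp J hJ j hj]
    ring
  have hcw : ∀ J ⊆ Finset.Icc 1 q, c (v - ∑ j ∈ J, a j • p j) (v - ∑ j ∈ J, a j • p j) =
      c v v - ∑ j ∈ J, a j ^ 2 := by
    intro J hJ
    rw [hc.apply_sub hv (huW J hJ), hc.symm v hv _ (huW J hJ), hcv J hJ, hcu J hJ]
    ring
  have hbw : ∀ J ⊆ Finset.Icc 1 q, b (v - ∑ j ∈ J, a j • p j) (v - ∑ j ∈ J, a j • p j) =
      b v v - ∑ j ∈ J, lam j * a j ^ 2 := by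
    intro J hJ
    rw [hb.apply_sub hv (huW J hJ), hb.symm v hv _ (huW J hJ), hbv J hJ, hbu J hJ]
    ring
  have hsub : Finset.Icc 1 m ⊆ Finset.Icc 1 q := Finset.Icc_subset_Icc_right (by omega)
  have hproj : eigProj c p m v = ∑ j ∈ Finset.Icc 1 m, a j • p j := rfl
  have hk := h.sub_mem_kerForm hc hv
  have hk1 : c v v - ∑ j ∈ Finset.Icc 1 q, a j ^ 2 = 0 :=
    (hcw _ subset_rfl).symm.trans (hk.2 _ hk.1)
  have hk2 : 0 ≤ b v v - ∑ j ∈ Finset.Icc 1 q, lam j * a j ^ 2 := by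
    rw [← hbw _ subset_rfl]
    exact hker _ hk
  rw [hproj, hcw _ hsub, hbw _ hsub]
  refine ⟨huW _ hsub, ?_, ?_⟩
  · have e1 := Finset.sum_sdiff (f := fun j => a j ^ 2) hsub
    have e2 := Finset.sum_sdiff (f := fun j => lam j * a j ^ 2) hsub
    have e3 : lam (m + 1) * ∑ j ∈ Finset.Icc 1 q \ Finset.Icc 1 m, a j ^ 2 ≤
        ∑ j ∈ Finset.Icc 1 q \ Finset.Icc 1 m, lam j * a j ^ 2 := by
      rw [Finset.mul_sum]
      refine Finset.sum_le_sum fun j hj => mul_le_mul_of_nonneg_right ?_ (sq_nonneg _)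
      simp only [Finset.mem_sdiff, Finset.mem_Icc, not_and, not_le] at hj
      exact h.mono ⟨by omega, hm⟩ ⟨hj.1.1, hj.1.2⟩ (hj.2 hj.1.1)
    have e4 : c v v - ∑ j ∈ Finset.Icc 1 m, a j ^ 2 =
        ∑ j ∈ Finset.Icc 1 q \ Finset.Icc 1 m, a j ^ 2 := by linarith
    rw [e4]
    linarith
  · set J := (Finset.Icc 1 m).filter fun j => lam j < 0 with hJ
    have hJm : J ⊆ Finset.Icc 1 m := Finset.filter_subset _ _
    have hJq := hJm.trans hsub
    refine ⟨∑ j ∈ J, a j • p j, huW J hJq, (hbu J hJq).trans (hbv J hJq).symm, ?_, ?_, ?_⟩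
    · rw [hbu J hJq]
      exact Finset.sum_nonpos fun j hj =>
        mul_nonpos_of_nonpos_of_nonneg (Finset.mem_filter.1 hj).2.le (sq_nonneg _)
    · rw [hcu J hJq]
      have := hcpos _ (W.sub_mem hv (huW J hJq))
      rw [hcw J hJq] at this
      linarith
    · rw [hbu J hJq]
      have e2 := Finset.sum_sdiff (f := fun j => lam j * a j ^ 2) hJm
      have e3 : 0 ≤ ∑ j ∈ Finset.Icc 1 m \ J, lam j * a j ^ 2 := by
        refine Finset.sum_nonneg fun j hj => mul_nonneg ?_ (sq_nonneg _)
        rw [Finset.mem_sdiff, hJ, Finset.mem_filter] at hj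
        exact not_lt.1 fun h' => hj.2 ⟨hj.1, h'⟩
      linarith

end Spectral

/-! ### The bilinear forms on elements and subdomains -/

section Forms

variable {d : ℕ}

theorem ae_cell_of_interior {T : Finset (Sp d)} {P : Sp d → Prop}
    (h : ∀ x ∈ interior (cell T), P x) : ∀ᵐ x ∂(volume.restrict (cell T)), P x := by
  rw [← Measure.restrict_congr_set (interior_cell_ae_eq T)]
  exact (ae_restrict_iff' isOpen_interior.measurableSet).2 (ae_of_all _ h)

theorem ae_cell_of_ae_domain {𝒯 : Mesh d} {T : Finset (Sp d)} (hT : T ∈ 𝒯.elems) {P : Sp d → Prop}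
    (h : ∀ᵐ x ∂(volume.restrict 𝒯.domain), P x) : ∀ᵐ x ∂(volume.restrict (cell T)), P x := by
  rw [← Measure.restrict_congr_set (interior_cell_ae_eq T)]
  exact ae_restrict_of_ae_restrict_of_subset (interior_cell_subset_region hT) h

theorem region_ae_eq (S : Finset (Finset (Sp d))) :
    (region S : Set (Sp d)) =ᵐ[volume] (⋃ T ∈ S, interior (cell T) : Set (Sp d)) := by
  have h1 : (⋃ T ∈ S, interior (cell T) : Set (Sp d)) =ᵐ[volume] (⋃ T ∈ S, cell T : Set (Sp d)) :=
    Filter.EventuallyEq.countable_bUnion S.countable_toSet fun T _ => interior_cell_ae_eq T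
  have h2 : (⋃ T ∈ S, interior (cell T) : Set (Sp d)) ⊆ region S :=
    Set.iUnion₂_subset fun T hT => interior_cell_subset_region hT
  refine Filter.EventuallyLE.antisymm ?_ (Filter.Eventually.of_forall h2)
  exact Filter.EventuallyLE.trans (Filter.Eventually.of_forall (interior_subset :
    region S ⊆ ⋃ T ∈ S, cell T)) h1.symm.le

/-- Integrals over a subdomain are sums of integrals over its elements. -/
theorem setIntegral_region {𝒯 : Mesh d} {S : Finset (Finset (Sp d))} (hS : S ⊆ 𝒯.elems)
    {F : Sp d → ℝ} (hF : ∀ T ∈ S, IntegrableOn F (cell T)) :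
    ∫ x in region S, F x = ∑ T ∈ S, ∫ x in cell T, F x := by
  rw [setIntegral_congr_set (region_ae_eq S), integral_biUnion_finset S
    (fun T _ => isOpen_interior.measurableSet) ?_ fun T hT => (hF T hT).mono_set interior_subset]
  · exact Finset.sum_congr rfl fun T _ => setIntegral_congr_set (interior_cell_ae_eq T)
  · intro T hTS T' hTS' hne
    refine Set.disjoint_left.2 fun x hx hx' => hne ?_
    exact eq_of_mem_interior_cell 𝒯 (hS hTS) (hS hTS') hx (interior_subset hx')

theorem inner_toEuclideanLin_symm {A : Matrix (Fin d) (Fin d) ℝ} (hA : A.IsSymm) (ξ η : Sp d) :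
    inner ℝ (Matrix.toEuclideanLin A ξ) η = inner ℝ (Matrix.toEuclideanLin A η) ξ := by
  have h : (Matrix.toEuclideanLin A).IsSymmetric := by
    rw [Matrix.isSymmetric_toEuclideanLin_iff, Matrix.IsHermitian,
      Matrix.conjTranspose_eq_transpose_of_trivial]
    exact hA
  rw [h ξ η, real_inner_comm]

theorem abs_inner_toEuclideanLin_le {A : Matrix (Fin d) (Fin d) ℝ} (hA : A.IsSymm) {amax : ℝ}
    (hb : ∀ ξ : Sp d, ‖ξ‖ ^ 2 ≤ inner ℝ (Matrix.toEuclideanLin A ξ) ξ ∧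
      inner ℝ (Matrix.toEuclideanLin A ξ) ξ ≤ amax * ‖ξ‖ ^ 2) (ξ η : Sp d) :
    |inner ℝ (Matrix.toEuclideanLin A ξ) η| ≤ amax * (‖ξ‖ ^ 2 + ‖η‖ ^ 2) := by
  have h1 := (sq_nonneg _).trans (hb (ξ + η)).1
  have h2 := (sq_nonneg _).trans (hb (ξ - η)).1
  rw [map_add, inner_add_left, inner_add_right, inner_add_right,
    inner_toEuclideanLin_symm hA η ξ] at h1
  rw [map_sub, inner_sub_left, inner_sub_right, inner_sub_right,
    inner_toEuclideanLin_symm hA η ξ] at h2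
  have h3 := (hb ξ).2
  have h4 := (hb η).2
  have h5 := (sq_nonneg _).trans (hb ξ).1
  have h6 := (sq_nonneg _).trans (hb η).1
  rw [abs_le]
  constructor <;> linarith

theorem measurable_inner_toEuclideanLin {A : Sp d → Matrix (Fin d) (Fin d) ℝ}
    (hA : ∀ i j, Measurable fun x => A x i j) {G H : Sp d → Sp d} (hG : Continuous G)
    (hH : Continuous H) : Measurable fun x =>
      (inner ℝ (Matrix.toEuclideanLin (A x) (G x)) (H x) : ℝ) := by
  have h : ∀ x, (inner ℝ (Matrix.toEuclideanLin (A x) (G x)) (H x) : ℝ) =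
      ∑ i, (∑ j, A x i j * G x j) * H x i := by
    intro x
    rw [PiLp.inner_apply]
    refine Finset.sum_congr rfl fun i _ => ?_
    rw [Matrix.toLpLin_apply]
    simp [Matrix.mulVec, dotProduct, mul_comm]
  simp only [h]
  refine Finset.measurable_sum _ fun i _ => Measurable.mul
    (Finset.measurable_sum _ fun j _ => (hA i j).mul ?_) ?_
  · exact Continuous.measurable (by fun_prop)
  · exact Continuous.measurable (by fun_prop)

theorem continuous_gradient {g : Sp d → ℝ} (hg : ContDiff ℝ 1 g) : Continuous (gradient g) := by
  unfold gradient
  exact (LinearIsometryEquiv.continuous _).comp (hg.continuous_fderiv one_ne_zero)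

variable {𝒯 : Mesh d} {r : ℕ} {A : Sp d → Matrix (Fin d) (Fin d) ℝ} {n : Sp d → ℝ}
  {amax nmin : ℝ}

theorem Vh_differentiableAt {u : Sp d → ℝ} (hu : u ∈ 𝒯.Vh r) {T : Finset (Sp d)}
    (hT : T ∈ 𝒯.elems) {x : Sp d} (hx : x ∈ interior (cell T)) : DifferentiableAt ℝ u x := by
  obtain ⟨g, hg, hug⟩ := Vh_exists_polyFun 𝒯 hu hT
  have : u =ᶠ[nhds x] g := by
    filter_upwards [isOpen_interior.mem_nhds hx] with y hy using hug y (interior_subset hy)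
  exact this.differentiableAt_iff.2 ((polyFun_contDiff hg).differentiable one_ne_zero x)

theorem integrableOn_sq_gradient {u : Sp d → ℝ} (hu : u ∈ 𝒯.Vh r) {T : Finset (Sp d)}
    (hT : T ∈ 𝒯.elems) : IntegrableOn (fun x => ‖gradient u x‖ ^ 2) (cell T) := by
  obtain ⟨g, hg, hug⟩ := Vh_exists_polyFun 𝒯 hu hT
  have h1 : IntegrableOn (fun x => ‖gradient g x‖ ^ 2) (cell T) :=
    ((continuous_gradient (polyFun_contDiff hg)).norm.pow 2).continuousOn.integrableOn_compact
      (isCompact_cell T)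
  exact h1.congr (ae_cell_of_interior fun x hx => by
    simp only [gradient_eq_of_eqOn_cell hug hx])

theorem integrableOn_aForm (hA : AdmissibleCoeffs 𝒯.domain A n amax nmin) {u v : Sp d → ℝ}
    (hu : u ∈ 𝒯.Vh r) (hv : v ∈ 𝒯.Vh r) {T : Finset (Sp d)} (hT : T ∈ 𝒯.elems) :
    IntegrableOn (fun x =>
      (inner ℝ (Matrix.toEuclideanLin (A x) (gradient u x)) (gradient v x) : ℝ)) (cell T) := by
  obtain ⟨g, hg, hug⟩ := Vh_exists_polyFun 𝒯 hu hT
  obtain ⟨g', hg', hvg⟩ := Vh_exists_polyFun 𝒯 hv hT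
  have hm := measurable_inner_toEuclideanLin hA.measurable_A
    (continuous_gradient (polyFun_contDiff hg)) (continuous_gradient (polyFun_contDiff hg'))
  have hae : (fun x => (inner ℝ (Matrix.toEuclideanLin (A x) (gradient g x)) (gradient g' x) : ℝ))
      =ᵐ[volume.restrict (cell T)] fun x =>
        (inner ℝ (Matrix.toEuclideanLin (A x) (gradient u x)) (gradient v x) : ℝ) :=
    ae_cell_of_interior fun x hx => by
      simp only [gradient_eq_of_eqOn_cell hug hx, gradient_eq_of_eqOn_cell hvg hx]
  have hint : IntegrableOn (fun x => amax * (‖gradient u x‖ ^ 2 + ‖gradient v x‖ ^ 2)) (cell T) :=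
    ((integrableOn_sq_gradient hu hT).add (integrableOn_sq_gradient hv hT)).const_mul amax
  refine Integrable.mono' hint (hm.aestronglyMeasurable.congr hae) ?_
  have hsymm : ∀ᵐ x ∂(volume.restrict (cell T)), (A x).IsSymm :=
    ae_cell_of_interior fun x hx => hA.symm x (interior_cell_subset_region hT hx)
  filter_upwards [ae_cell_of_ae_domain hT hA.bounds_A, hsymm] with x hx hsx
  exact abs_inner_toEuclideanLin_le hsx hx _ _

theorem integrableOn_nForm (hA : AdmissibleCoeffs 𝒯.domain A n amax nmin) {u v : Sp d → ℝ}
    (hu : u ∈ 𝒯.Vh r) (hv : v ∈ 𝒯.Vh r) {T : Finset (Sp d)} (hT : T ∈ 𝒯.elems) :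
    IntegrableOn (fun x => n x * u x * v x) (cell T) := by
  have hint : IntegrableOn (fun x => |u x| * |v x|) (cell T) :=
    (((Vh_continuous 𝒯 hu).abs.mul (Vh_continuous 𝒯 hv).abs)).continuousOn.integrableOn_compact
      (isCompact_cell T)
  refine Integrable.mono' hint ((hA.measurable_n.mul (Vh_continuous 𝒯 hu).measurable).mul
    (Vh_continuous 𝒯 hv).measurable).aestronglyMeasurable ?_
  filter_upwards [ae_cell_of_ae_domain hT hA.bounds_n] with x hx
  have hn0 : 0 ≤ n x := hA.nmin_pos.le.trans hx.1
  rw [Real.norm_eq_abs, abs_mul, abs_mul, abs_of_nonneg hn0]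
  exact mul_le_mul_of_nonneg_right (mul_le_of_le_one_left (abs_nonneg _) hx.2) (abs_nonneg _)

theorem gradient_add_of_mem {u v : Sp d → ℝ} (hu : u ∈ 𝒯.Vh r) (hv : v ∈ 𝒯.Vh r)
    {T : Finset (Sp d)} (hT : T ∈ 𝒯.elems) {x : Sp d} (hx : x ∈ interior (cell T)) :
    gradient (u + v) x = gradient u x + gradient v x := by
  rw [gradient, gradient, gradient, fderiv_add (Vh_differentiableAt hu hT hx)
    (Vh_differentiableAt hv hT hx), map_add]

theorem gradient_smul_of_mem {u : Sp d → ℝ} (t : ℝ) (hu : u ∈ 𝒯.Vh r)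
    {T : Finset (Sp d)} (hT : T ∈ 𝒯.elems) {x : Sp d} (hx : x ∈ interior (cell T)) :
    gradient (t • u) x = t • gradient u x := by
  rw [gradient, gradient, fderiv_const_smul (Vh_differentiableAt hu hT hx)]
  simp

theorem symmBilin_aForm_cell (hA : AdmissibleCoeffs 𝒯.domain A n amax nmin) {T : Finset (Sp d)}
    (hT : T ∈ 𝒯.elems) : SymmBilin (𝒯.Vh r) (aForm A (cell T)) where
  add_left u hu u' hu' v hv := by
    rw [aForm, aForm, aForm, ← integral_add (integrableOn_aForm hA hu hv hT)
      (integrableOn_aForm hA hu' hv hT)]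
    refine integral_congr_ae (ae_cell_of_interior fun x hx => ?_)
    simp only [gradient_add_of_mem hu hu' hT hx, map_add, inner_add_left]
  smul_left t u hu v hv := by
    rw [aForm, aForm, ← integral_const_mul]
    refine integral_congr_ae (ae_cell_of_interior fun x hx => ?_)
    simp only [gradient_smul_of_mem t hu hT hx, map_smul, real_inner_smul_left]
  symm u hu v hv := by
    refine integral_congr_ae (ae_cell_of_interior fun x hx => ?_)
    exact inner_toEuclideanLin_symm (hA.symm x (interior_cell_subset_region hT hx)) _ _

theorem symmBilin_nForm_cell (hA : AdmissibleCoeffs 𝒯.domain A n amax nmin) {T : Finset (Sp d)}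
    (hT : T ∈ 𝒯.elems) : SymmBilin (𝒯.Vh r) (nForm n (cell T)) where
  add_left u hu u' hu' v hv := by
    rw [nForm, nForm, nForm, ← integral_add (integrableOn_nForm hA hu hv hT)
      (integrableOn_nForm hA hu' hv hT)]
    refine integral_congr_ae (ae_of_all _ fun x => ?_)
    simp only [Pi.add_apply]
    ring
  smul_left t u hu v hv := by
    rw [nForm, nForm, ← integral_const_mul]
    refine integral_congr_ae (ae_of_all _ fun x => ?_)
    simp only [Pi.smul_apply, smul_eq_mul]
    ring
  symm u hu v hv := by
    refine integral_congr_ae (ae_of_all _ fun x => ?_)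
    ring

theorem stiff_le_aForm (hA : AdmissibleCoeffs 𝒯.domain A n amax nmin) {u : Sp d → ℝ}
    (hu : u ∈ 𝒯.Vh r) {T : Finset (Sp d)} (hT : T ∈ 𝒯.elems) :
    stiff T u ≤ aForm A (cell T) u u :=
  integral_mono_ae (integrableOn_sq_gradient hu hT) (integrableOn_aForm hA hu hu hT)
    (by filter_upwards [ae_cell_of_ae_domain hT hA.bounds_A] with x hx using (hx _).1)

theorem aForm_le_stiff (hA : AdmissibleCoeffs 𝒯.domain A n amax nmin) {u : Sp d → ℝ}
    (hu : u ∈ 𝒯.Vh r) {T : Finset (Sp d)} (hT : T ∈ 𝒯.elems) :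
    aForm A (cell T) u u ≤ amax * stiff T u := by
  rw [stiff, ← integral_const_mul]
  exact integral_mono_ae (integrableOn_aForm hA hu hu hT)
    ((integrableOn_sq_gradient hu hT).const_mul _)
    (by filter_upwards [ae_cell_of_ae_domain hT hA.bounds_A] with x hx using (hx _).2)

theorem integrableOn_sq {u : Sp d → ℝ} (hu : u ∈ 𝒯.Vh r) (T : Finset (Sp d)) :
    IntegrableOn (fun x => u x ^ 2) (cell T) :=
  ((Vh_continuous 𝒯 hu).pow 2).continuousOn.integrableOn_compact (isCompact_cell T)

theorem mass_le_nForm (hA : AdmissibleCoeffs 𝒯.domain A n amax nmin) {u : Sp d → ℝ}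
    (hu : u ∈ 𝒯.Vh r) {T : Finset (Sp d)} (hT : T ∈ 𝒯.elems) :
    nmin * mass T u ≤ nForm n (cell T) u u := by
  rw [mass, ← integral_const_mul]
  refine integral_mono_ae ((integrableOn_sq hu T).const_mul _) (integrableOn_nForm hA hu hu hT) ?_
  filter_upwards [ae_cell_of_ae_domain hT hA.bounds_n] with x hx
  rw [mul_assoc, ← sq]
  exact mul_le_mul_of_nonneg_right hx.1 (sq_nonneg _)

theorem nForm_le_mass (hA : AdmissibleCoeffs 𝒯.domain A n amax nmin) {u : Sp d → ℝ}
    (hu : u ∈ 𝒯.Vh r) {T : Finset (Sp d)} (hT : T ∈ 𝒯.elems) :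
    nForm n (cell T) u u ≤ mass T u := by
  refine integral_mono_ae (integrableOn_nForm hA hu hu hT) (integrableOn_sq hu T) ?_
  filter_upwards [ae_cell_of_ae_domain hT hA.bounds_n] with x hx
  rw [mul_assoc, ← sq]
  exact mul_le_of_le_one_left (sq_nonneg _) hx.2

theorem aForm_region (hA : AdmissibleCoeffs 𝒯.domain A n amax nmin) {S : Finset (Finset (Sp d))}
    (hS : S ⊆ 𝒯.elems) {u v : Sp d → ℝ} (hu : u ∈ 𝒯.Vh r) (hv : v ∈ 𝒯.Vh r) :
    aForm A (region S) u v = ∑ T ∈ S, aForm A (cell T) u v :=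
  setIntegral_region hS fun _ hT => integrableOn_aForm hA hu hv (hS hT)

theorem nForm_region (hA : AdmissibleCoeffs 𝒯.domain A n amax nmin) {S : Finset (Finset (Sp d))}
    (hS : S ⊆ 𝒯.elems) {u v : Sp d → ℝ} (hu : u ∈ 𝒯.Vh r) (hv : v ∈ 𝒯.Vh r) :
    nForm n (region S) u v = ∑ T ∈ S, nForm n (cell T) u v :=
  setIntegral_region hS fun _ hT => integrableOn_nForm hA hu hv (hS hT)

theorem gradient_restr {D : Set (Sp d)} (hD : IsOpen D) (u : Sp d → ℝ) {x : Sp d} (hx : x ∈ D) :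
    gradient (restr D u) x = gradient u x := by
  have : restr D u =ᶠ[nhds x] u := by
    filter_upwards [hD.mem_nhds hx] with y hy using restr_apply_of_mem hy u
  rw [gradient, gradient, this.fderiv_eq]

theorem aForm_restr {D : Set (Sp d)} (hD : IsOpen D) (u v : Sp d → ℝ) :
    aForm A D (restr D u) (restr D v) = aForm A D u v :=
  setIntegral_congr_fun hD.measurableSet fun x hx => by
    simp only [gradient_restr hD _ hx]

theorem nForm_restr {D : Set (Sp d)} (hD : IsOpen D) (u v : Sp d → ℝ) :
    nForm n D (restr D u) (restr D v) = nForm n D u v :=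
  setIntegral_congr_fun hD.measurableSet fun x hx => by
    simp only [restr_apply_of_mem hx]

theorem symmBilin_sum {ι E : Type*} [AddCommGroup E] [Module ℝ E] {W : Submodule ℝ E}
    {f : ι → E → E → ℝ} {g : E → E → ℝ} (s : Finset ι) (hf : ∀ i ∈ s, SymmBilin W (f i))
    (hg : ∀ u ∈ W, ∀ v ∈ W, g u v = ∑ i ∈ s, f i u v) : SymmBilin W g where
  add_left u hu u' hu' v hv := by
    rw [hg _ (W.add_mem hu hu') v hv, hg u hu v hv, hg u' hu' v hv, ← Finset.sum_add_distrib]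
    exact Finset.sum_congr rfl fun i hi => (hf i hi).add_left u hu u' hu' v hv
  smul_left t u hu v hv := by
    rw [hg _ (W.smul_mem t hu) v hv, hg u hu v hv, Finset.mul_sum]
    exact Finset.sum_congr rfl fun i hi => (hf i hi).smul_left t u hu v hv
  symm u hu v hv := by
    rw [hg u hu v hv, hg v hv u hu]
    exact Finset.sum_congr rfl fun i hi => (hf i hi).symm u hu v hv

theorem symmBilin_aForm (hA : AdmissibleCoeffs 𝒯.domain A n amax nmin)
    {S : Finset (Finset (Sp d))} (hS : S ⊆ 𝒯.elems) : SymmBilin (𝒯.Vh r) (aForm A (region S)) :=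
  symmBilin_sum S (fun _ hT => symmBilin_aForm_cell hA (hS hT))
    fun _ hu _ hv => aForm_region hA hS hu hv

theorem symmBilin_nForm (hA : AdmissibleCoeffs 𝒯.domain A n amax nmin)
    {S : Finset (Finset (Sp d))} (hS : S ⊆ 𝒯.elems) : SymmBilin (𝒯.Vh r) (nForm n (region S)) :=
  symmBilin_sum S (fun _ hT => symmBilin_nForm_cell hA (hS hT))
    fun _ hu _ hv => nForm_region hA hS hu hv

theorem symmBilin_ipk (hA : AdmissibleCoeffs 𝒯.domain A n amax nmin) (k : ℝ)
    {S : Finset (Finset (Sp d))} (hS : S ⊆ 𝒯.elems) : SymmBilin (𝒯.Vh r) (ipk A n k (region S)) :=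
  (symmBilin_aForm hA hS).add ((symmBilin_nForm hA hS).const_mul (k ^ 2))

theorem symmBilin_bForm (hA : AdmissibleCoeffs 𝒯.domain A n amax nmin) (k : ℝ)
    {S : Finset (Finset (Sp d))} (hS : S ⊆ 𝒯.elems) :
    SymmBilin (𝒯.Vh r) (bForm A n k (region S)) :=
  (symmBilin_aForm hA hS).sub ((symmBilin_nForm hA hS).const_mul (k ^ 2))

theorem symmBilin_ipk_cell (hA : AdmissibleCoeffs 𝒯.domain A n amax nmin) (k : ℝ)
    {T : Finset (Sp d)} (hT : T ∈ 𝒯.elems) : SymmBilin (𝒯.Vh r) (ipk A n k (cell T)) :=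
  (symmBilin_aForm_cell hA hT).add ((symmBilin_nForm_cell hA hT).const_mul (k ^ 2))

theorem ipk_region (hA : AdmissibleCoeffs 𝒯.domain A n amax nmin) (k : ℝ)
    {S : Finset (Finset (Sp d))} (hS : S ⊆ 𝒯.elems) {u v : Sp d → ℝ} (hu : u ∈ 𝒯.Vh r)
    (hv : v ∈ 𝒯.Vh r) : ipk A n k (region S) u v = ∑ T ∈ S, ipk A n k (cell T) u v := by
  simp only [ipk, aForm_region hA hS hu hv, nForm_region hA hS hu hv, Finset.sum_add_distrib,
    Finset.mul_sum]

theorem stiff_mass_le_ipk (hA : AdmissibleCoeffs 𝒯.domain A n amax nmin) (k : ℝ) {u : Sp d → ℝ}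
    (hu : u ∈ 𝒯.Vh r) {T : Finset (Sp d)} (hT : T ∈ 𝒯.elems) :
    stiff T u + k ^ 2 * (nmin * mass T u) ≤ ipk A n k (cell T) u u :=
  add_le_add (stiff_le_aForm hA hu hT)
    (mul_le_mul_of_nonneg_left (mass_le_nForm hA hu hT) (sq_nonneg _))

theorem ipk_le_stiff_mass (hA : AdmissibleCoeffs 𝒯.domain A n amax nmin) (k : ℝ) {u : Sp d → ℝ}
    (hu : u ∈ 𝒯.Vh r) {T : Finset (Sp d)} (hT : T ∈ 𝒯.elems) :
    ipk A n k (cell T) u u ≤ amax * stiff T u + k ^ 2 * mass T u :=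
  add_le_add (aForm_le_stiff hA hu hT)
    (mul_le_mul_of_nonneg_left (nForm_le_mass hA hu hT) (sq_nonneg _))

theorem ipk_cell_nonneg (hA : AdmissibleCoeffs 𝒯.domain A n amax nmin) (k : ℝ) {u : Sp d → ℝ}
    (hu : u ∈ 𝒯.Vh r) {T : Finset (Sp d)} (hT : T ∈ 𝒯.elems) : 0 ≤ ipk A n k (cell T) u u := by
  have h1 := stiff_mass_le_ipk hA k hu hT
  have h2 := stiff_nonneg T u
  have h3 := mass_nonneg T u
  have h4 := hA.nmin_pos
  have : 0 ≤ k ^ 2 * (nmin * mass T u) := by positivity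
  linarith

theorem ipk_region_nonneg (hA : AdmissibleCoeffs 𝒯.domain A n amax nmin) (k : ℝ)
    {S : Finset (Finset (Sp d))} (hS : S ⊆ 𝒯.elems) {u : Sp d → ℝ} (hu : u ∈ 𝒯.Vh r) :
    0 ≤ ipk A n k (region S) u u := by
  rw [ipk_region hA k hS hu hu]
  exact Finset.sum_nonneg fun T hT => ipk_cell_nonneg hA k hu (hS hT)

theorem normk_sq (hA : AdmissibleCoeffs 𝒯.domain A n amax nmin) (k : ℝ)
    {S : Finset (Finset (Sp d))} (hS : S ⊆ 𝒯.elems) {u : Sp d → ℝ} (hu : u ∈ 𝒯.Vh r) :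
    normk A n k (region S) u ^ 2 = ipk A n k (region S) u u :=
  Real.sq_sqrt (ipk_region_nonneg hA k hS hu)

end Forms

/-! ### Spectral estimates on the coarse subdomains -/

theorem SymmBilin.abs_two_mul_le {E : Type*} [AddCommGroup E] [Module ℝ E] {W : Submodule ℝ E}
    {f : E → E → ℝ} (hf : SymmBilin W f) (hpos : ∀ u ∈ W, 0 ≤ f u u) {t : ℝ} (ht : 0 < t) {u v : E}
    (hu : u ∈ W) (hv : v ∈ W) : |2 * f u v| ≤ t * f u u + t⁻¹ * f v v := by
  have htu := W.smul_mem t hu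
  have h1 := hpos _ (W.add_mem htu hv)
  have h2 := hpos _ (W.sub_mem htu hv)
  rw [hf.apply_add htu hv, hf.smul_right t htu hu, hf.smul_left t u hu u hu,
    hf.smul_left t u hu v hv] at h1
  rw [hf.apply_sub htu hv, hf.smul_right t htu hu, hf.smul_left t u hu u hu,
    hf.smul_left t u hu v hv] at h2
  have h3 : t * (t * f u u + t⁻¹ * f v v) = t * (t * f u u) + f v v := by
    field_simp
  rw [abs_le]
  constructor
  · refine le_of_mul_le_mul_left ?_ ht
    rw [mul_neg, h3]
    linarith
  · refine le_of_mul_le_mul_left ?_ ht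
    rw [h3]
    linarith

theorem SymmBilin.map {E : Type*} [AddCommGroup E] [Module ℝ E] {W : Submodule ℝ E}
    {f g : E → E → ℝ} (hg : SymmBilin W g) (L : E →ₗ[ℝ] E)
    (h : ∀ u ∈ W, ∀ v ∈ W, f (L u) (L v) = g u v) : SymmBilin (W.map L) f where
  add_left := by
    rintro _ ⟨u, hu, rfl⟩ _ ⟨u', hu', rfl⟩ _ ⟨v, hv, rfl⟩
    rw [← map_add, h _ (W.add_mem hu hu') v hv, h u hu v hv, h u' hu' v hv,
      hg.add_left u hu u' hu' v hv]
  smul_left := by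
    rintro t _ ⟨u, hu, rfl⟩ _ ⟨v, hv, rfl⟩
    rw [← map_smul, h _ (W.smul_mem t hu) v hv, h u hu v hv, hg.smul_left t u hu v hv]
  symm := by
    rintro _ ⟨u, hu, rfl⟩ _ ⟨v, hv, rfl⟩
    rw [h u hu v hv, h v hv u hu, hg.symm u hu v hv]

section Coarse

variable {d : ℕ} {𝒯 : Mesh d} {r : ℕ}

theorem admissibleCoeffs_one (𝒯 : Mesh d) :
    AdmissibleCoeffs 𝒯.domain (fun _ => (1 : Matrix (Fin d) (Fin d) ℝ)) (fun _ => 1) 1 1 where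
  measurable_A i j := measurable_const
  measurable_n := measurable_const
  symm x _ := Matrix.isSymm_one
  one_le_amax := le_rfl
  nmin_pos := one_pos
  nmin_le_one := le_rfl
  bounds_A := ae_of_all _ fun x ξ => by
    have : Matrix.toEuclideanLin (1 : Matrix (Fin d) (Fin d) ℝ) ξ = ξ := by
      simp
    rw [this, real_inner_self_eq_norm_sq]
    simp
  bounds_n := ae_of_all _ fun x => ⟨le_rfl, le_rfl⟩

theorem stiff_eq_aForm {u : Sp d → ℝ} (hu : u ∈ 𝒯.Vh r) {T : Finset (Sp d)} (hT : T ∈ 𝒯.elems) :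
    stiff T u = aForm (fun _ => (1 : Matrix (Fin d) (Fin d) ℝ)) (cell T) u u :=
  le_antisymm (stiff_le_aForm (admissibleCoeffs_one 𝒯) hu hT)
    (by simpa using aForm_le_stiff (admissibleCoeffs_one 𝒯) hu hT)

theorem mass_eq_nForm (T : Finset (Sp d)) (u : Sp d → ℝ) :
    mass T u = nForm (fun _ => 1) (cell T) u u := by
  simp only [mass, nForm, one_mul, sq]

theorem stiff_sub_le {u v : Sp d → ℝ} (hu : u ∈ 𝒯.Vh r) (hv : v ∈ 𝒯.Vh r) {T : Finset (Sp d)}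
    (hT : T ∈ 𝒯.elems) : stiff T (u - v) ≤ 2 * stiff T u + 2 * stiff T v := by
  rw [stiff_eq_aForm hu hT, stiff_eq_aForm hv hT, stiff_eq_aForm (Submodule.sub_mem _ hu hv) hT]
  exact (symmBilin_aForm_cell (admissibleCoeffs_one 𝒯) hT).apply_sub_le
    (fun w hw => by rw [← stiff_eq_aForm hw hT]; exact stiff_nonneg T w) hu hv

theorem stiff_add_le {u v : Sp d → ℝ} (hu : u ∈ 𝒯.Vh r) (hv : v ∈ 𝒯.Vh r) {T : Finset (Sp d)}
    (hT : T ∈ 𝒯.elems) : stiff T (u + v) ≤ 2 * stiff T u + 2 * stiff T v := by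
  rw [stiff_eq_aForm hu hT, stiff_eq_aForm hv hT, stiff_eq_aForm (Submodule.add_mem _ hu hv) hT]
  exact (symmBilin_aForm_cell (admissibleCoeffs_one 𝒯) hT).apply_add_le
    (fun w hw => by rw [← stiff_eq_aForm hw hT]; exact stiff_nonneg T w) hu hv

theorem mass_add_le {u v : Sp d → ℝ} (hu : u ∈ 𝒯.Vh r) (hv : v ∈ 𝒯.Vh r) {T : Finset (Sp d)}
    (hT : T ∈ 𝒯.elems) : mass T (u + v) ≤ 2 * mass T u + 2 * mass T v := by
  simp only [mass_eq_nForm]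
  exact (symmBilin_nForm_cell (admissibleCoeffs_one 𝒯) hT).apply_add_le
    (fun w hw => by rw [← mass_eq_nForm]; exact mass_nonneg T w) hu hv

theorem hT_le_size {T : Finset (Sp d)} (hTe : T ∈ 𝒯.elems) : hT T ≤ 𝒯.size :=
  le_ciSup (f := fun T : 𝒯.elems => Metric.diam (cell (T : Finset (Sp d))))
    (Set.finite_range _).bddAbove ⟨T, hTe⟩

theorem InverseEstimate.stiff_le {k Cinv : ℝ} (h : InverseEstimate 𝒯 r k Cinv) {T : Finset (Sp d)} (hT : T ∈ 𝒯.elems) {v : Sp d → ℝ}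
    (hv : v ∈ 𝒯.Vh r) : stiff T v ≤ Cinv ^ 2 * k ^ 2 * mass T v := by
  have h1 := pow_le_pow_left₀ (Real.sqrt_nonneg _) (h T hT v hv) 2
  change Real.sqrt (stiff T v) ^ 2 ≤ (Cinv * k * Real.sqrt (mass T v)) ^ 2 at h1
  rwa [Real.sq_sqrt (stiff_nonneg T v), mul_pow, Real.sq_sqrt (mass_nonneg T v), mul_pow] at h1

variable {A : Sp d → Matrix (Fin d) (Fin d) ℝ} {n : Sp d → ℝ} {amax nmin : ℝ} {N : ℕ}
  {Sc : Fin N → Finset (Finset (Sp d))}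

theorem cForm_restr (hr : 1 ≤ r) {i : Fin N} (hS : Sc i ⊆ 𝒯.elems) (k : ℝ) (u v : Sp d → ℝ) :
    cForm 𝒯 r A n k Sc i (restr (region (Sc i)) u) (restr (region (Sc i)) v) =
      ipk A n k (region (Sc i)) (Xi 𝒯 r Sc i u) (Xi 𝒯 r Sc i v) := by
  rw [cForm, Xi_restr 𝒯 hr hS, Xi_restr 𝒯 hr hS]

theorem bForm_restr (k : ℝ) {D : Set (Sp d)} (hD : IsOpen D) (u v : Sp d → ℝ) :
    bForm A n k D (restr D u) (restr D v) = bForm A n k D u v := by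
  rw [bForm, bForm, aForm_restr hD, nForm_restr hD]

theorem symmBilin_cForm (hr : 1 ≤ r) (hA : AdmissibleCoeffs 𝒯.domain A n amax nmin) (k : ℝ)
    {i : Fin N} (hS : Sc i ⊆ 𝒯.elems) :
    SymmBilin (𝒯.VTilde r (region (Sc i))) (cForm 𝒯 r A n k Sc i) := by
  refine SymmBilin.map (W := 𝒯.Vh r)
    (g := fun u v => ipk A n k (region (Sc i)) (Xi 𝒯 r Sc i u) (Xi 𝒯 r Sc i v)) ?_ _
    fun u _ v _ => cForm_restr hr hS k u v
  have h := symmBilin_ipk (r := r) hA k hS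
  exact
    { add_left := fun u _ u' _ v _ => by
        rw [Xi_add]
        exact h.add_left _ (Xi_mem 𝒯 hr i u) _ (Xi_mem 𝒯 hr i u') _ (Xi_mem 𝒯 hr i v)
      smul_left := fun t u _ v _ => by
        rw [Xi_smul]
        exact h.smul_left t _ (Xi_mem 𝒯 hr i u) _ (Xi_mem 𝒯 hr i v)
      symm := fun u _ v _ => h.symm _ (Xi_mem 𝒯 hr i u) _ (Xi_mem 𝒯 hr i v) }

theorem symmBilin_bForm_VTilde (hA : AdmissibleCoeffs 𝒯.domain A n amax nmin) (k : ℝ)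
    {S : Finset (Finset (Sp d))} (hS : S ⊆ 𝒯.elems) :
    SymmBilin (𝒯.VTilde r (region S)) (bForm A n k (region S)) :=
  (symmBilin_bForm hA k hS).map _ fun u _ v _ => bForm_restr k (isOpen_region S) u v

/-- `‖u‖²_{L²(Ω')}` for a subdomain `Ω'` composed of the elements in `S`. -/
def massSum (S : Finset (Finset (Sp d))) (u : Sp d → ℝ) : ℝ := ∑ T ∈ S, mass T u

/-- `‖∇u‖²_{L²(Ω')}` for a subdomain `Ω'` composed of the elements in `S`. -/
def stiffSum (S : Finset (Finset (Sp d))) (u : Sp d → ℝ) : ℝ := ∑ T ∈ S, stiff T u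

theorem massSum_nonneg (S : Finset (Finset (Sp d))) (u : Sp d → ℝ) : 0 ≤ massSum S u :=
  Finset.sum_nonneg fun T _ => mass_nonneg T u

theorem stiffSum_nonneg (S : Finset (Finset (Sp d))) (u : Sp d → ℝ) : 0 ≤ stiffSum S u :=
  Finset.sum_nonneg fun T _ => stiff_nonneg T u

theorem stiffSum_le_aForm (hA : AdmissibleCoeffs 𝒯.domain A n amax nmin)
    {S : Finset (Finset (Sp d))} (hS : S ⊆ 𝒯.elems) {u : Sp d → ℝ} (hu : u ∈ 𝒯.Vh r) :
    stiffSum S u ≤ aForm A (region S) u u := by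
  rw [aForm_region hA hS hu hu]
  exact Finset.sum_le_sum fun T hT => stiff_le_aForm hA hu (hS hT)

theorem aForm_le_stiffSum (hA : AdmissibleCoeffs 𝒯.domain A n amax nmin)
    {S : Finset (Finset (Sp d))} (hS : S ⊆ 𝒯.elems) {u : Sp d → ℝ} (hu : u ∈ 𝒯.Vh r) :
    aForm A (region S) u u ≤ amax * stiffSum S u := by
  rw [aForm_region hA hS hu hu, stiffSum, Finset.mul_sum]
  exact Finset.sum_le_sum fun T hT => aForm_le_stiff hA hu (hS hT)

theorem massSum_le_nForm (hA : AdmissibleCoeffs 𝒯.domain A n amax nmin)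
    {S : Finset (Finset (Sp d))} (hS : S ⊆ 𝒯.elems) {u : Sp d → ℝ} (hu : u ∈ 𝒯.Vh r) :
    nmin * massSum S u ≤ nForm n (region S) u u := by
  rw [nForm_region hA hS hu hu, massSum, Finset.mul_sum]
  exact Finset.sum_le_sum fun T hT => mass_le_nForm hA hu (hS hT)

theorem nForm_le_massSum (hA : AdmissibleCoeffs 𝒯.domain A n amax nmin)
    {S : Finset (Finset (Sp d))} (hS : S ⊆ 𝒯.elems) {u : Sp d → ℝ} (hu : u ∈ 𝒯.Vh r) :
    nForm n (region S) u u ≤ massSum S u := by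
  rw [nForm_region hA hS hu hu]
  exact Finset.sum_le_sum fun T hT => nForm_le_mass hA hu (hS hT)

theorem abs_bForm_le (hA : AdmissibleCoeffs 𝒯.domain A n amax nmin) (k : ℝ)
    {S : Finset (Finset (Sp d))} (hS : S ⊆ 𝒯.elems) {u v : Sp d → ℝ} (hu : u ∈ 𝒯.Vh r)
    (hv : v ∈ 𝒯.Vh r) {t : ℝ} (ht : 0 < t) : |2 * bForm A n k (region S) u v| ≤
      t * ipk A n k (region S) u u + t⁻¹ * ipk A n k (region S) v v := by
  have h1 := (symmBilin_aForm (r := r) hA hS).abs_two_mul_le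
    (fun w hw => (stiffSum_nonneg S w).trans (stiffSum_le_aForm hA hS hw)) ht hu hv
  have h2 := (symmBilin_nForm (r := r) hA hS).abs_two_mul_le
    (fun w hw => (mul_nonneg hA.nmin_pos.le (massSum_nonneg S w)).trans
      (massSum_le_nForm hA hS hw)) ht hu hv
  have h3 := mul_le_mul_of_nonneg_left h2 (sq_nonneg k)
  rw [← abs_of_nonneg (sq_nonneg k), ← abs_mul, abs_of_nonneg (sq_nonneg k)] at h3
  have h4 : 2 * bForm A n k (region S) u v =
      2 * aForm A (region S) u v - k ^ 2 * (2 * nForm n (region S) u v) := by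
    rw [bForm]
    ring
  rw [h4]
  refine (abs_sub _ _).trans ((add_le_add h1 h3).trans (le_of_eq ?_))
  simp only [ipk]
  ring

/-- A function with `Ξ_i`-image of zero energy vanishes at the interior nodes. -/
theorem eq_zero_of_ipk_Xi_eq_zero (hd : 1 ≤ d) (hr : 1 ≤ r)
    (hA : AdmissibleCoeffs 𝒯.domain A n amax nmin) {k : ℝ} (hk : 0 < k) (hSc : IsCover 𝒯 Sc)
    {i : Fin N} {C : ℝ} (hE : ∀ T ∈ 𝒯.elems, ∀ f ∈ 𝒯.Vh r, ElementEstimates 𝒯 r C T f)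
    {u : Sp d → ℝ} (h : ipk A n k (region (Sc i)) (Xi 𝒯 r Sc i u) (Xi 𝒯 r Sc i u) = 0)
    {l : Sp d} (hl : l ∈ 𝒯.nodes r) (hlS : l ∈ region (Sc i)) : u l = 0 := by
  have hS := hSc.subset i
  have hX := Xi_mem 𝒯 (Sc := Sc) hr i u
  obtain ⟨T, hTS, hlT⟩ := exists_mem_cell_of_mem_region hlS
  rw [ipk_region hA k hS hX hX, Finset.sum_eq_zero_iff_of_nonneg
    fun T hT => ipk_cell_nonneg hA k hX (hS hT)] at h
  have h1 := stiff_mass_le_ipk hA k hX (hS hTS)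
  rw [h T hTS] at h1
  have h2 := stiff_nonneg T (Xi 𝒯 r Sc i u)
  have h3 := mass_nonneg T (Xi 𝒯 r Sc i u)
  have h4 : 0 < k ^ 2 * nmin := mul_pos (by positivity) hA.nmin_pos
  have h5 : mass T (Xi 𝒯 r Sc i u) = 0 := by nlinarith
  have h6 := (hE T (hS hTS) _ hX).sq_le l hlT
  rw [h5, mul_zero] at h6
  have h7 : 0 < hT T ^ d := pow_pos (hT_pos hd (𝒯.isSimplex (hS hTS))) d
  have h8 : Xi 𝒯 r Sc i u l = 0 := by
    have : Xi 𝒯 r Sc i u l ^ 2 ≤ 0 := nonpos_of_mul_nonpos_right h6 h7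
    exact pow_eq_zero_iff two_ne_zero |>.1 (le_antisymm this (sq_nonneg _))
  rw [Xi_apply_of_mem 𝒯 hr hS u hl hlS] at h8
  have h9 : (mu 𝒯 r Sc l : ℝ) ≠ 0 := by
    have := mu_pos 𝒯 hr hSc hl
    positivity
  exact (mul_eq_zero.1 h8).resolve_left (one_div_ne_zero h9)

/-- The operators `Ξ_i` are stable in `L²`. -/
theorem massSum_Xi_le (hr : 1 ≤ r) (hSc : IsCover 𝒯 Sc) {i : Fin N} {C : ℝ}
    (hN : ∀ T ∈ 𝒯.elems, ∀ f ∈ 𝒯.Vh r, ∀ g ∈ 𝒯.Vh r, ∀ κ : ℝ, 0 ≤ κ →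
      (∀ l ∈ 𝒯.nodes r, l ∈ cell T → |f l| ≤ κ * |g l|) → mass T f ≤ C * κ ^ 2 * mass T g)
    {v : Sp d → ℝ} (hv : v ∈ 𝒯.Vh r) :
    massSum (Sc i) (Xi 𝒯 r Sc i v) ≤ C * massSum (Sc i) v := by
  rw [massSum, massSum, Finset.mul_sum]
  refine Finset.sum_le_sum fun T hT => ?_
  have := hN T (hSc.subset i hT) _ (Xi_mem 𝒯 (Sc := Sc) hr i v) v hv 1 zero_le_one
    fun l hl _ => by
      by_cases hlS : l ∈ region (Sc i)
      · rw [Xi_apply_of_mem 𝒯 hr (hSc.subset i) v hl hlS, abs_mul]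
        refine mul_le_mul_of_nonneg_right ?_ (abs_nonneg _)
        have : (1 : ℝ) ≤ mu 𝒯 r Sc l := by exact_mod_cast mu_pos 𝒯 hr hSc hl
        rw [abs_of_nonneg (by positivity), div_le_one (by positivity)]
        exact this
      · rw [Xi_apply_of_notMem 𝒯 hr i v hlS, abs_zero, one_mul]
        exact abs_nonneg _
  simpa using this

/-- Functions whose gradient is bounded by `k` times their norm are controlled by their
`Ξ_i`-image. -/
theorem massSum_le_massSum_Xi (hr : 1 ≤ r) (hSc : IsCover 𝒯 Sc) {i : Fin N} {CE CN CP k : ℝ}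
    (hCE : 0 < CE) (hCP : 0 < CP)
    (hE : ∀ T ∈ 𝒯.elems, ∀ f ∈ 𝒯.Vh r, ElementEstimates 𝒯 r CE T f)
    (hN : ∀ T ∈ 𝒯.elems, ∀ f ∈ 𝒯.Vh r, ∀ g ∈ 𝒯.Vh r, ∀ κ : ℝ, 0 ≤ κ →
      (∀ l ∈ 𝒯.nodes r, l ∈ cell T → |f l| ≤ κ * |g l|) → mass T f ≤ CN * κ ^ 2 * mass T g)
    (hP : ∀ w ∈ 𝒯.Vh r, (∀ l ∈ 𝒯.nodes r, l ∈ region (Sc i) → w l = 0) →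
      ∑ T ∈ Sc i, mass T w ≤ CP * ∑ T ∈ Sc i, hT T ^ 2 * stiff T w)
    (hkh : 8 * CP * (k * 𝒯.size) ^ 2 ≤ 1) {u : Sp d → ℝ} (hu : u ∈ 𝒯.Vh r)
    (hus : stiffSum (Sc i) u ≤ k ^ 2 * massSum (Sc i) u) :
    massSum (Sc i) u ≤ 2 * ((4 * CP * CE + 2) * CN) * (multiplicity 𝒯 Sc : ℝ) ^ 2 *
      massSum (Sc i) (Xi 𝒯 r Sc i u) := by
  classical
  have hS := hSc.subset i
  set Λ : ℝ := (multiplicity 𝒯 Sc : ℝ) with hΛ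
  set g : Sp d → ℝ := interp 𝒯 r fun l => if l ∈ region (Sc i) then u l else 0 with hg
  have hgV : g ∈ 𝒯.Vh r := interp_mem 𝒯 hr _
  have hG : massSum (Sc i) g ≤ CN * Λ ^ 2 * massSum (Sc i) (Xi 𝒯 r Sc i u) := by
    rw [massSum, massSum, Finset.mul_sum]
    refine Finset.sum_le_sum fun T hT => hN T (hS hT) g hgV _ (Xi_mem 𝒯 hr i u) Λ (by positivity)
      fun l hl _ => ?_
    rw [hg, interp_apply 𝒯 hr _ hl]
    by_cases hlS : l ∈ region (Sc i)
    · rw [if_pos hlS, Xi_apply_of_mem 𝒯 hr hS u hl hlS, abs_mul]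
      have h1 : (1 : ℝ) ≤ mu 𝒯 r Sc l := by exact_mod_cast mu_pos 𝒯 hr hSc hl
      have h2 : (mu 𝒯 r Sc l : ℝ) ≤ Λ := by
        rw [hΛ]
        exact_mod_cast mu_le_multiplicity 𝒯 hr hSc hl
      rw [abs_of_nonneg (by positivity : (0 : ℝ) ≤ 1 / (mu 𝒯 r Sc l : ℝ)), ← mul_assoc]
      refine le_mul_of_one_le_left (abs_nonneg _) ?_
      rw [mul_one_div, one_le_div (by linarith)]
      exact h2
    · rw [if_neg hlS, abs_zero]
      positivity
  have hw := hP (u - g) (Submodule.sub_mem _ hu hgV) fun l hl hlS => by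
    rw [Pi.sub_apply, hg, interp_apply 𝒯 hr _ hl, if_pos hlS, sub_self]
  have h1 : ∑ T ∈ Sc i, hT T ^ 2 * stiff T (u - g) ≤
      2 * (𝒯.size ^ 2 * stiffSum (Sc i) u) + 2 * (CE * massSum (Sc i) g) := by
    rw [stiffSum, massSum, Finset.mul_sum, Finset.mul_sum, Finset.mul_sum, Finset.mul_sum,
      ← Finset.sum_add_distrib]
    refine Finset.sum_le_sum fun T hT' => ?_
    have e1 := stiff_sub_le hu hgV (hS hT')
    have e2 := (hE T (hS hT') g hgV).stiff_le
    have e3 : hT T ^ 2 ≤ 𝒯.size ^ 2 :=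
      pow_le_pow_left₀ Metric.diam_nonneg (hT_le_size (hS hT')) 2
    have e4 := mul_le_mul_of_nonneg_left e1 (sq_nonneg (hT T))
    have e5 := mul_le_mul_of_nonneg_right e3 (stiff_nonneg T u)
    linarith
  have h2 : massSum (Sc i) u ≤ 2 * massSum (Sc i) (u - g) + 2 * massSum (Sc i) g := by
    rw [massSum, massSum, massSum, Finset.mul_sum, Finset.mul_sum, ← Finset.sum_add_distrib]
    refine Finset.sum_le_sum fun T hT' => ?_
    have := mass_add_le (Submodule.sub_mem _ hu hgV) hgV (hS hT')
    rwa [sub_add_cancel] at this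
  have h3 : massSum (Sc i) (u - g) ≤
      CP * (2 * (𝒯.size ^ 2 * stiffSum (Sc i) u) + 2 * (CE * massSum (Sc i) g)) :=
    hw.trans (mul_le_mul_of_nonneg_left h1 hCP.le)
  have h4 : 𝒯.size ^ 2 * stiffSum (Sc i) u ≤ 𝒯.size ^ 2 * (k ^ 2 * massSum (Sc i) u) :=
    mul_le_mul_of_nonneg_left hus (sq_nonneg _)
  have h5 : 8 * CP * (k * 𝒯.size) ^ 2 * massSum (Sc i) u ≤ 1 * massSum (Sc i) u :=
    mul_le_mul_of_nonneg_right hkh (massSum_nonneg _ _)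
  have h6 := mul_le_mul_of_nonneg_left h4 hCP.le
  have h7 : massSum (Sc i) u ≤ 2 * ((4 * CP * CE + 2) * massSum (Sc i) g) := by nlinarith
  refine h7.trans ?_
  have h8 := mul_le_mul_of_nonneg_left hG (by positivity : 0 ≤ 2 * (4 * CP * CE + 2))
  linarith

end Coarse

section Coarse

variable {d : ℕ} {𝒯 : Mesh d} {r : ℕ} {A : Sp d → Matrix (Fin d) (Fin d) ℝ} {n : Sp d → ℝ}
  {amax nmin : ℝ} {N : ℕ} {Sc : Fin N → Finset (Finset (Sp d))}

theorem VTilde_finiteDimensional (𝒯 : Mesh d) (hr : 1 ≤ r) (D : Set (Sp d)) :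
    FiniteDimensional ℝ (𝒯.VTilde r D) :=
  haveI := Vh_finiteDimensional 𝒯 hr
  inferInstanceAs (FiniteDimensional ℝ ((𝒯.Vh r).map (restr D)))

theorem stiffSum_le_of_bForm_nonpos (hA : AdmissibleCoeffs 𝒯.domain A n amax nmin) {k : ℝ}
    {S : Finset (Finset (Sp d))} (hS : S ⊆ 𝒯.elems) {u : Sp d → ℝ} (hu : u ∈ 𝒯.Vh r)
    (h : bForm A n k (region S) u u ≤ 0) :
    stiffSum S u ≤ k ^ 2 * massSum S u ∧
      ipk A n k (region S) u u ≤ 2 * (k ^ 2 * massSum S u) := by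
  have h1 := stiffSum_le_aForm hA hS hu
  have h2 := mul_le_mul_of_nonneg_left (nForm_le_massSum hA hS hu) (sq_nonneg k)
  rw [bForm] at h
  rw [ipk]
  constructor <;> linarith

/-- Discrete functions in the kernel of `c_i` have nonnegative `b`-energy. -/
theorem bForm_nonneg_of_mem_kerForm (hd : 1 ≤ d) (hr : 1 ≤ r)
    (hA : AdmissibleCoeffs 𝒯.domain A n amax nmin) {k : ℝ} (hk : 0 < k) (hSc : IsCover 𝒯 Sc)
    {i : Fin N} {CE CP : ℝ} (hCP : 0 < CP)
    (hE : ∀ T ∈ 𝒯.elems, ∀ f ∈ 𝒯.Vh r, ElementEstimates 𝒯 r CE T f)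
    (hP : ∀ w ∈ 𝒯.Vh r, (∀ l ∈ 𝒯.nodes r, l ∈ region (Sc i) → w l = 0) →
      ∑ T ∈ Sc i, mass T w ≤ CP * ∑ T ∈ Sc i, hT T ^ 2 * stiff T w)
    (hkh : 8 * CP * (k * 𝒯.size) ^ 2 ≤ 1) {w : Sp d → ℝ}
    (hw : w ∈ kerForm (𝒯.VTilde r (region (Sc i))) (cForm 𝒯 r A n k Sc i)) :
    0 ≤ bForm A n k (region (Sc i)) w w := by
  have hS := hSc.subset i
  obtain ⟨⟨u, hu, rfl⟩, hw'⟩ := hw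
  have hu' : u ∈ 𝒯.Vh r := hu
  have h0 := hw' _ (Submodule.mem_map_of_mem hu)
  rw [cForm_restr hr hS] at h0
  have h1 := hP u hu fun l hl hlS => eq_zero_of_ipk_Xi_eq_zero hd hr hA hk hSc hE h0 hl hlS
  have h2 : ∑ T ∈ Sc i, hT T ^ 2 * stiff T u ≤ 𝒯.size ^ 2 * stiffSum (Sc i) u := by
    rw [stiffSum, Finset.mul_sum]
    exact Finset.sum_le_sum fun T hT' => mul_le_mul_of_nonneg_right
      (pow_le_pow_left₀ Metric.diam_nonneg (hT_le_size (hS hT')) 2) (stiff_nonneg T u)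
  have h3 : massSum (Sc i) u ≤ CP * (𝒯.size ^ 2 * stiffSum (Sc i) u) :=
    h1.trans (mul_le_mul_of_nonneg_left h2 hCP.le)
  have h4 := mul_le_mul_of_nonneg_left h3 (sq_nonneg k)
  have h5 := mul_le_mul_of_nonneg_right hkh (stiffSum_nonneg (Sc i) u)
  have h6 := stiffSum_le_aForm hA hS hu'
  have h7 := mul_le_mul_of_nonneg_left (nForm_le_massSum hA hS hu') (sq_nonneg k)
  have h8 := stiffSum_nonneg (Sc i) u
  rw [bForm_restr k (isOpen_region _), bForm]
  nlinarith

/-- The operators `Ξ_i` are stable in the energy norm. -/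
theorem ipk_Xi_le (hr : 1 ≤ r) (hA : AdmissibleCoeffs 𝒯.domain A n amax nmin) {k : ℝ}
    (hSc : IsCover 𝒯 Sc) {i : Fin N} {CN Cinv : ℝ} (hI : InverseEstimate 𝒯 r k Cinv)
    (hN : ∀ T ∈ 𝒯.elems, ∀ f ∈ 𝒯.Vh r, ∀ g ∈ 𝒯.Vh r, ∀ κ : ℝ, 0 ≤ κ →
      (∀ l ∈ 𝒯.nodes r, l ∈ cell T → |f l| ≤ κ * |g l|) → mass T f ≤ CN * κ ^ 2 * mass T g)
    {v : Sp d → ℝ} (hv : v ∈ 𝒯.Vh r) :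
    ipk A n k (region (Sc i)) (Xi 𝒯 r Sc i v) (Xi 𝒯 r Sc i v) ≤
      (amax * Cinv ^ 2 + 1) * (k ^ 2 * (CN * massSum (Sc i) v)) := by
  have hS := hSc.subset i
  have hX := Xi_mem 𝒯 (Sc := Sc) hr i v
  have hamax : 0 ≤ amax := zero_le_one.trans hA.one_le_amax
  have h1 := aForm_le_stiffSum hA hS hX
  have h2 := mul_le_mul_of_nonneg_left (nForm_le_massSum hA hS hX) (sq_nonneg k)
  have h3 : stiffSum (Sc i) (Xi 𝒯 r Sc i v) ≤
      Cinv ^ 2 * k ^ 2 * massSum (Sc i) (Xi 𝒯 r Sc i v) := by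
    rw [stiffSum, massSum, Finset.mul_sum]
    exact Finset.sum_le_sum fun T hT' => hI.stiff_le (hS hT') hX
  have h4 := mul_le_mul_of_nonneg_left h3 hamax
  have h5 := mul_le_mul_of_nonneg_left (massSum_Xi_le hr hSc (i := i) hN hv)
    (by positivity : 0 ≤ (amax * Cinv ^ 2 + 1) * k ^ 2)
  rw [ipk]
  linarith

/-- The local spectral estimate: the energy of `Ξ_i (v - Π_i v)` is bounded by that of `v`. -/
theorem lam_mul_cForm_le (hd : 1 ≤ d) (hr : 1 ≤ r)
    (hA : AdmissibleCoeffs 𝒯.domain A n amax nmin) {k : ℝ} (hk : 0 < k) (hSc : IsCover 𝒯 Sc)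
    {i : Fin N} {CE CN CP Cinv : ℝ} (hCE : 0 < CE) (hCN : 0 < CN) (hCP : 0 < CP)
    (hCinv : 1 ≤ Cinv) (hI : InverseEstimate 𝒯 r k Cinv)
    (hE : ∀ T ∈ 𝒯.elems, ∀ f ∈ 𝒯.Vh r, ElementEstimates 𝒯 r CE T f)
    (hN : ∀ T ∈ 𝒯.elems, ∀ f ∈ 𝒯.Vh r, ∀ g ∈ 𝒯.Vh r, ∀ κ : ℝ, 0 ≤ κ →
      (∀ l ∈ 𝒯.nodes r, l ∈ cell T → |f l| ≤ κ * |g l|) → mass T f ≤ CN * κ ^ 2 * mass T g)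
    (hP : ∀ w ∈ 𝒯.Vh r, (∀ l ∈ 𝒯.nodes r, l ∈ region (Sc i) → w l = 0) →
      ∑ T ∈ Sc i, mass T w ≤ CP * ∑ T ∈ Sc i, hT T ^ 2 * stiff T w)
    (hkh : 8 * CP * (k * 𝒯.size) ^ 2 ≤ 1) (hΛ : 1 ≤ multiplicity 𝒯 Sc)
    {q : ℕ} {p : ℕ → Sp d → ℝ} {lam : ℕ → ℝ}
    (h : IsEigenSystem (𝒯.VTilde r (region (Sc i))) (bForm A n k (region (Sc i)))
      (cForm 𝒯 r A n k Sc i) q p lam) {m : ℕ} (hm : m + 1 ≤ q) {v : Sp d → ℝ} (hv : v ∈ 𝒯.Vh r) :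
    lam (m + 1) * cForm 𝒯 r A n k Sc i
        (restr (region (Sc i)) v - eigProj (cForm 𝒯 r A n k Sc i) p m (restr (region (Sc i)) v))
        (restr (region (Sc i)) v - eigProj (cForm 𝒯 r A n k Sc i) p m (restr (region (Sc i)) v)) ≤
      (2 * ((4 * CP * CE + 2) * CN) * CN + 2) * Cstar (multiplicity 𝒯 Sc) amax nmin Cinv *
        ipk A n k (region (Sc i)) v v := by
  have hS := hSc.subset i
  have := VTilde_finiteDimensional 𝒯 hr (region (Sc i))
  have hcpos : ∀ u ∈ 𝒯.VTilde r (region (Sc i)), 0 ≤ cForm 𝒯 r A n k Sc i u u := fun u _ =>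
    ipk_region_nonneg hA k hS (Xi_mem 𝒯 hr i u)
  obtain ⟨-, h1, u', ⟨u, hu, rfl⟩, hb1, hb2, hc1, hb3⟩ := h.spectral_estimate
    (symmBilin_bForm_VTilde hA k hS) (symmBilin_cForm hr hA k hS) hcpos
    (fun u hu => bForm_nonneg_of_mem_kerForm hd hr hA hk hSc hCP hE hP hkh hu) hm
    (Submodule.mem_map_of_mem (f := restr (region (Sc i))) hv)
  have hu' : u ∈ 𝒯.Vh r := hu
  have hn0 := hA.nmin_pos
  simp only [bForm_restr k (isOpen_region (Sc i))] at hb1 hb2 hb3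
  rw [cForm_restr hr hS, cForm_restr hr hS] at hc1
  refine h1.trans (hb3.trans ?_)
  obtain ⟨hus, hui⟩ := stiffSum_le_of_bForm_nonpos hA hS hu' hb2
  have hX := massSum_le_massSum_Xi hr hSc hCE hCP hE hN hP hkh hu' hus
  set Λ : ℝ := (multiplicity 𝒯 Sc : ℝ) with hΛ'
  have hΛ1 : 1 ≤ Λ := by
    rw [hΛ']
    exact_mod_cast hΛ
  set E : ℝ := ipk A n k (region (Sc i)) v v with hEdef
  have hXi := Xi_mem 𝒯 (Sc := Sc) hr i u
  have hZ : k ^ 2 * (nmin * massSum (Sc i) (Xi 𝒯 r Sc i u)) ≤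
      ipk A n k (region (Sc i)) (Xi 𝒯 r Sc i u) (Xi 𝒯 r Sc i u) := by
    have e1 := mul_le_mul_of_nonneg_left (massSum_le_nForm hA hS hXi) (sq_nonneg k)
    have e2 := (stiffSum_nonneg _ _).trans (stiffSum_le_aForm hA hS hXi)
    rw [ipk]
    linarith
  have hvE : nmin * (k ^ 2 * massSum (Sc i) v) ≤ E := by
    have e1 := mul_le_mul_of_nonneg_left (massSum_le_nForm hA hS hv) (sq_nonneg k)
    have e2 := (stiffSum_nonneg _ _).trans (stiffSum_le_aForm hA hS hv)
    rw [hEdef, ipk]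
    linarith
  have hbv : bForm A n k (region (Sc i)) v v ≤ E := by
    have e1 := mul_nonneg (sq_nonneg k)
      ((mul_nonneg hn0.le (massSum_nonneg _ _)).trans (massSum_le_nForm hA hS hv))
    rw [hEdef, ipk, bForm]
    linarith
  have hE0 : 0 ≤ E := ipk_region_nonneg hA k hS hv
  have hvX := ipk_Xi_le hr hA hSc (i := i) hI hN hv
  have hb4 := abs_bForm_le hA k hS hu' hv (div_pos hn0 (zero_lt_one.trans_le hΛ1))
  rw [← hb1, inv_div] at hb4
  have hb5 := (neg_le_abs _).trans hb4
  set B : ℝ := amax * Cinv ^ 2 + 1 with hB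
  have hB1 : 1 ≤ B := by
    have : 0 ≤ amax := zero_le_one.trans hA.one_le_amax
    have : 0 ≤ amax * Cinv ^ 2 := by positivity
    linarith
  set K : ℝ := 2 * ((4 * CP * CE + 2) * CN) with hK
  have hK0 : 0 < K := by positivity
  -- `k² ‖u‖²` in terms of the energy of `v`
  have h2 : nmin / Λ * (k ^ 2 * massSum (Sc i) u) ≤ K * CN * (Λ / nmin * B) * E := by
    have e1 : k ^ 2 * massSum (Sc i) u ≤
        K * Λ ^ 2 * (k ^ 2 * massSum (Sc i) (Xi 𝒯 r Sc i u)) := by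
      have := mul_le_mul_of_nonneg_left hX (sq_nonneg k)
      linarith
    have e2 : k ^ 2 * massSum (Sc i) (Xi 𝒯 r Sc i u) ≤ nmin⁻¹ * (B * CN * (nmin⁻¹ * E)) := by
      rw [le_inv_mul_iff₀ hn0]
      have e3 : k ^ 2 * massSum (Sc i) v ≤ nmin⁻¹ * E := by rwa [le_inv_mul_iff₀ hn0]
      have e4 := mul_le_mul_of_nonneg_left e3 (by positivity : 0 ≤ B * CN)
      linarith
    have e5 := mul_le_mul_of_nonneg_left e2 (by positivity : 0 ≤ K * Λ ^ 2)
    have e6 := mul_le_mul_of_nonneg_left (e1.trans e5)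
      (by positivity : 0 ≤ nmin / Λ)
    refine e6.trans (le_of_eq ?_)
    field_simp
  have h3 : nmin / Λ * ipk A n k (region (Sc i)) u u ≤ 2 * (K * CN * (Λ / nmin * B) * E) := by
    have := mul_le_mul_of_nonneg_left hui (by positivity : 0 ≤ nmin / Λ)
    linarith
  have hi1 : 1 ≤ nmin⁻¹ := (one_le_inv₀ hn0).2 hA.nmin_le_one
  have hF : Λ / nmin * B ≤ Cstar (multiplicity 𝒯 Sc) amax nmin Cinv := by
    rw [Cstar, Ceig, ← hΛ', div_eq_mul_inv]
    have e1 : Λ ≤ Λ ^ 2 := le_self_pow₀ hΛ1 two_ne_zero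
    have e2 : B ≤ (amax * Cinv ^ 2 + 2) ^ 2 := by nlinarith
    have e3 : 1 ≤ Cinv ^ 2 := one_le_pow₀ hCinv
    calc Λ * nmin⁻¹ * B ≤ Λ ^ 2 * nmin⁻¹ * (amax * Cinv ^ 2 + 2) ^ 2 := by gcongr
      _ ≤ _ := le_mul_of_one_le_right (by positivity) e3
  have hF1 : Λ / nmin ≤ Λ / nmin * B := le_mul_of_one_le_right (by positivity) hB1
  have hF2 : 1 ≤ Λ / nmin := by
    rw [div_eq_mul_inv]
    exact one_le_mul_of_one_le_of_one_le hΛ1 hi1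
  have h4 := mul_le_mul_of_nonneg_right hF1 hE0
  have h5 := mul_le_mul_of_nonneg_right hF2 hE0
  have h6 := mul_le_mul_of_nonneg_right hF (by positivity : 0 ≤ (K * CN + 2) * E)
  linarith

end Coarse

/-! ### Decomposition into local functions -/

/-- The running maximum `max(0, a_0, …, a_{n-1})`. -/
def runMax (a : ℕ → ℝ) : ℕ → ℝ
  | 0 => 0
  | n + 1 => max (runMax a n) (a n)

theorem runMax_le_succ (a : ℕ → ℝ) (n : ℕ) : runMax a n ≤ runMax a (n + 1) := le_max_left _ _

theorem runMax_nonneg (a : ℕ → ℝ) (n : ℕ) : 0 ≤ runMax a n := by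
  induction n with
  | zero => exact le_rfl
  | succ n ih => exact ih.trans (runMax_le_succ a n)

theorem runMax_le_one {a : ℕ → ℝ} (ha : ∀ i, a i ≤ 1) (n : ℕ) : runMax a n ≤ 1 := by
  induction n with
  | zero => exact zero_le_one
  | succ n ih => exact max_le ih (ha n)

theorem le_runMax (a : ℕ → ℝ) {i n : ℕ} (h : i < n) : a i ≤ runMax a n := by
  induction n with
  | zero => omega
  | succ n ih =>
    rcases Nat.lt_succ_iff_lt_or_eq.1 h with h | rfl
    · exact (ih h).trans (runMax_le_succ a n)
    · exact le_max_right _ _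

theorem runMax_succ_of_eq_zero {a : ℕ → ℝ} {n : ℕ} (h : a n = 0) :
    runMax a (n + 1) = runMax a n := by
  rw [runMax, h]
  exact max_eq_left (runMax_nonneg a n)

theorem abs_runMax_sub_le {a b : ℕ → ℝ} {ε : ℝ} (hε : 0 ≤ ε) (h : ∀ i, |a i - b i| ≤ ε) (n : ℕ) :
    |runMax a n - runMax b n| ≤ ε := by
  induction n with
  | zero => simpa [runMax] using hε
  | succ n ih => exact (abs_max_sub_max_le_max _ _ _ _).trans (max_le ih (h n))

section Local

variable {d : ℕ} (𝒯 : Mesh d)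

open Classical in
/-- The cutoff function `min(1, dist(x, ∂Ω' \ ∂Ω) / δ)` of a subdomain `Ω'`, extended by zero. -/
def cutoff (S : Finset (Finset (Sp d))) (δ : ℝ) (x : Sp d) : ℝ :=
  if x ∈ region S then
    if (frontier (region S) ∩ 𝒯.domain).Nonempty then
      min 1 (Metric.infDist x (frontier (region S) ∩ 𝒯.domain) / δ)
    else 1
  else 0

theorem cutoff_of_notMem {S : Finset (Finset (Sp d))} (δ : ℝ) {x : Sp d} (hx : x ∉ region S) :
    cutoff 𝒯 S δ x = 0 := if_neg hx

theorem cutoff_le_one (S : Finset (Finset (Sp d))) (δ : ℝ) (x : Sp d) : cutoff 𝒯 S δ x ≤ 1 := by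
  unfold cutoff
  split_ifs
  exacts [min_le_left _ _, le_rfl, zero_le_one]

theorem cutoff_nonneg (S : Finset (Finset (Sp d))) {δ : ℝ} (hδ : 0 < δ) (x : Sp d) :
    0 ≤ cutoff 𝒯 S δ x := by
  unfold cutoff
  split_ifs
  exacts [le_min zero_le_one (div_nonneg Metric.infDist_nonneg hδ.le), zero_le_one, le_rfl]

theorem cutoff_eq_one {S : Finset (Finset (Sp d))} {δ : ℝ} (hδ : 0 < δ) {x : Sp d}
    (hx : x ∈ region S) (h : ∀ y ∈ frontier (region S) ∩ 𝒯.domain, δ ≤ dist x y) :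
    cutoff 𝒯 S δ x = 1 := by
  rw [cutoff, if_pos hx]
  split_ifs with hne
  · refine min_eq_left ((one_le_div hδ).2 ?_)
    exact (Metric.le_infDist hne).2 fun {y} hy => h y hy
  · rfl

theorem cutoff_sub_le {S : Finset (Finset (Sp d))} (hS : S ⊆ 𝒯.elems) {δ : ℝ} (hδ : 0 < δ)
    {T : Finset (Sp d)} (hT : T ∈ 𝒯.elems) {x y : Sp d} (hx : x ∈ cell T) (hy : y ∈ cell T)
    (hyd : y ∈ 𝒯.domain) : cutoff 𝒯 S δ x - cutoff 𝒯 S δ y ≤ dist x y / δ := by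
  have h0 : 0 ≤ dist x y / δ := div_nonneg dist_nonneg hδ.le
  by_cases hxS : x ∈ region S
  · by_cases hyS : y ∈ region S
    · rw [cutoff, cutoff, if_pos hxS, if_pos hyS]
      split_ifs with hne
      · have h1 := Metric.infDist_le_infDist_add_dist (s := frontier (region S) ∩ 𝒯.domain)
          (x := x) (y := y)
        have h2 := div_le_div_of_nonneg_right h1 hδ.le
        rw [add_div] at h2
        rw [sub_le_iff_le_add, ← min_add_add_left]
        exact min_le_min (by linarith) (by linarith)
      · rwa [sub_self]
    · have hTS := mem_of_mem_cell_of_mem_region 𝒯 hS hT hx hxS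
      have hyF : y ∈ frontier (region S) ∩ 𝒯.domain := by
        refine ⟨⟨cell_subset_closure_region (𝒯.isSimplex hT) hTS hy, ?_⟩, hyd⟩
        rwa [(isOpen_region S).interior_eq]
      rw [cutoff_of_notMem 𝒯 δ hyS, sub_zero, cutoff, if_pos hxS, if_pos ⟨y, hyF⟩]
      exact (min_le_right _ _).trans
        (div_le_div_of_nonneg_right (Metric.infDist_le_dist_of_mem hyF) hδ.le)
  · rw [cutoff_of_notMem 𝒯 δ hxS]
    linarith [cutoff_nonneg 𝒯 S hδ y]

theorem abs_cutoff_sub_le {S : Finset (Finset (Sp d))} (hS : S ⊆ 𝒯.elems) {δ : ℝ} (hδ : 0 < δ)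
    {T : Finset (Sp d)} (hT : T ∈ 𝒯.elems) {x y : Sp d} (hx : x ∈ cell T) (hy : y ∈ cell T)
    (hxd : x ∈ 𝒯.domain) (hyd : y ∈ 𝒯.domain) :
    |cutoff 𝒯 S δ x - cutoff 𝒯 S δ y| ≤ dist x y / δ := by
  refine abs_sub_le_iff.2 ⟨cutoff_sub_le 𝒯 hS hδ hT hx hy hyd, ?_⟩
  rw [dist_comm]
  exact cutoff_sub_le 𝒯 hS hδ hT hy hx hxd

/-- The values at `x` of the cutoff functions of a cover, extended by zero to all indices. -/
def cutoffSeq {Q : ℕ} (S : Fin Q → Finset (Finset (Sp d))) (δ : ℝ) (x : Sp d) (j : ℕ) : ℝ :=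
  if h : j < Q then cutoff 𝒯 (S ⟨j, h⟩) δ x else 0

theorem cutoffSeq_le_one {Q : ℕ} (S : Fin Q → Finset (Finset (Sp d))) (δ : ℝ) (x : Sp d) (j : ℕ) :
    cutoffSeq 𝒯 S δ x j ≤ 1 := by
  unfold cutoffSeq
  split_ifs
  exacts [cutoff_le_one 𝒯 _ _ _, zero_le_one]

theorem cutoffSeq_coe {Q : ℕ} (S : Fin Q → Finset (Finset (Sp d))) (δ : ℝ) (x : Sp d) (j : Fin Q) :
    cutoffSeq 𝒯 S δ x j = cutoff 𝒯 (S j) δ x := dif_pos j.2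

/-- A partition of unity subordinate to a cover with overlap `δ`. -/
def partUnity {Q : ℕ} (S : Fin Q → Finset (Finset (Sp d))) (δ : ℝ) (j : Fin Q) (x : Sp d) : ℝ :=
  runMax (cutoffSeq 𝒯 S δ x) (j + 1) - runMax (cutoffSeq 𝒯 S δ x) j

theorem partUnity_nonneg {Q : ℕ} (S : Fin Q → Finset (Finset (Sp d))) (δ : ℝ) (j : Fin Q)
    (x : Sp d) : 0 ≤ partUnity 𝒯 S δ j x :=
  sub_nonneg.2 (runMax_le_succ _ _)

theorem partUnity_le_one {Q : ℕ} (S : Fin Q → Finset (Finset (Sp d))) (δ : ℝ) (j : Fin Q)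
    (x : Sp d) : partUnity 𝒯 S δ j x ≤ 1 := by
  have h1 := runMax_le_one (cutoffSeq_le_one 𝒯 S δ x) (j + 1)
  have h2 := runMax_nonneg (cutoffSeq 𝒯 S δ x) j
  rw [partUnity]
  linarith

theorem partUnity_of_notMem {Q : ℕ} {S : Fin Q → Finset (Finset (Sp d))} (δ : ℝ) {j : Fin Q}
    {x : Sp d} (hx : x ∉ region (S j)) : partUnity 𝒯 S δ j x = 0 := by
  rw [partUnity, runMax_succ_of_eq_zero, sub_self]
  rw [cutoffSeq_coe, cutoff_of_notMem 𝒯 δ hx]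

theorem sum_partUnity {Q : ℕ} {S : Fin Q → Finset (Finset (Sp d))} {δ : ℝ} (hδ : 0 < δ)
    (hS : HasOverlap 𝒯 S δ) {x : Sp d} (hx : x ∈ 𝒯.domain) : ∑ j, partUnity 𝒯 S δ j x = 1 := by
  simp only [partUnity]
  rw [Fin.sum_univ_eq_sum_range fun j => runMax (cutoffSeq 𝒯 S δ x) (j + 1) -
    runMax (cutoffSeq 𝒯 S δ x) j, Finset.sum_range_sub]
  obtain ⟨j, hj, h⟩ := hS x hx
  have h1 := le_runMax (cutoffSeq 𝒯 S δ x) j.2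
  rw [cutoffSeq_coe, cutoff_eq_one 𝒯 hδ hj h] at h1
  have h2 := runMax_le_one (cutoffSeq_le_one 𝒯 S δ x) Q
  rw [le_antisymm h2 h1]
  exact sub_zero 1

theorem abs_partUnity_sub_le {Q : ℕ} {S : Fin Q → Finset (Finset (Sp d))}
    (hS : ∀ j, S j ⊆ 𝒯.elems) {δ : ℝ} (hδ : 0 < δ) {T : Finset (Sp d)} (hT : T ∈ 𝒯.elems)
    {x y : Sp d} (hx : x ∈ cell T) (hy : y ∈ cell T) (hxd : x ∈ 𝒯.domain) (hyd : y ∈ 𝒯.domain)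
    (j : Fin Q) : |partUnity 𝒯 S δ j x - partUnity 𝒯 S δ j y| ≤ 2 * (dist x y / δ) := by
  have h0 : 0 ≤ dist x y / δ := div_nonneg dist_nonneg hδ.le
  have h : ∀ i, |cutoffSeq 𝒯 S δ x i - cutoffSeq 𝒯 S δ y i| ≤ dist x y / δ := fun i => by
    unfold cutoffSeq
    split_ifs
    · exact abs_cutoff_sub_le 𝒯 (hS _) hδ hT hx hy hxd hyd
    · simpa using h0
  have h1 := abs_runMax_sub_le h0 h (j + 1)
  have h2 := abs_runMax_sub_le h0 h j
  rw [partUnity, partUnity, sub_sub_sub_comm]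
  refine (abs_sub _ _).trans ?_
  linarith

variable {𝒯} {r : ℕ}

theorem stiff_smul {u : Sp d → ℝ} (hu : u ∈ 𝒯.Vh r) {T : Finset (Sp d)} (hT : T ∈ 𝒯.elems)
    (c : ℝ) : stiff T (c • u) = c ^ 2 * stiff T u := by
  have h := symmBilin_aForm_cell (r := r) (admissibleCoeffs_one 𝒯) hT
  have hcu := Submodule.smul_mem (𝒯.Vh r) c hu
  rw [stiff_eq_aForm hcu hT, stiff_eq_aForm hu hT, h.smul_right c hcu hu, h.smul_left c u hu u hu]
  ring

/-- Stability of the nodal interpolation of the product with a weight. -/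
theorem interp_mul_estimates (hd : 1 ≤ d) (hr : 1 ≤ r) {CE CN : ℝ} (hCE : 0 < CE)
    (hE : ∀ T ∈ 𝒯.elems, ∀ f ∈ 𝒯.Vh r, ElementEstimates 𝒯 r CE T f)
    (hN : ∀ T ∈ 𝒯.elems, ∀ f ∈ 𝒯.Vh r, ∀ g ∈ 𝒯.Vh r, ∀ κ : ℝ, 0 ≤ κ →
      (∀ l ∈ 𝒯.nodes r, l ∈ cell T → |f l| ≤ κ * |g l|) → mass T f ≤ CN * κ ^ 2 * mass T g)
    {T : Finset (Sp d)} (hT' : T ∈ 𝒯.elems) {y : Sp d → ℝ} (hy : y ∈ 𝒯.Vh r) {χ : Sp d → ℝ}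
    (h0 : ∀ x, 0 ≤ χ x) (h1 : ∀ x, χ x ≤ 1) {L : ℝ} (hL : 0 ≤ L)
    (hχ : ∀ l ∈ 𝒯.nodes r, l ∈ cell T → ∀ l' ∈ 𝒯.nodes r, l' ∈ cell T →
      |χ l - χ l'| ≤ L * hT T) :
    mass T (interp 𝒯 r fun x => χ x * y x) ≤ CN * mass T y ∧
      stiff T (interp 𝒯 r fun x => χ x * y x) ≤
        2 * stiff T y + 2 * (CE * CN * L ^ 2) * mass T y := by
  set z := interp 𝒯 r fun x => χ x * y x with hz
  have hzV : z ∈ 𝒯.Vh r := interp_mem 𝒯 hr _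
  have hzl : ∀ l ∈ 𝒯.nodes r, z l = χ l * y l := fun l hl => interp_apply 𝒯 hr _ hl
  have hpos : 0 < hT T := hT_pos hd (𝒯.isSimplex hT')
  have hm := hN T hT' z hzV y hy 1 zero_le_one fun l hl _ => by
    rw [hzl l hl, abs_mul, abs_of_nonneg (h0 l)]
    exact mul_le_mul_of_nonneg_right (h1 l) (abs_nonneg _)
  refine ⟨by simpa using hm, ?_⟩
  -- it suffices to compare `z` with a multiple of `y`
  obtain ⟨c, hc0, hc1, hc⟩ : ∃ c : ℝ, 0 ≤ c ∧ c ≤ 1 ∧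
      ∀ l ∈ 𝒯.nodes r, l ∈ cell T → |χ l - c| ≤ L * hT T := by
    by_cases hex : ∃ l ∈ 𝒯.nodes r, l ∈ cell T
    · obtain ⟨l₀, hl₀, hl₀T⟩ := hex
      exact ⟨χ l₀, h0 l₀, h1 l₀, fun l hl hlT => hχ l hl hlT l₀ hl₀ hl₀T⟩
    · exact ⟨0, le_rfl, zero_le_one, fun l hl hlT => absurd ⟨l, hl, hlT⟩ hex⟩
  have hcy := Submodule.smul_mem (𝒯.Vh r) c hy
  have hf := Submodule.sub_mem _ hzV hcy
  have hmf := hN T hT' (z - c • y) hf y hy (L * hT T) (by positivity) fun l hl hlT => by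
    rw [Pi.sub_apply, Pi.smul_apply, hzl l hl, smul_eq_mul, ← sub_mul, abs_mul]
    exact mul_le_mul_of_nonneg_right (hc l hl hlT) (abs_nonneg _)
  have hsf : stiff T (z - c • y) ≤ CE * CN * L ^ 2 * mass T y := by
    refine le_of_mul_le_mul_left ?_ (pow_pos hpos 2)
    have := (hE T hT' _ hf).stiff_le.trans (mul_le_mul_of_nonneg_left hmf hCE.le)
    linarith
  have hs := stiff_add_le hf hcy hT'
  rw [sub_add_cancel, stiff_smul hy hT'] at hs
  have hc2 : c ^ 2 * stiff T y ≤ 1 * stiff T y :=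
    mul_le_mul_of_nonneg_right (pow_le_one₀ hc0 hc1) (stiff_nonneg T y)
  linarith

variable {A : Sp d → Matrix (Fin d) (Fin d) ℝ} {n : Sp d → ℝ} {amax nmin : ℝ}

/-- Stable decomposition of a finite element function into local functions, for a cover with
overlap at least `k⁻¹`. -/
theorem exists_local_decomposition (hd : 1 ≤ d) (hr : 1 ≤ r)
    (hA : AdmissibleCoeffs 𝒯.domain A n amax nmin) {k : ℝ} (hk : 0 < k) {CE CN : ℝ} (hCE : 0 < CE)
    (hCN : 0 < CN) (hE : ∀ T ∈ 𝒯.elems, ∀ f ∈ 𝒯.Vh r, ElementEstimates 𝒯 r CE T f)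
    (hN : ∀ T ∈ 𝒯.elems, ∀ f ∈ 𝒯.Vh r, ∀ g ∈ 𝒯.Vh r, ∀ κ : ℝ, 0 ≤ κ →
      (∀ l ∈ 𝒯.nodes r, l ∈ cell T → |f l| ≤ κ * |g l|) → mass T f ≤ CN * κ ^ 2 * mass T g)
    {Q : ℕ} {S : Fin Q → Finset (Finset (Sp d))} (hS : IsCover 𝒯 S) {δ : ℝ} (hδ : k⁻¹ ≤ δ)
    (hov : HasOverlap 𝒯 S δ) {y : Sp d → ℝ} (hy : y ∈ 𝒯.Vh r) :
    ∃ z : Fin Q → Sp d → ℝ, (∀ j, z j ∈ 𝒯.Vh r) ∧ (∀ j, z j ∈ 𝒯.V r (region (S j))) ∧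
      y = ∑ j, z j ∧ ∑ j, ipk A n k (region (S j)) (z j) (z j) ≤
        (2 + 8 * CE * CN + CN) * (amax * nmin⁻¹) *
          (multiplicity 𝒯 S * ipk A n k 𝒯.domain y y) := by
  have hδ0 : 0 < δ := (inv_pos.2 hk).trans_le hδ
  set z : Fin Q → Sp d → ℝ := fun j => interp 𝒯 r fun x => partUnity 𝒯 S δ j x * y x with hz
  have hzV : ∀ j, z j ∈ 𝒯.Vh r := fun j => interp_mem 𝒯 hr _
  have hzl : ∀ j, ∀ l ∈ 𝒯.nodes r, z j l = partUnity 𝒯 S δ j l * y l := fun j l hl =>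
    interp_apply 𝒯 hr _ hl
  refine ⟨z, hzV, fun j => mem_V_of_nodal 𝒯 hr (hS.subset j) (hzV j) fun l hl hlS => ?_, ?_, ?_⟩
  · rw [hzl j l hl, partUnity_of_notMem 𝒯 δ hlS, zero_mul]
  · refine Vh_ext 𝒯 hr hy (Submodule.sum_mem _ fun j _ => hzV j) fun l hl => ?_
    rw [Finset.sum_apply, Finset.sum_congr rfl fun j _ => hzl j l hl, ← Finset.sum_mul,
      sum_partUnity 𝒯 hδ0 hov (mem_domain_of_mem_nodes 𝒯 hl), one_mul]
  · have hcell : ∀ j, ∀ T ∈ 𝒯.elems, ipk A n k (cell T) (z j) (z j) ≤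
        (2 + 8 * CE * CN + CN) * (amax * nmin⁻¹) * ipk A n k (cell T) y y := by
      intro j T hT'
      obtain ⟨e1, e2⟩ := interp_mul_estimates hd hr hCE hE hN hT' hy (χ := partUnity 𝒯 S δ j)
        (partUnity_nonneg 𝒯 S δ j) (partUnity_le_one 𝒯 S δ j) (by positivity : 0 ≤ 2 * k)
        fun l hl hlT l' hl' hlT' => by
          have e1 := abs_partUnity_sub_le 𝒯 hS.subset hδ0 hT' hlT hlT'
            (mem_domain_of_mem_nodes 𝒯 hl) (mem_domain_of_mem_nodes 𝒯 hl') j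
          have e2 : dist l l' / δ ≤ hT T * k := by
            rw [div_eq_mul_inv]
            exact mul_le_mul (dist_le_diam_cell T hlT hlT') (inv_le_of_inv_le₀ hk hδ)
              (by positivity) Metric.diam_nonneg
          linarith
      have e3 := ipk_le_stiff_mass hA k (hzV j) hT'
      have e4 := stiff_mass_le_ipk hA k hy hT'
      have hn0 := hA.nmin_pos
      have ha1 := hA.one_le_amax
      have hs := stiff_nonneg T y
      have hm := mul_nonneg (sq_nonneg k) (mass_nonneg T y)
      set m' := k ^ 2 * mass T y with hm'
      set s' := stiff T y with hs'
      have e5 : ipk A n k (cell T) (z j) (z j) ≤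
          amax * (2 * s' + 8 * CE * CN * m') + CN * m' := by
        have f1 := mul_le_mul_of_nonneg_left e2 (zero_le_one.trans ha1)
        have f2 := mul_le_mul_of_nonneg_left e1 (sq_nonneg k)
        have f3 : amax * (2 * stiff T y + 2 * (CE * CN * (2 * k) ^ 2) * mass T y) =
            amax * (2 * s' + 8 * CE * CN * m') := by
          rw [hm', hs']
          ring
        have f4 : k ^ 2 * (CN * mass T y) = CN * m' := by
          rw [hm']
          ring
        rw [f3] at f1
        rw [f4] at f2
        linarith
      have e6 : CN * m' ≤ amax * (CN * m') := le_mul_of_one_le_left (by positivity) ha1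
      have e7 : s' + m' ≤ nmin⁻¹ * ipk A n k (cell T) y y := by
        rw [le_inv_mul_iff₀ hn0]
        have f1 : nmin * s' ≤ 1 * s' := mul_le_mul_of_nonneg_right hA.nmin_le_one hs
        have f2 : k ^ 2 * (nmin * mass T y) = nmin * m' := by
          rw [hm']
          ring
        rw [f2] at e4
        linarith
      have e8 : 2 * s' + 8 * CE * CN * m' + CN * m' ≤ (2 + 8 * CE * CN + CN) * (s' + m') := by
        have f1 : 0 ≤ (8 * CE * CN + CN) * s' := by positivity
        linarith
      have e9 := mul_le_mul_of_nonneg_left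
        (e8.trans (mul_le_mul_of_nonneg_left e7 (by positivity : 0 ≤ 2 + 8 * CE * CN + CN)))
        (zero_le_one.trans ha1)
      linarith
    have h1 : ∑ j, ipk A n k (region (S j)) (z j) (z j) ≤
        ∑ j, ∑ T ∈ S j, (2 + 8 * CE * CN + CN) * (amax * nmin⁻¹) * ipk A n k (cell T) y y := by
      refine Finset.sum_le_sum fun j _ => ?_
      rw [ipk_region hA k (hS.subset j) (hzV j) (hzV j)]
      exact Finset.sum_le_sum fun T hT' => hcell j T (hS.subset j hT')
    refine h1.trans ?_
    simp only [← Finset.mul_sum]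
    have hn0 := hA.nmin_pos
    have ha1 := zero_le_one.trans hA.one_le_amax
    refine mul_le_mul_of_nonneg_left ?_ (by positivity)
    rw [Mesh.domain, ipk_region hA k subset_rfl hy hy]
    exact sum_sum_le_multiplicity 𝒯 hS fun T hT' => ipk_cell_nonneg hA k hy hT'

end Local

/-! ### The coarse part -/

section Coarse

variable {d : ℕ} {𝒯 : Mesh d} {r : ℕ} {A : Sp d → Matrix (Fin d) (Fin d) ℝ} {n : Sp d → ℝ}
  {amax nmin : ℝ} {N : ℕ} {Sc : Fin N → Finset (Finset (Sp d))}

theorem ipk_cell_congr (k : ℝ) {T : Finset (Sp d)} {u v : Sp d → ℝ}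
    (h : ∀ x ∈ cell T, u x = v x) : ipk A n k (cell T) u u = ipk A n k (cell T) v v := by
  have hg : ∀ x ∈ interior (cell T), gradient u x = gradient v x := fun x hx => by
    have : u =ᶠ[nhds x] v := by
      filter_upwards [isOpen_interior.mem_nhds hx] with y hy using h y (interior_subset hy)
    rw [gradient, gradient, this.fderiv_eq]
  rw [ipk, ipk, aForm, aForm, nForm, nForm]
  congr 1
  · exact integral_congr_ae (ae_cell_of_interior fun x hx => by simp only [hg x hx])
  · congr 1
    exact integral_congr_ae
      (ae_cell_of_interior fun x hx => by simp only [h x (interior_subset hx)])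

/-- Energy of a sum of functions supported in the subdomains of a cover. -/
theorem ipk_sum_le (hA : AdmissibleCoeffs 𝒯.domain A n amax nmin) (k : ℝ) (hSc : IsCover 𝒯 Sc)
    {g : Fin N → Sp d → ℝ} (hg : ∀ i, g i ∈ 𝒯.Vh r) (h0 : ∀ i, ∀ x ∉ region (Sc i), g i x = 0) :
    ipk A n k 𝒯.domain (∑ i, g i) (∑ i, g i) ≤
      multiplicity 𝒯 Sc * ∑ i, ipk A n k (region (Sc i)) (g i) (g i) := by
  classical
  have hsum := Submodule.sum_mem (𝒯.Vh r) (t := Finset.univ) fun i _ => hg i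
  have h1 : ∀ T ∈ 𝒯.elems, ipk A n k (cell T) (∑ i, g i) (∑ i, g i) ≤
      multiplicity 𝒯 Sc * ∑ i, if T ∈ Sc i then ipk A n k (cell T) (g i) (g i) else 0 := by
    intro T hT'
    have e1 : ∀ x ∈ cell T, (∑ i, g i) x = (∑ i with T ∈ Sc i, g i) x := fun x hx => by
      rw [Finset.sum_apply, Finset.sum_apply]
      refine (Finset.sum_filter_of_ne fun i _ hne => ?_).symm
      by_contra hTi
      exact hne (h0 i x fun hxi =>
        hTi (mem_of_mem_cell_of_mem_region 𝒯 (hSc.subset i) hT' hx hxi))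
    rw [ipk_cell_congr k e1, ← Finset.sum_filter]
    refine ((symmBilin_ipk_cell hA k hT').sum_le_card_mul
      (fun u hu => ipk_cell_nonneg hA k hu hT') _ fun i _ => hg i).trans ?_
    exact mul_le_mul_of_nonneg_right (by exact_mod_cast card_filter_le_multiplicity 𝒯 Sc hT')
      (Finset.sum_nonneg fun i _ => ipk_cell_nonneg hA k (hg i) hT')
  rw [Mesh.domain, ipk_region hA k subset_rfl hsum hsum]
  refine (Finset.sum_le_sum h1).trans (le_of_eq ?_)
  rw [← Finset.mul_sum, Finset.sum_comm]
  refine congrArg _ (Finset.sum_congr rfl fun i _ => ?_)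
  rw [ipk_region hA k (hSc.subset i) (hg i) (hg i), ← Finset.sum_filter,
    Finset.filter_mem_eq_inter, Finset.inter_eq_right.2 (hSc.subset i)]

theorem coarsePart_mem_coarseSpace (k : ℝ) (p : Fin N → ℕ → Sp d → ℝ) (m : Fin N → ℕ)
    (v : Sp d → ℝ) : coarsePart 𝒯 r A n k Sc p m v ∈ coarseSpace 𝒯 r Sc p m := by
  refine Submodule.sum_mem _ fun i _ => ?_
  rw [eigProj, Xi_sum]
  refine Submodule.sum_mem _ fun j hj => ?_
  rw [Xi_smul]
  exact Submodule.smul_mem _ _ (Submodule.subset_span ⟨i, j, Finset.mem_Icc.1 hj, rfl⟩)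

theorem coarsePart_mem_Vh (hr : 1 ≤ r) (k : ℝ) (p : Fin N → ℕ → Sp d → ℝ) (m : Fin N → ℕ)
    (v : Sp d → ℝ) : coarsePart 𝒯 r A n k Sc p m v ∈ 𝒯.Vh r :=
  Submodule.sum_mem _ fun i _ => Xi_mem 𝒯 hr i _

theorem sub_coarsePart (hr : 1 ≤ r) (hSc : IsCover 𝒯 Sc) (k : ℝ) (p : Fin N → ℕ → Sp d → ℝ)
    (m : Fin N → ℕ) {v : Sp d → ℝ} (hv : v ∈ 𝒯.Vh r) :
    v - coarsePart 𝒯 r A n k Sc p m v = ∑ i, Xi 𝒯 r Sc i (restr (region (Sc i)) v -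
      eigProj (cForm 𝒯 r A n k Sc i) (p i) (m i) (restr (region (Sc i)) v)) := by
  simp only [Xi_sub, Finset.sum_sub_distrib, Xi_restr 𝒯 hr (hSc.subset _), sum_Xi 𝒯 hr hSc hv,
    coarsePart]

theorem Theta_nonneg {lam : Fin N → ℕ → ℝ} {m : Fin N → ℕ} (h : ∀ i, 0 < lam i (m i + 1)) :
    0 ≤ Theta lam m :=
  one_div_nonneg.2 (Real.iInf_nonneg fun i => (h i).le)

theorem le_Theta_mul {lam : Fin N → ℕ → ℝ} {m : Fin N → ℕ} (h : ∀ i, 0 < lam i (m i + 1))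
    (i : Fin N) {x y : ℝ} (hx : 0 ≤ x) (hxy : lam i (m i + 1) * x ≤ y) : x ≤ Theta lam m * y := by
  have : Nonempty (Fin N) := ⟨i⟩
  obtain ⟨i₀, hi₀⟩ := exists_eq_ciInf_of_finite (f := fun i => lam i (m i + 1))
  have h1 : ⨅ i, lam i (m i + 1) ≤ lam i (m i + 1) := ciInf_le (Set.finite_range _).bddBelow i
  have h2 : 0 < ⨅ i, lam i (m i + 1) := hi₀ ▸ h i₀
  rw [Theta, one_div, le_inv_mul_iff₀ h2]
  exact (mul_le_mul_of_nonneg_right h1 hx).trans hxy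

/-- The error of the coarse approximation is stable. -/
theorem ipk_sub_coarsePart_le (hd : 1 ≤ d) (hr : 1 ≤ r)
    (hA : AdmissibleCoeffs 𝒯.domain A n amax nmin) {k : ℝ} (hk : 0 < k) (hSc : IsCover 𝒯 Sc)
    {CE CN CP Cinv : ℝ} (hCE : 0 < CE) (hCN : 0 < CN) (hCP : 0 < CP)
    (hCinv : 1 ≤ Cinv) (hI : InverseEstimate 𝒯 r k Cinv)
    (hE : ∀ T ∈ 𝒯.elems, ∀ f ∈ 𝒯.Vh r, ElementEstimates 𝒯 r CE T f)
    (hN : ∀ T ∈ 𝒯.elems, ∀ f ∈ 𝒯.Vh r, ∀ g ∈ 𝒯.Vh r, ∀ κ : ℝ, 0 ≤ κ →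
      (∀ l ∈ 𝒯.nodes r, l ∈ cell T → |f l| ≤ κ * |g l|) → mass T f ≤ CN * κ ^ 2 * mass T g)
    (hP : ∀ i, ∀ w ∈ 𝒯.Vh r, (∀ l ∈ 𝒯.nodes r, l ∈ region (Sc i) → w l = 0) →
      ∑ T ∈ Sc i, mass T w ≤ CP * ∑ T ∈ Sc i, hT T ^ 2 * stiff T w)
    (hkh : 8 * CP * (k * 𝒯.size) ^ 2 ≤ 1) (hΛ : 1 ≤ multiplicity 𝒯 Sc)
    {q : Fin N → ℕ} {p : Fin N → ℕ → Sp d → ℝ} {lam : Fin N → ℕ → ℝ}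
    (h : ∀ i, IsEigenSystem (𝒯.VTilde r (region (Sc i))) (bForm A n k (region (Sc i)))
      (cForm 𝒯 r A n k Sc i) (q i) (p i) (lam i))
    {m : Fin N → ℕ} (hm : ∀ i, m i + 1 ≤ q i) (hlam : ∀ i, 0 < lam i (m i + 1))
    {v : Sp d → ℝ} (hv : v ∈ 𝒯.Vh r) :
    ipk A n k 𝒯.domain (v - coarsePart 𝒯 r A n k Sc p m v) (v - coarsePart 𝒯 r A n k Sc p m v) ≤
      (multiplicity 𝒯 Sc : ℝ) ^ 2 * ((2 * ((4 * CP * CE + 2) * CN) * CN + 2) *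
        (Cstar (multiplicity 𝒯 Sc) amax nmin Cinv * Theta lam m)) * ipk A n k 𝒯.domain v v := by
  rw [sub_coarsePart hr hSc k p m hv]
  refine (ipk_sum_le hA k hSc (fun i => Xi_mem 𝒯 hr i _)
    fun i x hx => Xi_apply_of_notMem 𝒯 hr i _ hx).trans ?_
  have h1 : ∀ i, ipk A n k (region (Sc i))
      (Xi 𝒯 r Sc i (restr (region (Sc i)) v -
        eigProj (cForm 𝒯 r A n k Sc i) (p i) (m i) (restr (region (Sc i)) v)))
      (Xi 𝒯 r Sc i (restr (region (Sc i)) v -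
        eigProj (cForm 𝒯 r A n k Sc i) (p i) (m i) (restr (region (Sc i)) v))) ≤
      Theta lam m * ((2 * ((4 * CP * CE + 2) * CN) * CN + 2) *
        Cstar (multiplicity 𝒯 Sc) amax nmin Cinv) * ∑ T ∈ Sc i, ipk A n k (cell T) v v := by
    intro i
    rw [← ipk_region hA k (hSc.subset i) hv hv, mul_assoc]
    exact le_Theta_mul hlam i (ipk_region_nonneg hA k (hSc.subset i) (Xi_mem 𝒯 hr i _))
      (lam_mul_cForm_le hd hr hA hk hSc hCE hCN hCP hCinv hI hE hN (hP i) hkh hΛ (h i) (hm i) hv)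
  have h2 := Finset.sum_le_sum fun i (_ : i ∈ Finset.univ) => h1 i
  rw [← Finset.mul_sum] at h2
  have h3 := sum_sum_le_multiplicity 𝒯 hSc fun T hT' => ipk_cell_nonneg hA k hv hT'
  rw [← ipk_region hA k subset_rfl hv hv] at h3
  have hn0 := hA.nmin_pos
  have hC : 0 ≤ Theta lam m * ((2 * ((4 * CP * CE + 2) * CN) * CN + 2) *
      Cstar (multiplicity 𝒯 Sc) amax nmin Cinv) := by
    have := Theta_nonneg hlam
    rw [Cstar, Ceig]
    positivity
  have h4 := mul_le_mul_of_nonneg_left (h2.trans (mul_le_mul_of_nonneg_left h3 hC))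
    (Nat.cast_nonneg (α := ℝ) (multiplicity 𝒯 Sc))
  refine h4.trans (le_of_eq ?_)
  rw [Mesh.domain]
  ring

theorem Vh_eq_zero_of_elems_eq_empty (h : 𝒯.elems = ∅) {v : Sp d → ℝ} (hv : v ∈ 𝒯.Vh r) :
    v = 0 := by
  funext x
  refine Vh_eq_zero 𝒯 hv ?_
  simp [Mesh.domain, region, h]

end Coarse

end HkGenEO

end

open HkGenEO in
theorem lemma3p10 (d : ℕ) (hd : d = 2 ∨ d = 3) (r : ℕ) (hr : 1 ≤ r)
    (CSR : ℝ) (hCSR : 0 < CSR) (M : ℕ) :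
    ∃ C₁ : ℝ, 0 < C₁ ∧ ∃ C₃ : ℝ, 1 ≤ C₃ ∧
      ∀ (𝒯 : Mesh d), 𝒯.ShapeRegular CSR →
      ∀ (A : Sp d → Matrix (Fin d) (Fin d) ℝ) (n : Sp d → ℝ) (amax nmin : ℝ),
        AdmissibleCoeffs 𝒯.domain A n amax nmin →
      ∀ k : ℝ, 0 < k → (k * 𝒯.size) ^ 2 ≤ C₁ →
      ∀ Cinv : ℝ, 1 ≤ Cinv → InverseEstimate 𝒯 r k Cinv →
      ∀ (Q : ℕ) (Sl : Fin Q → Finset (Finset (Sp d))), IsCover 𝒯 Sl →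
      ∀ δ : ℝ, k⁻¹ ≤ δ → HasOverlap 𝒯 Sl δ →
      ∀ (N : ℕ) (Sc : Fin N → Finset (Finset (Sp d))), IsCover 𝒯 Sc →
        (∀ i, InteriorReach 𝒯 r M (Sc i)) →
      ∀ (q : Fin N → ℕ) (p : Fin N → ℕ → Sp d → ℝ) (lam : Fin N → ℕ → ℝ),
        (∀ i, IsEigenSystem (𝒯.VTilde r (region (Sc i))) (bForm A n k (region (Sc i)))
          (cForm 𝒯 r A n k Sc i) (q i) (p i) (lam i)) →
      ∀ m : Fin N → ℕ, (∀ i, 1 ≤ m i ∧ m i + 1 ≤ q i ∧ 0 < lam i (m i + 1)) →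
      ∀ v ∈ 𝒯.Vh r,
        coarsePart 𝒯 r A n k Sc p m v ∈ coarseSpace 𝒯 r Sc p m ∧
        ∃ z : Fin Q → Sp d → ℝ,
          (∀ j, z j ∈ 𝒯.V r (region (Sl j))) ∧
          v = coarsePart 𝒯 r A n k Sc p m v + ∑ j, z j ∧
          normk A n k 𝒯.domain (coarsePart 𝒯 r A n k Sc p m v) ^ 2 +
              ∑ j, normk A n k (region (Sl j)) (z j) ^ 2 ≤
            C₃ * (1 + (multiplicity 𝒯 Sl : ℝ) * (multiplicity 𝒯 Sc : ℝ) ^ 2 * amax * nmin⁻¹ *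
              Cstar (multiplicity 𝒯 Sc) amax nmin Cinv * Theta lam m) *
              normk A n k 𝒯.domain v ^ 2 := by
  have hd1 : 1 ≤ d := by omega
  obtain ⟨CE, hCE, HE⟩ := exists_elementEstimates d r hd1 hCSR
  obtain ⟨CN, hCN1, HN⟩ := exists_mass_le_of_nodal_le d r hd1 hr hCSR
  obtain ⟨CP, hCP, HP⟩ := exists_poincare d r M hd1 hr hCSR
  have hCN : 0 < CN := zero_lt_one.trans_le hCN1
  set K₀ : ℝ := 2 * ((4 * CP * CE + 2) * CN) * CN + 2 with hK₀
  set K₁ : ℝ := 2 + 8 * CE * CN + CN with hK₁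
  have hK₀0 : 0 < K₀ := by positivity
  have hK₁0 : 0 < K₁ := by positivity
  refine ⟨(8 * CP)⁻¹, by positivity, 2 + (2 + K₁) * K₀, by nlinarith [mul_pos hK₁0 hK₀0],
    fun 𝒯 hSR A n amax nmin hA k hk hkh Cinv hCinv hI Q Sl hSl δ hδ hov N Sc hSc hreach q p lam
      hsys m hm v hv => ⟨coarsePart_mem_coarseSpace k p m v, ?_⟩⟩
  have hz₀ : coarsePart 𝒯 r A n k Sc p m v ∈ 𝒯.Vh r := coarsePart_mem_Vh hr k p m v
  rcases 𝒯.elems.eq_empty_or_nonempty with hemp | hne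
  · refine ⟨0, fun j => Submodule.zero_mem _, ?_, ?_⟩
    · rw [Vh_eq_zero_of_elems_eq_empty hemp hz₀, Vh_eq_zero_of_elems_eq_empty hemp hv]
      simp
    · have hnorm : ∀ u ∈ 𝒯.Vh r, normk A n k 𝒯.domain u ^ 2 = 0 := fun u hu => by
        rw [Mesh.domain, normk_sq hA k subset_rfl hu, ipk_region hA k subset_rfl hu hu, hemp,
          Finset.sum_empty]
      have hnorm' : ∀ j, normk A n k (region (Sl j)) ((0 : Fin Q → Sp d → ℝ) j) ^ 2 = 0 :=
        fun j => by
          have h0 := Submodule.zero_mem (𝒯.Vh r)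
          rw [Pi.zero_apply, normk_sq hA k (hSl.subset j) h0,
            ipk_region hA k (hSl.subset j) h0 h0,
            Finset.subset_empty.1 ((hSl.subset j).trans hemp.subset), Finset.sum_empty]
      rw [hnorm _ hz₀, hnorm v hv]
      simp only [hnorm']
      simp
  have hy := Submodule.sub_mem _ hv hz₀
  obtain ⟨z, hzVh, hzV, hyz, hzle⟩ := exists_local_decomposition hd1 hr hA hk hCE hCN
    (HE 𝒯 hSR) (HN 𝒯 hSR) hSl hδ hov hy
  refine ⟨z, hzV, ?_, ?_⟩
  · rw [← hyz, add_sub_cancel]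
  have hyle := ipk_sub_coarsePart_le hd1 hr hA hk hSc hCE hCN hCP hCinv hI (HE 𝒯 hSR) (HN 𝒯 hSR)
    (fun i => HP 𝒯 hSR (Sc i) (hSc.subset i) (hreach i))
    ((le_inv_mul_iff₀ (by positivity)).1 (by rwa [mul_one]))
    (one_le_multiplicity 𝒯 hSc hne) hsys (fun i => (hm i).2.1) (fun i => (hm i).2.2) hv
  have hzz := (symmBilin_ipk (r := r) hA k (subset_refl 𝒯.elems)).apply_sub_le
    (fun u hu => ipk_region_nonneg hA k subset_rfl hu) hv hy
  rw [sub_sub_cancel] at hzz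
  have hv0 := ipk_region_nonneg hA k (subset_refl 𝒯.elems) hv
  have hy0 := ipk_region_nonneg hA k (subset_refl 𝒯.elems) hy
  rw [Mesh.domain] at hyle hzle ⊢
  rw [normk_sq hA k subset_rfl hz₀, normk_sq hA k subset_rfl hv,
    Finset.sum_congr rfl fun j _ => normk_sq hA k (hSl.subset j) (hzVh j)]
  set z₀ := coarsePart 𝒯 r A n k Sc p m v with hz₀def
  set Y := ipk A n k (region 𝒯.elems) (v - z₀) (v - z₀) with hY
  set X := ipk A n k (region 𝒯.elems) v v with hX
  set G : ℝ := amax * nmin⁻¹ * (multiplicity 𝒯 Sl : ℝ) with hG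
  set P : ℝ := Cstar (multiplicity 𝒯 Sc) amax nmin Cinv * Theta lam m with hP
  have hG1 : 1 ≤ G := by
    have h1 : (1 : ℝ) ≤ multiplicity 𝒯 Sl := by exact_mod_cast one_le_multiplicity 𝒯 hSl hne
    exact one_le_mul_of_one_le_of_one_le (one_le_mul_of_one_le_of_one_le hA.one_le_amax
      ((one_le_inv₀ hA.nmin_pos).2 hA.nmin_le_one)) h1
  have hP0 : 0 ≤ P := by
    have h1 := Theta_nonneg fun i => (hm i).2.2
    have h2 := hA.nmin_pos
    rw [hP, Cstar, Ceig]
    positivity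
  have hYG : Y ≤ G * Y := le_mul_of_one_le_left hy0 hG1
  have hR0 : 0 ≤ G * ((multiplicity 𝒯 Sc : ℝ) ^ 2 * P) * X := by positivity
  have hGY := mul_le_mul_of_nonneg_left hyle (by positivity : 0 ≤ (2 + K₁) * G)
  have hfin : (2 + (2 + K₁) * K₀) * (1 + (multiplicity 𝒯 Sl : ℝ) * (multiplicity 𝒯 Sc : ℝ) ^ 2 *
      amax * nmin⁻¹ * Cstar (multiplicity 𝒯 Sc) amax nmin Cinv * Theta lam m) * X =
      (2 + (2 + K₁) * K₀) * X +
        (2 + (2 + K₁) * K₀) * (G * ((multiplicity 𝒯 Sc : ℝ) ^ 2 * P) * X) := by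
    rw [hG, hP]
    ring
  rw [hfin]
  have hX1 : 0 ≤ (2 + K₁) * K₀ * X := by positivity
  linarith
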